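/- Let $X$ be a standard Borel space, $\mu$ a Borel probability measure on $X$, and $R$ a countable Borel equivalence relation on $X$ (Borel as a subset of $X\times X$, with countable classes). Let $[[R]]_B$ be the set of partial Borel isomorphisms $g:\operatorname{dom}g\to\operatorname{ran}g$ between Borel subsets of $X$ with $(x,gx)\in R$ for all $x\in\operatorname{dom}g$, with composition of partial maps as product, and assume that $\mu$ is $R$-invariant: $\mu(g(A))=\mu(A)$ for all $g\in[[R]]_B$ and all Borel $A\subseteq\operatorname{dom}g$. The full semigroup $[[R]]$ is the metric quotient of $[[R]]_B$ under the pseudometric $$d_\mu(g,h)=\mu(\operatorname{dom}g\,\triangle\,\operatorname{dom}h)+\mu\{x\in\operatorname{dom}g\cap\operatorname{dom}h: gx\ne hx\},$$ and the full group $[R]$ is the image in $[[R]]$ of the set of those $g\in[[R]]_B$ with $\operatorname{dom}g=\operatorname{ran}g=X$, with the metric $d_\mu$. Put $\operatorname{tr}(g)=\mu\{x\in\operatorname{dom}g:gx=x\}$. For $n\ge 1$, let $[[n]]$ be the semigroup of partial bijections of $\{0,\dots,n-1\}$ and $\mathfrak S_n\subseteq[[n]]$ the symmetric group, with the metric $d_\#$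 and trace $\operatorname{tr}_\#$ given by the same formulas for the normalized counting measure. $R$ is *sofic* if for every finite $K\subseteq[[R]]$ and every $\varepsilon>0$ there are $N\ge1$ and a map $\pi:[[R]]\to[[N]]$ such that $\pi(\mathrm{id}_X)=\mathrm{id}$, $\pi(\varnothing)=\varnothing$, $d_\#(\pi(\varphi\psi),\pi(\varphi)\pi(\psi))<\varepsilon$ for all $\varphi,\psi\in K$, and $|\operatorname{tr}(\varphi)-\operatorname{tr}_\#(\pi(\varphi))|<\varepsilon$ for all $\varphi\in K$. For a free ultrafilter $\mathcal U$ on $\mathbb N$ and a sequence of integers $n_k\ge1$, let $\prod_{\mathcal U}\mathfrak S_{n_k}$ be the group obtained as the metric quotient of $\prod_k\mathfrak S_{n_k}$ under the pseudometric $d_{\mathcal U}((\sigma_k),(\tau_k))=\lim_{k\to\mathcal U}d_\#(\sigma_k,\tau_k)$. The full group $[R]$ is *metrically sofic* (with respect to $\mathcal U$) if for some sequence $(n_k)$ there is an isometric group homomorphism $[R]\to\prod_{\mathcal U}\mathfrak S_{n_k}$. **Theorem.** Suppose that $R$ has no singleton classes, up to a $\mu$-null set: for $\mu$-almost every $x\in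 X$ the class $R(x)$ has at least two elements. Then, for every free ultrafilter $\mathcal U$ on $\mathbb N$, $R$ is sofic if and only if $[R]$ is metrically sofic with respect to $\mathcal U$. -/

import Mathlib

namespace SoficRel

open MeasureTheory Filter Topology

/-- The domain of a partial bijection. -/
def dom {X : Type*} (g : X ≃. X) : Set X := {x | ∃ y, g x = some y}

/-- The image `g(A)` of a set under a partial bijection. -/
def image {X : Type*} (g : X ≃. X) (A : Set X) : Set X := {y | ∃ x ∈ A, g x = some y}

/-- `g : dom g → ran g` is a partial Borel isomorphism: images and preimages of Borel sets under `g`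
are Borel (in particular, `dom g` and `ran g` are Borel). -/
def IsPartialBorelIso {X : Type*} [MeasurableSpace X] (g : X ≃. X) : Prop :=
  (∀ B : Set X, MeasurableSet B → MeasurableSet (image g B)) ∧
    ∀ B : Set X, MeasurableSet B → MeasurableSet (image g.symm B)

/-- Membership in the Borel full semigroup of `r`: partial Borel isomorphisms `g` with
`(x, g x) ∈ r` for every `x` in the domain. -/
def MemBorelFullSemigroup {X : Type*} [MeasurableSpace X] (r : Setoid X) (g : X ≃. X) : Prop :=
  IsPartialBorelIso g ∧ ∀ x y, g x = some y → r x y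

/-- A countable Borel equivalence relation on `X` for which the measure `μ` is invariant. -/
structure PMPRelation (X : Type*) [MeasurableSpace X] (μ : Measure X) where
  /-- the equivalence relation -/
  rel : Setoid X
  measurableSet_rel : MeasurableSet {p : X × X | rel p.1 p.2}
  countable_class : ∀ x, {y | rel x y}.Countable
  invariant : ∀ g : X ≃. X, MemBorelFullSemigroup rel g →
    ∀ A : Set X, MeasurableSet A → A ⊆ dom g → μ (image g A) = μ A

/-! ### Partial bijections -/

theorem image_refl {X : Type*} (A : Set X) : image (PEquiv.refl X) A = A := by
  ext y; simp [image]

theorem image_bot {X : Type*} (A : Set X) : image (⊥ : X ≃. X) A = ∅ := by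
  ext y; simp [image]

theorem image_trans {X : Type*} (g h : X ≃. X) (A : Set X) :
    image (g.trans h) A = image h (image g A) := by
  ext z
  simp only [image, Set.mem_ofPred_eq]
  constructor
  · rintro ⟨x, hx, hxz⟩
    obtain ⟨y, hy, hz⟩ := (PEquiv.trans_eq_some g h x z).1 hxz
    exact ⟨y, ⟨x, hx, hy⟩, hz⟩
  · rintro ⟨y, ⟨x, hx, hy⟩, hz⟩
    exact ⟨x, hx, (PEquiv.trans_eq_some g h x z).2 ⟨y, hy, hz⟩⟩

theorem symm_trans_rev' {X : Type*} (g h : X ≃. X) : (g.trans h).symm = h.symm.trans g.symm := rfl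

theorem memBorelFullSemigroup_refl {X : Type*} [MeasurableSpace X] (r : Setoid X) :
    MemBorelFullSemigroup r (PEquiv.refl X) := by
  refine ⟨⟨fun B hB => ?_, fun B hB => ?_⟩, fun x y h => ?_⟩
  · rwa [image_refl]
  · rwa [PEquiv.symm_refl, image_refl]
  · rw [PEquiv.refl_apply, Option.some.injEq] at h
    exact h ▸ r.refl x

theorem memBorelFullSemigroup_bot {X : Type*} [MeasurableSpace X] (r : Setoid X) :
    MemBorelFullSemigroup r (⊥ : X ≃. X) := by
  refine ⟨⟨fun B _ => ?_, fun B _ => ?_⟩, fun x y h => ?_⟩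
  · rw [image_bot]; exact MeasurableSet.empty
  · rw [PEquiv.symm_bot, image_bot]; exact MeasurableSet.empty
  · simp at h

theorem MemBorelFullSemigroup.symm {X : Type*} [MeasurableSpace X] {r : Setoid X} {g : X ≃. X}
    (hg : MemBorelFullSemigroup r g) : MemBorelFullSemigroup r g.symm :=
  ⟨⟨hg.1.2, hg.1.1⟩, fun _ _ h => r.symm (hg.2 _ _ (g.eq_some_iff.1 h))⟩

theorem MemBorelFullSemigroup.trans {X : Type*} [MeasurableSpace X] {r : Setoid X} {g h : X ≃. X}
    (hg : MemBorelFullSemigroup r g) (hh : MemBorelFullSemigroup r h) :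
    MemBorelFullSemigroup r (g.trans h) := by
  refine ⟨⟨fun B hB => ?_, fun B hB => ?_⟩, fun x z hxz => ?_⟩
  · rw [image_trans]; exact hh.1.1 _ (hg.1.1 _ hB)
  · rw [symm_trans_rev', image_trans]; exact hg.1.2 _ (hh.1.2 _ hB)
  · obtain ⟨y, hy, hz⟩ := (PEquiv.trans_eq_some g h x z).1 hxz
    exact r.trans (hg.2 _ _ hy) (hh.2 _ _ hz)

/-! ### The full semigroup -/

/-- The Borel full semigroup of `R`. -/
def BorelFullSemigroup {X : Type*} [MeasurableSpace X] {μ : Measure X} (R : PMPRelation X μ) :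
    Type _ := {g : X ≃. X // MemBorelFullSemigroup R.rel g}

/-- The product is composition, `(h g)(x) = h (g x)`; the unit is the identity of `X`. -/
instance {X : Type*} [MeasurableSpace X] {μ : Measure X} (R : PMPRelation X μ) :
    Monoid (BorelFullSemigroup R) where
  mul h g := ⟨g.1.trans h.1, g.2.trans h.2⟩
  one := ⟨PEquiv.refl X, memBorelFullSemigroup_refl R.rel⟩
  mul_assoc a b c := Subtype.ext (PEquiv.trans_assoc c.1 b.1 a.1).symm
  one_mul a := Subtype.ext (PEquiv.trans_refl a.1)
  mul_one a := Subtype.ext (PEquiv.refl_trans a.1)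

instance {X : Type*} [MeasurableSpace X] {μ : Measure X} (R : PMPRelation X μ) :
    Inv (BorelFullSemigroup R) where
  inv g := ⟨g.1.symm, g.2.symm⟩

/-- The empty partial map. -/
instance {X : Type*} [MeasurableSpace X] {μ : Measure X} (R : PMPRelation X μ) :
    Zero (BorelFullSemigroup R) where
  zero := ⟨⊥, memBorelFullSemigroup_bot R.rel⟩

/-- Equality of values in `Option X` handles the domains: `g x ≠ h x` says that `x` lies in exactly
one of the domains, or in both and is sent to different points. -/
theorem setOf_ne_eq {X : Type*} (g h : X ≃. X) :
    {x | g x ≠ h x} = symmDiff (dom g) (dom h) ∪ {x | x ∈ dom g ∩ dom h ∧ g x ≠ h x} := by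
  ext x
  cases hg : g x <;> cases hh : h x <;> simp [dom, Set.mem_symmDiff, hg, hh]

/-- A set has measure at least that of its inverse image under an element of the semigroup. -/
theorem PMPRelation.measure_image_symm_le {X : Type*} [MeasurableSpace X] {μ : Measure X}
    (R : PMPRelation X μ) {g : X ≃. X} (hg : MemBorelFullSemigroup R.rel g) (N : Set X) :
    μ (image g.symm N) ≤ μ N := by
  have hdom : image g.symm (toMeasurable μ N) ⊆ dom g := by
    rintro x ⟨y, _, hy⟩
    exact ⟨y, g.eq_some_iff.1 hy⟩
  calc μ (image g.symm N) ≤ μ (image g.symm (toMeasurable μ N)) :=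
        measure_mono fun x ⟨y, hy, h⟩ => ⟨y, subset_toMeasurable μ N hy, h⟩
    _ = μ (image g (image g.symm (toMeasurable μ N))) :=
        (R.invariant g hg _ (hg.1.2 _ (measurableSet_toMeasurable μ N)) hdom).symm
    _ ≤ μ (toMeasurable μ N) := by
        refine measure_mono ?_
        rintro z ⟨x, ⟨y, hy, hxy⟩, hxz⟩
        rw [g.eq_some_iff.1 hxy, Option.some.injEq] at hxz
        exact hxz ▸ hy
    _ = μ N := measure_toMeasurable N

/-- The Borel full group: the elements of the Borel full semigroup whose domain and range are `X`. -/
def borelFullGroup {X : Type*} [MeasurableSpace X] {μ : Measure X} 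
    (R : PMPRelation X μ) : Submonoid (BorelFullSemigroup R) where
  carrier := {g | dom g.1 = Set.univ ∧ image g.1 Set.univ = Set.univ}
  one_mem' := by
    refine ⟨Set.eq_univ_of_forall fun x => ⟨x, rfl⟩, image_refl _⟩
  mul_mem' := by
    rintro h g ⟨hh, hh'⟩ ⟨hg, hg'⟩
    refine ⟨Set.eq_univ_of_forall fun x => ?_, ?_⟩
    · obtain ⟨y, hy⟩ : x ∈ dom g.1 := hg ▸ Set.mem_univ x
      obtain ⟨z, hz⟩ : y ∈ dom h.1 := hh ▸ Set.mem_univ y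
      exact ⟨z, (PEquiv.trans_eq_some g.1 h.1 x z).2 ⟨y, hy, hz⟩⟩
    · change image (g.1.trans h.1) Set.univ = Set.univ
      rw [image_trans, hg', hh']

theorem inv_mem_borelFullGroup {X : Type*} [MeasurableSpace X] {μ : Measure X} 
    {R : PMPRelation X μ} {g : BorelFullSemigroup R}
    (hg : g ∈ borelFullGroup R) : g⁻¹ ∈ borelFullGroup R := by
  refine ⟨Set.eq_univ_of_forall fun y => ?_, Set.eq_univ_of_forall fun x => ?_⟩
  · obtain ⟨x, -, hx⟩ : y ∈ image g.1 Set.univ := hg.2.symm.subset (Set.mem_univ y)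
    exact ⟨x, g.1.eq_some_iff.2 hx⟩
  · obtain ⟨y, hy⟩ : x ∈ dom g.1 := hg.1 ▸ Set.mem_univ x
    exact ⟨y, trivial, g.1.eq_some_iff.2 hy⟩

theorem inv_mul_cancel_of_mem_borelFullGroup {X : Type*} [MeasurableSpace X] {μ : Measure X} 
    {R : PMPRelation X μ} {g : BorelFullSemigroup R}
    (hg : g ∈ borelFullGroup R) : g⁻¹ * g = 1 := by
  refine Subtype.ext (PEquiv.ext fun x => ?_)
  obtain ⟨y, hy⟩ : x ∈ dom g.1 := hg.1 ▸ Set.mem_univ x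
  exact (PEquiv.trans_eq_some g.1 g.1.symm x x).2 ⟨y, hy, g.1.eq_some_iff.2 hy⟩

section

variable {X : Type*} [MeasurableSpace X] {μ : Measure X} [IsProbabilityMeasure μ]

/-- The pseudometric `d_μ(g, h) = μ (dom g ∆ dom h) + μ {x ∈ dom g ∩ dom h | g x ≠ h x}`
(see `BorelFullSemigroup.dist_eq`). -/
noncomputable instance BorelFullSemigroup.instPseudoMetricSpace (R : PMPRelation X μ) :
    PseudoMetricSpace (BorelFullSemigroup R) where
  dist g h := μ.real {x | g.1 x ≠ h.1 x}
  dist_self g := by simp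
  dist_comm g h := by simp only [ne_comm]
  dist_triangle f g h := by
    refine (measureReal_mono ?_).trans (measureReal_union_le _ _)
    intro x hx
    by_contra hc
    simp only [Set.mem_union, Set.mem_ofPred_eq, not_or, not_not] at hc
    exact hx (hc.1.trans hc.2)

theorem BorelFullSemigroup.dist_def (R : PMPRelation X μ) (g h : BorelFullSemigroup R) :
    dist g h = μ.real {x | g.1 x ≠ h.1 x} := rfl

theorem measurableSet_dom {g : X ≃. X} (hg : IsPartialBorelIso g) : MeasurableSet (dom g) := by
  have h : dom g = image g.symm Set.univ := by
    ext x
    simp [dom, image, g.eq_some_iff]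
  exact h ▸ hg.2 _ MeasurableSet.univ

theorem BorelFullSemigroup.dist_eq (R : PMPRelation X μ) (g h : BorelFullSemigroup R) :
    dist g h = μ.real (symmDiff (dom g.1) (dom h.1)) +
      μ.real {x | x ∈ dom g.1 ∩ dom h.1 ∧ g.1 x ≠ h.1 x} := by
  rw [dist_def, setOf_ne_eq, measureReal_union']
  · rw [Set.disjoint_left]
    rintro x hx ⟨hx', _⟩
    rw [Set.mem_symmDiff] at hx
    rcases hx with hx | hx
    · exact hx.2 hx'.2
    · exact hx.2 hx'.1
  · exact (measurableSet_dom g.2.1).symmDiff (measurableSet_dom h.2.1)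

theorem BorelFullSemigroup.dist_mul_mul_le (R : PMPRelation X μ) (g g' h h' : BorelFullSemigroup R) :
    dist (h * g) (h' * g') ≤ dist h h' + dist g g' := by
  have hsub : {x | (h * g).1 x ≠ (h' * g').1 x} ⊆
      image g.1.symm {y | h.1 y ≠ h'.1 y} ∪ {x | g.1 x ≠ g'.1 x} := by
    intro x hx
    by_cases hgg : g.1 x = g'.1 x
    · left
      change (g.1 x).bind h.1 ≠ (g'.1 x).bind h'.1 at hx
      rw [← hgg] at hx
      cases hy : g.1 x with
      | none => simp [hy] at hx
      | some y =>
        rw [hy] at hx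
        exact ⟨y, hx, g.1.eq_some_iff.2 hy⟩
    · exact Or.inr hgg
  refine (measureReal_mono hsub).trans ((measureReal_union_le _ _).trans ?_)
  gcongr
  · exact ENNReal.toReal_mono (measure_ne_top μ _) (R.measure_image_symm_le g.2 _)
  · exact le_rfl

theorem BorelFullSemigroup.dist_inv_inv_le (R : PMPRelation X μ) (g h : BorelFullSemigroup R) :
    dist g⁻¹ h⁻¹ ≤ 2 * dist g h := by
  have hsub : {y | g⁻¹.1 y ≠ h⁻¹.1 y} ⊆
      image g.1 {x | g.1 x ≠ h.1 x} ∪ image h.1 {x | g.1 x ≠ h.1 x} := by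
    intro y hy
    change g.1.symm y ≠ h.1.symm y at hy
    cases hx : g.1.symm y with
    | some x =>
      refine Or.inl ⟨x, fun hgh => hy ?_, g.1.eq_some_iff.1 hx⟩
      rw [hx]
      exact (h.1.eq_some_iff.2 (hgh ▸ g.1.eq_some_iff.1 hx)).symm
    | none =>
      cases hz : h.1.symm y with
      | none => exact absurd (hx.trans hz.symm) hy
      | some z =>
        refine Or.inr ⟨z, fun hgh => hy ?_, h.1.eq_some_iff.1 hz⟩
        rw [hz]
        exact g.1.eq_some_iff.2 (hgh.trans (h.1.eq_some_iff.1 hz))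
  refine (measureReal_mono hsub).trans ((measureReal_union_le _ _).trans ?_)
  rw [two_mul]
  exact add_le_add
    (ENNReal.toReal_mono (measure_ne_top μ _) (R.measure_image_symm_le g.2.symm _))
    (ENNReal.toReal_mono (measure_ne_top μ _) (R.measure_image_symm_le h.2.symm _))

instance (R : PMPRelation X μ) : ContinuousMul (BorelFullSemigroup R) where
  continuous_mul := by
    refine (LipschitzWith.of_dist_le_mul (K := 2) fun p q => ?_).continuous
    refine (BorelFullSemigroup.dist_mul_mul_le R _ _ _ _).trans ?_
    rw [NNReal.coe_ofNat, two_mul, Prod.dist_eq]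
    exact add_le_add (le_max_left _ _) (le_max_right _ _)

instance (R : PMPRelation X μ) : ContinuousInv (BorelFullSemigroup R) where
  continuous_inv :=
    (LipschitzWith.of_dist_le_mul (K := 2) fun g h =>
      BorelFullSemigroup.dist_inv_inv_le R g h).continuous

/-- The (measured) full semigroup of `R`: the metric quotient of the Borel full semigroup, with the
induced product, unit, zero (the class of the empty map), inverse and metric. -/
abbrev FullSemigroup (R : PMPRelation X μ) : Type _ := SeparationQuotient (BorelFullSemigroup R)

/-- The trace `μ {x ∈ dom g | g x = x}`. -/
noncomputable def FullSemigroup.tr {R : PMPRelation X μ} : FullSemigroup R → ℝ :=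
  SeparationQuotient.lift (fun g : BorelFullSemigroup R => μ.real {x | g.1 x = some x}) (by
    have key : ∀ g h : BorelFullSemigroup R, dist g h = 0 →
        μ.real {x | g.1 x = some x} ≤ μ.real {x | h.1 x = some x} := by
      intro g h hgh
      have hsub : {x | g.1 x = some x} ⊆ {x | h.1 x = some x} ∪ {x | g.1 x ≠ h.1 x} := by
        intro x hx
        by_cases hxx : g.1 x = h.1 x
        · exact Or.inl (hxx.symm.trans hx)
        · exact Or.inr hxx
      have h1 := (measureReal_mono (μ := μ) hsub).trans (measureReal_union_le _ _)
      rw [BorelFullSemigroup.dist_def] at hgh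
      rwa [hgh, add_zero] at h1
    intro g h hgh
    rw [Metric.inseparable_iff] at hgh
    exact le_antisymm (key g h hgh) (key h g (by rwa [dist_comm])))

/-- The (measured) full group `[R]`: the image of the Borel full group in the full semigroup, with
the product and the metric of the full semigroup. -/
noncomputable def fullGroup (R : PMPRelation X μ) : Submonoid (FullSemigroup R) :=
  (borelFullGroup R).map SeparationQuotient.mkMonoidHom

noncomputable instance (R : PMPRelation X μ) : Group (fullGroup R) where
  inv φ := ⟨φ.1⁻¹, by
    obtain ⟨g, hg, hgφ⟩ := φ.2
    exact ⟨g⁻¹, inv_mem_borelFullGroup hg, hgφ ▸ rfl⟩⟩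
  inv_mul_cancel φ := by
    obtain ⟨φ, g, hg, rfl⟩ := φ
    exact Subtype.ext
      (congrArg SeparationQuotient.mk (inv_mul_cancel_of_mem_borelFullGroup hg))

/-! ### Soficity -/

/-- The normalized Hamming distance on the semigroup `[[n]]` of partial bijections of an `n`-element
set, i.e. `d_μ` for the normalized counting measure `μ`. -/
noncomputable def pbijDist {n : ℕ} (f g : Fin n ≃. Fin n) : ℝ :=
  ({i | f i ≠ g i} : Set (Fin n)).ncard / n

/-- The normalized number of fixed points of a partial bijection of an `n`-element set. -/
noncomputable def finTrace {n : ℕ} (f : Fin n ≃. Fin n) : ℝ :=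
  ({i | f i = some i} : Set (Fin n)).ncard / n

/-- `R` is sofic: for every finite `K ⊆ [[R]]` and `ε > 0` there is a `(K, ε)`-almost morphism from
`[[R]]` to some `[[N]]`. -/
def IsSofic (R : PMPRelation X μ) : Prop :=
  ∀ K : Set (FullSemigroup R), K.Finite → ∀ ε : ℝ, 0 < ε →
    ∃ N : ℕ, 0 < N ∧ ∃ π : FullSemigroup R → (Fin N ≃. Fin N),
      (π 1 = PEquiv.refl (Fin N) ∧ π 0 = ⊥) ∧
      (∀ φ ∈ K, ∀ ψ ∈ K, pbijDist (π (φ * ψ)) ((π ψ).trans (π φ)) < ε) ∧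
      ∀ φ ∈ K, |φ.tr - finTrace (π φ)| < ε

end

/-! ### Ultraproducts of symmetric groups -/

/-- The product `∏ₖ 𝔖_{n k}`, to be given the pseudometric coming from the ultrafilter `U`. -/
@[nolint unusedArguments]
def PermSeq (_U : Ultrafilter ℕ) (n : ℕ → ℕ) : Type := ∀ k, Equiv.Perm (Fin (n k))

instance (U : Ultrafilter ℕ) (n : ℕ → ℕ) : Group (PermSeq U n) :=
  inferInstanceAs (Group (∀ k, Equiv.Perm (Fin (n k))))

/-- The normalized Hamming distance on the symmetric group. -/
noncomputable def permDist {n : ℕ} (σ τ : Equiv.Perm (Fin n)) : ℝ :=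
  ({i | σ i ≠ τ i} : Set (Fin n)).ncard / n

theorem permDist_eq_pbijDist {n : ℕ} (σ τ : Equiv.Perm (Fin n)) :
    permDist σ τ = pbijDist σ.toPEquiv τ.toPEquiv := by
  simp [permDist, pbijDist, Equiv.toPEquiv_apply]

theorem permDist_nonneg {n : ℕ} (σ τ : Equiv.Perm (Fin n)) : 0 ≤ permDist σ τ := by
  unfold permDist; positivity

theorem permDist_le_one {n : ℕ} (σ τ : Equiv.Perm (Fin n)) : permDist σ τ ≤ 1 := by
  refine div_le_one_of_le₀ ?_ (Nat.cast_nonneg n)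
  have h := Set.ncard_le_ncard (Set.subset_univ {i | σ i ≠ τ i})
  rw [Set.ncard_univ, Nat.card_eq_fintype_card, Fintype.card_fin] at h
  exact_mod_cast h

theorem permDist_triangle {n : ℕ} (ρ σ τ : Equiv.Perm (Fin n)) :
    permDist ρ τ ≤ permDist ρ σ + permDist σ τ := by
  unfold permDist
  rw [← add_div]
  gcongr
  have hsub : {i | ρ i ≠ τ i} ⊆ {i | ρ i ≠ σ i} ∪ {i | σ i ≠ τ i} := by
    intro i hi
    by_contra hc
    simp only [Set.mem_union, Set.mem_ofPred_eq, not_or, not_not] at hc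
    exact hi (hc.1.trans hc.2)
  exact_mod_cast (Set.ncard_le_ncard hsub).trans (Set.ncard_union_le _ _)

theorem permDist_mul_left {n : ℕ} (ρ σ τ : Equiv.Perm (Fin n)) :
    permDist (ρ * σ) (ρ * τ) = permDist σ τ := by
  simp [permDist]

theorem permDist_mul_right {n : ℕ} (ρ σ τ : Equiv.Perm (Fin n)) :
    permDist (σ * ρ) (τ * ρ) = permDist σ τ := by
  unfold permDist
  have h : {i | (σ * ρ) i ≠ (τ * ρ) i} = ρ ⁻¹' {i | σ i ≠ τ i} := rfl
  rw [h, Set.ncard_preimage_of_injective_subset_range ρ.injective (by simp)]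

theorem permDist_comm {n : ℕ} (σ τ : Equiv.Perm (Fin n)) : permDist σ τ = permDist τ σ := by
  simp only [permDist, ne_comm]

theorem permDist_inv {n : ℕ} (σ τ : Equiv.Perm (Fin n)) :
    permDist σ⁻¹ τ⁻¹ = permDist σ τ := by
  rw [← permDist_mul_left σ, ← permDist_mul_right τ]
  simp [permDist_comm]

theorem tendsto_permDist {U : Ultrafilter ℕ} {n : ℕ → ℕ} (σ τ : PermSeq U n) :
    Tendsto (fun k => permDist (σ k) (τ k)) U
      (𝓝 (limUnder (U : Filter ℕ) fun k => permDist (σ k) (τ k))) := by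
  refine tendsto_nhds_limUnder ?_
  obtain ⟨l, -, hl⟩ := isCompact_iff_ultrafilter_le_nhds.1 (isCompact_Icc (a := (0 : ℝ)) (b := 1))
    (U.map fun k => permDist (σ k) (τ k)) (by
      rw [Filter.le_principal_iff]
      exact Filter.mem_map.2 (Filter.univ_mem' fun k =>
        ⟨permDist_nonneg (σ k) (τ k), permDist_le_one (σ k) (τ k)⟩))
  exact ⟨l, hl⟩

/-- The pseudometric `d_U(σ, τ) = lim_{k → U} d(σ k, τ k)`; the limit exists by
`tendsto_permDist`. -/
noncomputable instance (U : Ultrafilter ℕ) (n : ℕ → ℕ) : PseudoMetricSpace (PermSeq U n) where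
  dist σ τ := limUnder (U : Filter ℕ) fun k => permDist (σ k) (τ k)
  dist_self σ := by
    refine tendsto_nhds_unique (tendsto_permDist σ σ) ?_
    simp [permDist]
  dist_comm σ τ := by simp only [permDist_comm]
  dist_triangle ρ σ τ :=
    le_of_tendsto_of_tendsto (tendsto_permDist ρ τ)
      ((tendsto_permDist ρ σ).add (tendsto_permDist σ τ))
      (Filter.Eventually.of_forall fun _ => permDist_triangle _ _ _)

theorem PermSeq.dist_def {U : Ultrafilter ℕ} {n : ℕ → ℕ} (σ τ : PermSeq U n) :
    dist σ τ = limUnder (U : Filter ℕ) fun k => permDist (σ k) (τ k) := rfl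

instance (U : Ultrafilter ℕ) (n : ℕ → ℕ) : IsTopologicalGroup (PermSeq U n) where
  continuous_mul := by
    refine (LipschitzWith.of_dist_le_mul (K := 2) fun p q => ?_).continuous
    have h1 : dist (p.1 * p.2) (q.1 * p.2) = dist p.1 q.1 := by
      simp only [PermSeq.dist_def]
      exact congrArg _ (funext fun k => permDist_mul_right (p.2 k) (p.1 k) (q.1 k))
    have h2 : dist (q.1 * p.2) (q.1 * q.2) = dist p.2 q.2 := by
      simp only [PermSeq.dist_def]
      exact congrArg _ (funext fun k => permDist_mul_left (q.1 k) (p.2 k) (q.2 k))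
    refine (dist_triangle _ (q.1 * p.2) _).trans ?_
    rw [h1, h2, NNReal.coe_ofNat, two_mul, Prod.dist_eq]
    exact add_le_add (le_max_left _ _) (le_max_right _ _)
  continuous_inv := by
    refine (Isometry.of_dist_eq fun σ τ => ?_).continuous
    simp only [PermSeq.dist_def]
    exact congrArg _ (funext fun k => permDist_inv (σ k) (τ k))

/-- The metric ultraproduct of the symmetric groups `𝔖_{n k}` along `U`, with its group structure
and metric. -/
abbrev PermUltraproduct (U : Ultrafilter ℕ) (n : ℕ → ℕ) : Type :=
  SeparationQuotient (PermSeq U n)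

/-- A group with a metric is metrically sofic (with respect to `U`) if it embeds isometrically, as a
group, into the metric ultraproduct along `U` of a sequence of symmetric groups `𝔖_{n k}`. -/
def IsMetricallySofic (U : Ultrafilter ℕ) (G : Type*) [Group G] [MetricSpace G] : Prop :=
  ∃ n : ℕ → ℕ, (∀ k, 0 < n k) ∧ ∃ θ : G →* PermUltraproduct U n, Isometry θ

end SoficRel

namespace SoficRel

open MeasureTheory Filter Topology

/-! ### Analytic sets are universally measurable -/

/-! From soficity to an embedding: on the full group, π(u⁻¹)π(u) is close to π(1) = id, so π(u) is
nearly total and can be replaced by a permutation at small cost. Distances are recovered from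
traces, since tr(c⁻¹u) = 1 − d(u, c). Up to a null set R is generated by a sequence of Borel
bijections; this makes [R] separable, and approximations that are good on longer and longer pieces
of a dense sequence assemble to an isometric embedding (`isMetricallySofic_of_approximations`).

Conversely, an embedding lifts to permutations ρ(g) of the disjoint union Ω of the sets `Fin (n k)`,
and the normalized counting measures have a finitely additive limit P along U. What is known is that
ρ is multiplicative almost everywhere and that P{ρ(g) ≠ ρ(h)} = μ{g ≠ h}. An element of [[R]] is
almost everywhere an element of [R] restricted to a Borel set
(`exists_perm_of_memBorelFullSemigroup`), so it remains to find, for Borel sets, subsets of Ω that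
are compatible with ρ.

These are obtained from supports, since elements with disjoint supports have images with disjoint
supports (`IsIsometricRep.disjoint`). Where classes have at least three points, one works with sets
B such that B, αB, βB are disjoint. Then B is the intersection of the supports of two involutions,
exchanging B with αB and with βB, and the corresponding intersection in Ω is the core. It has
measure μ(B) (`core_aux`), every k fixing B pointwise fixes it (`fixes_core`), and disjoint sets
have disjoint cores (`core_disjoint`), all up to null sets. Where classes have exactly two points,
supports see only unions of classes. There the only nontrivial motion is the flip τ, and orders on X
and on Ω choose a point from each pair of τ and of ρ(τ); sets on one side in X are represented by
halves of supports on the same side in Ω. Points in singleton classes lie in no support at all,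
whence the assumption on R.

Finite disjoint unions of such sets approximate all Borel sets (`exists_represents`), so every Borel
A has a model S ⊆ Ω up to a given error (`exists_isModel`). The restriction of g to A is sent to the
restriction of ρ(g) to S; products and traces are right up to small P-measure, hence on the fibre
over some k. -/

theorem exists_forall_le_subset_of_isOpen {a : ℕ → ℕ} {V : Set (ℕ → ℕ)} (hV : IsOpen V)
    (h : {x | ∀ i, x i ≤ a i} ⊆ V) : ∃ k, {x | ∀ i < k, x i ≤ a i} ⊆ V := by
  have hK : IsCompact {x : ℕ → ℕ | ∀ i, x i ≤ a i} := by
    have : {x : ℕ → ℕ | ∀ i, x i ≤ a i} = Set.pi Set.univ fun i => Set.Iic (a i) := by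
      ext x; simp [Pi.le_def]
    rw [this]
    exact isCompact_univ_pi fun i => (Set.finite_Iic (a i)).isCompact
  have hcyl : ∀ x ∈ {x : ℕ → ℕ | ∀ i, x i ≤ a i}, ∃ n, PiNat.cylinder x n ⊆ V := by
    intro x hx
    obtain ⟨n, hn⟩ := (PiNat.isTopologicalBasis_cylinders (fun _ => ℕ)).exists_subset_of_mem_open
      (h hx) hV
    obtain ⟨⟨y, m, rfl⟩, hxy, hsub⟩ := hn
    refine ⟨m, ?_⟩
    rwa [PiNat.mem_cylinder_iff_eq.1 hxy]
  choose! n hn using hcyl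
  obtain ⟨t, hcov⟩ := hK.elim_nhds_subcover' (fun x _ => PiNat.cylinder x (n x))
    (fun x _ => (PiNat.isOpen_cylinder _ x _).mem_nhds (PiNat.self_mem_cylinder x _))
  refine ⟨t.sup fun x => n x, fun y hy => ?_⟩
  -- The truncation of `y` by `a` lies in the compact set, hence in one of finitely many cylinders;
  -- `k` is their largest length, and `y` agrees with its truncation on the first `k` coordinates.
  have hmem : (fun i => min (y i) (a i)) ∈ {x : ℕ → ℕ | ∀ i, x i ≤ a i} := fun i => min_le_right _ _
  have hmem' := hcov hmem
  simp only [Set.mem_iUnion] at hmem'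
  obtain ⟨x, hxt, hx⟩ := hmem'
  refine hn x.1 x.2 fun i hi => ?_
  rw [← hx i hi]
  exact (min_eq_left (hy i (hi.trans_le (Finset.le_sup (f := fun x : {x : ℕ → ℕ | ∀ i, x i ≤ a i} =>
    n x) hxt)))).symm

/-- The capacity argument: outer measure is continuous along increasing unions of arbitrary sets, so
the coordinates can be bounded one after another with the outer measure of the image kept above `c`.
The sequences obeying all bounds form a compact set, and its image is `K`. -/
theorem exists_measurableSet_subset_range_of_lt {X : Type*} [TopologicalSpace X] [T2Space X]
    [MeasurableSpace X] [BorelSpace X] (μ : Measure X) [IsFiniteMeasure μ] {f : (ℕ → ℕ) → X}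
    (hf : Continuous f) {c : ENNReal} (hc : c < μ (Set.range f)) :
    ∃ K ⊆ Set.range f, MeasurableSet K ∧ c ≤ μ K := by
  have step : ∀ (k : ℕ) (T : {T : Set (ℕ → ℕ) // c < μ (f '' T)}),
      ∃ n, c < μ (f '' (T.1 ∩ {x | x k ≤ n})) := by
    rintro k ⟨T, hT⟩
    have hU : f '' T = ⋃ n, f '' (T ∩ {x | x k ≤ n}) := by
      rw [← Set.image_iUnion, ← Set.inter_iUnion]
      congr 1
      refine (Set.inter_eq_left.2 fun x _ => Set.mem_iUnion.2 ⟨x k, le_refl (x k)⟩).symm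
    have hmono : Monotone fun n => f '' (T ∩ {x | x k ≤ n}) := fun n m hnm =>
      Set.image_mono (Set.inter_subset_inter_right _ fun x hx => le_trans hx hnm)
    rw [hU, hmono.measure_iUnion] at hT
    exact lt_iSup_iff.1 hT
  choose N hN using step
  let S : ℕ → {T : Set (ℕ → ℕ) // c < μ (f '' T)} := fun k =>
    Nat.rec ⟨Set.univ, by rwa [Set.image_univ]⟩ (fun k T => ⟨T.1 ∩ {x | x k ≤ N k T}, hN k T⟩) k
  let a : ℕ → ℕ := fun k => N k (S k)
  have hS : ∀ k, (S k).1 = {x | ∀ i < k, x i ≤ a i} := by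
    intro k
    induction k with
    | zero => ext; simp [S]
    | succ k ih =>
      change (S k).1 ∩ {x | x k ≤ a k} = _
      rw [ih]
      ext x
      simp only [Set.mem_inter_iff, Set.mem_ofPred_eq, Nat.lt_succ_iff_lt_or_eq, or_imp, forall_and,
        forall_eq]
  have hK : IsCompact (f '' {x | ∀ i, x i ≤ a i}) := by
    refine IsCompact.image ?_ hf
    have : {x : ℕ → ℕ | ∀ i, x i ≤ a i} = Set.pi Set.univ fun i => Set.Iic (a i) := by
      ext x; simp [Pi.le_def]
    rw [this]
    exact isCompact_univ_pi fun i => (Set.finite_Iic (a i)).isCompact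
  refine ⟨_, Set.image_subset_range _ _, hK.isClosed.measurableSet, ?_⟩
  -- An open `U` around the compact image, separated from `y`, already contains the image of the set
  -- cut out by finitely many of the bounds.
  have hsub : ⋂ k, closure (f '' (S k).1) ⊆ f '' {x | ∀ i, x i ≤ a i} := by
    intro y hy
    by_contra hyK
    obtain ⟨U, V, hU, hV, hKU, hyV, hUV⟩ :=
      SeparatedNhds.of_isCompact_isCompact hK (isCompact_singleton (x := y))
        (Set.disjoint_singleton_right.2 hyK)
    obtain ⟨k, hk⟩ := exists_forall_le_subset_of_isOpen (hU.preimage hf)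
      (Set.image_subset_iff.1 hKU)
    have hyk := Set.mem_iInter.1 hy k
    rw [hS] at hyk
    obtain ⟨z, hzV, hz⟩ := mem_closure_iff.1 hyk V hV (hyV rfl)
    obtain ⟨x, hx, rfl⟩ := hz
    exact Set.disjoint_left.1 hUV (hk hx) hzV
  refine le_trans ?_ (measure_mono hsub)
  rw [Antitone.measure_iInter]
  · exact le_iInf fun k => (S k).2.le.trans (measure_mono subset_closure)
  · refine antitone_nat_of_succ_le fun k => closure_mono (Set.image_mono ?_)
    exact Set.inter_subset_left
  · exact fun k => isClosed_closure.measurableSet.nullMeasurableSet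
  · exact ⟨0, measure_ne_top _ _⟩

/-- Borel subsets of nearly full outer measure exhaust the set from inside, and its measurable hull
has the same measure. -/
theorem nullMeasurableSet_of_analyticSet {X : Type*} [TopologicalSpace X] [T2Space X]
    [MeasurableSpace X] [BorelSpace X] (μ : Measure X) [IsFiniteMeasure μ] {s : Set X}
    (hs : AnalyticSet s) : NullMeasurableSet s μ := by
  rw [analyticSet_iff_exists_polishSpace_range] at hs
  obtain ⟨β, _, _, g, hg, rfl⟩ := hs
  rcases isEmpty_or_nonempty β with hβ | hβ
  · rw [Set.range_eq_empty]
    exact nullMeasurableSet_empty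
  obtain ⟨e, he, hes⟩ := PolishSpace.exists_nat_nat_continuous_surjective β
  rw [← hes.range_comp g]
  set f := g ∘ e
  have hf : Continuous f := hg.comp he
  have hfin : μ (Set.range f) ≠ ⊤ := measure_ne_top _ _
  by_cases h0 : μ (Set.range f) = 0
  · exact NullMeasurableSet.of_null h0
  obtain ⟨u, -, hu, hlim⟩ := exists_seq_strictMono_tendsto' (pos_iff_ne_zero.2 h0)
  choose K hKs hKm hK using fun n => exists_measurableSet_subset_range_of_lt μ hf (hu n).2
  have hKle : μ (Set.range f) ≤ μ (⋃ n, K n) :=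
    le_of_tendsto' hlim fun n => (hK n).trans (measure_mono (Set.subset_iUnion K n))
  have hKsub : ⋃ n, K n ⊆ Set.range f := Set.iUnion_subset hKs
  have hT : μ (toMeasurable μ (Set.range f) \ ⋃ n, K n) = 0 := by
    rw [measure_sdiff (hKsub.trans (subset_toMeasurable _ _))
      (MeasurableSet.iUnion hKm).nullMeasurableSet (measure_ne_top _ _), measure_toMeasurable]
    exact tsub_eq_zero_of_le hKle
  refine NullMeasurableSet.congr (s := ⋃ n, K n)
    (MeasurableSet.iUnion hKm).nullMeasurableSet ?_
  refine Filter.EventuallyLE.antisymm hKsub.eventuallyLE ?_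
  rw [ae_le_set]
  exact measure_mono_null (Set.sdiff_subset_sdiff_left (subset_toMeasurable _ _)) hT

/-! ### Countable-to-one Borel maps are countable unions of injections, almost everywhere -/

/-- Baire category: a nonempty countable Polish space is a countable union of closed singletons, so
one of them is open. -/
theorem exists_isolated_point_of_countable {P : Type*} [TopologicalSpace P] [PolishSpace P]
    {F : Set P} (hF : IsClosed F) (hc : F.Countable) (hne : F.Nonempty) :
    ∃ p ∈ F, ∃ V, IsOpen V ∧ V ∩ F = {p} := by
  have := hF.polishSpace
  have := hc.to_subtype
  have := hne.to_subtype
  obtain ⟨p, hp⟩ := nonempty_interior_of_iUnion_of_closed (f := fun p : F => {p})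
    (fun p => isClosed_singleton) (Set.iUnion_of_singleton F)
  obtain ⟨q, hq⟩ := hp
  have hqp : q = p := Set.mem_singleton_iff.1 (interior_subset hq)
  obtain ⟨V, hV, hVi⟩ := isOpen_induced_iff.1 (isOpen_interior (s := ({p} : Set F)))
  refine ⟨p.1, p.2, V, hV, Set.Subset.antisymm ?_ ?_⟩
  · rintro x ⟨hxV, hxF⟩
    have : (⟨x, hxF⟩ : F) ∈ interior {p} := hVi ▸ hxV
    exact congrArg Subtype.val (Set.mem_singleton_iff.1 (interior_subset this))
  · rintro x rfl
    exact ⟨by have : q ∈ Subtype.val ⁻¹' V := hVi ▸ hq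
              rw [hqp] at this; exact this, p.2⟩

/-- `A` is covered, up to the fibres of `f` over a null set, by countably many Borel sets on which
`f` is injective. -/
def InjCovered {P X : Type*} [MeasurableSpace P] [MeasurableSpace X] (μ : Measure X) (f : P → X)
    (A : Set P) : Prop :=
  ∃ E : ℕ → Set P, (∀ n, MeasurableSet (E n) ∧ Set.InjOn f (E n)) ∧
    ∀ᵐ x ∂μ, ∀ p ∈ A, f p = x → ∃ n, p ∈ E n

namespace InjCovered

variable {P X : Type*} [MeasurableSpace P] [MeasurableSpace X] {μ : Measure X} {f : P → X}

theorem mono {A B : Set P} (h : InjCovered μ f B) (hAB : A ⊆ B) : InjCovered μ f A := by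
  obtain ⟨E, hE, hcov⟩ := h
  exact ⟨E, hE, hcov.mono fun x hx p hp => hx p (hAB hp)⟩

theorem iUnion {ι : Type*} [Countable ι] {A : ι → Set P} (h : ∀ i, InjCovered μ f (A i)) :
    InjCovered μ f (⋃ i, A i) := by
  choose E hE hcov using h
  rcases isEmpty_or_nonempty ι with hι | hι
  · exact ⟨fun _ => ∅, fun n => ⟨MeasurableSet.empty, Set.injOn_empty f⟩, by simp⟩
  obtain ⟨e, he⟩ := exists_surjective_nat (ι × ℕ)
  refine ⟨fun n => E (e n).1 (e n).2, fun n => hE _ _, ?_⟩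
  filter_upwards [ae_all_iff.2 hcov] with x hx p hp hpx
  obtain ⟨i, hi⟩ := Set.mem_iUnion.1 hp
  obtain ⟨n, hn⟩ := hx i p hi hpx
  obtain ⟨m, hm⟩ := he (i, n)
  exact ⟨m, by rw [hm]; exact hn⟩

theorem union {A B : Set P} (hA : InjCovered μ f A) (hB : InjCovered μ f B) :
    InjCovered μ f (A ∪ B) := by
  rw [Set.union_eq_iUnion]
  exact iUnion fun b => by cases b <;> assumption

theorem of_injOn {A : Set P} (hA : MeasurableSet A) (h : Set.InjOn f A) : InjCovered μ f A :=
  ⟨fun _ => A, fun _ => ⟨hA, h⟩, Eventually.of_forall fun _ _ hp _ => ⟨0, hp⟩⟩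

/-- Exhaustion: the admissible `C` are closed under countable unions, so the supremum of their
measures is attained. -/
theorem exists_maximal [IsFiniteMeasure μ] (V : Set P) :
    ∃ C, MeasurableSet C ∧ InjCovered μ f (V ∩ f ⁻¹' C) ∧
      ∀ C', MeasurableSet C' → InjCovered μ f (V ∩ f ⁻¹' C') → μ (C' \ C) = 0 := by
  let 𝒞 : Set (Set X) := {C | MeasurableSet C ∧ InjCovered μ f (V ∩ f ⁻¹' C)}
  have h0 : (∅ : Set X) ∈ 𝒞 :=
    ⟨MeasurableSet.empty, by simpa using of_injOn MeasurableSet.empty (Set.injOn_empty f)⟩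
  obtain ⟨u, -, hu, hmem⟩ := exists_seq_tendsto_sSup (S := μ '' 𝒞) ⟨_, Set.mem_image_of_mem μ h0⟩
    (OrderTop.bddAbove _)
  choose C hC hCu using hmem
  have hCU : (⋃ n, C n) ∈ 𝒞 := by
    refine ⟨MeasurableSet.iUnion fun n => (hC n).1, ?_⟩
    rw [Set.preimage_iUnion, Set.inter_iUnion]
    exact iUnion fun n => (hC n).2
  have hsup : sSup (μ '' 𝒞) ≤ μ (⋃ n, C n) :=
    le_of_tendsto' hu fun n => (hCu n).symm.le.trans (measure_mono (Set.subset_iUnion C n))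
  refine ⟨_, hCU.1, hCU.2, fun C' hC' hC'i => ?_⟩
  have hun : C' ∪ ⋃ n, C n ∈ 𝒞 := by
    refine ⟨hC'.union hCU.1, ?_⟩
    rw [Set.preimage_union, Set.inter_union_distrib_left]
    exact hC'i.union hCU.2
  have hle : μ (C' ∪ ⋃ n, C n) ≤ μ (⋃ n, C n) :=
    (le_sSup (Set.mem_image_of_mem μ hun)).trans hsup
  have : C' \ ⋃ n, C n = (C' ∪ ⋃ n, C n) \ ⋃ n, C n := by rw [Set.union_sdiff_right]
  rw [this, measure_sdiff Set.subset_union_right hCU.1.nullMeasurableSet (measure_ne_top _ _)]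
  exact tsub_eq_zero_of_le hle

end InjCovered

/-- Let `C V` be the largest set over which the basic open set `V` is covered, and `E` the set of
points that no `V` covers. By maximality, over almost every point outside `C V` the set `V ∩ E` has
two points. But a nonempty fibre of `E` is closed and countable, so it has an isolated point, and a
small `V` around that point meets the fibre only there. -/
theorem injCovered_univ_of_continuous {P X : Type*} [TopologicalSpace P] [PolishSpace P]
    [MeasurableSpace P] [BorelSpace P] [TopologicalSpace X] [PolishSpace X] [MeasurableSpace X]
    [BorelSpace X] (μ : Measure X) [IsFiniteMeasure μ] {f : P → X} (hfc : Continuous f)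
    (hc : ∀ x, (f ⁻¹' {x}).Countable) : InjCovered μ f Set.univ := by
  have hf := hfc.measurable
  have hcb := TopologicalSpace.countable_countableBasis P
  have hbasis := TopologicalSpace.isBasis_countableBasis P
  set 𝓑 := TopologicalSpace.countableBasis P
  have : Countable 𝓑 := hcb.to_subtype
  have hVo : ∀ V : 𝓑, IsOpen V.1 := fun V => hbasis.isOpen V.2
  choose C hCm hCi hCmax using fun V : 𝓑 => InjCovered.exists_maximal (μ := μ) (f := f) V.1
  set E : Set P := {p | ∀ V : 𝓑, p ∈ V.1 → f p ∉ C V} with hE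
  have hEc : Eᶜ = ⋃ V : 𝓑, V.1 ∩ f ⁻¹' C V := by
    ext p; simp [hE]
  have hEci : InjCovered μ f Eᶜ := hEc ▸ InjCovered.iUnion hCi
  have hEm : MeasurableSet E := by
    rw [← compl_compl E, hEc]
    exact (MeasurableSet.iUnion fun V => (hVo V).measurableSet.inter (hf (hCm V))).compl
  let T : 𝓑 → Set X := fun V => (fun q : P × P => f q.1) ''
    {q | q.1 ∈ V.1 ∩ E ∧ q.2 ∈ V.1 ∩ E ∧ q.1 ≠ q.2 ∧ f q.1 = f q.2}
  -- `T V` is a projection, hence only analytic; this is where universal measurability of analytic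
  -- sets is needed.
  have hTm : ∀ V, NullMeasurableSet (T V) μ := by
    intro V
    refine nullMeasurableSet_of_analyticSet μ (MeasurableSet.analyticSet_image ?_
      (hf.comp measurable_fst))
    have hVE := (hVo V).measurableSet.inter hEm
    refine (measurable_fst hVE).inter ((measurable_snd hVE).inter
      (MeasurableSet.inter ?_ ?_))
    · exact (measurableSet_eq_fun measurable_fst measurable_snd).compl
    · exact measurableSet_eq_fun (hf.comp measurable_fst) (hf.comp measurable_snd)
  have hTC : ∀ V, ∀ᵐ x ∂μ, x ∉ C V → x ∈ T V := by
    intro V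
    have hT' := (measurableSet_toMeasurable μ (T V)).compl
    have hinj : InjCovered μ f (V.1 ∩ f ⁻¹' (toMeasurable μ (T V))ᶜ) := by
      refine (InjCovered.union (InjCovered.of_injOn (A := V.1 ∩ E ∩ f ⁻¹' (toMeasurable μ (T V))ᶜ)
        (((hVo V).measurableSet.inter hEm).inter (hf hT')) ?_) hEci).mono ?_
      · rintro p ⟨hp, hpT⟩ q ⟨hq, -⟩ hpq
        by_contra hne
        exact hpT (subset_toMeasurable μ (T V) ⟨(p, q), ⟨hp, hq, hne, hpq⟩, rfl⟩)
      · rintro p ⟨hpV, hpT⟩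
        by_cases hpE : p ∈ E
        · exact Or.inl ⟨⟨hpV, hpE⟩, hpT⟩
        · exact Or.inr hpE
    have h1 := hCmax V _ hT' hinj
    have h2 := (hTm V).toMeasurable_ae_eq.mem_iff
    rw [measure_eq_zero_iff_ae_notMem] at h1
    filter_upwards [h1, h2] with x hx1 hx2 hxC
    by_contra hxT
    exact hx1 ⟨fun h => hxT (hx2.1 h), hxC⟩
  have hempty : InjCovered μ f E := by
    refine ⟨fun _ => ∅, fun n => ⟨MeasurableSet.empty, Set.injOn_empty f⟩, ?_⟩
    filter_upwards [ae_all_iff.2 hTC] with x hx p hp hpx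
    exfalso
    have hclosed : IsClosed (f ⁻¹' {x} ∩ E) := by
      have : f ⁻¹' {x} ∩ E = f ⁻¹' {x} ∩ ⋂ V : {V : 𝓑 // x ∈ C V}, (V.1.1)ᶜ := by
        ext q
        simp only [Set.mem_inter_iff, Set.mem_preimage, Set.mem_singleton_iff, hE,
          Set.mem_ofPred_eq, Set.mem_iInter, Set.mem_compl_iff, Subtype.forall]
        refine and_congr_right fun hq => ?_
        rw [hq]
        exact ⟨fun h V hV hxC hqV => h V hV hqV hxC, fun h V hV hqV hxC => h V hV hxC hqV⟩
      rw [this]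
      exact (isClosed_singleton.preimage hfc).inter
        (isClosed_iInter fun V => (hVo V.1).isClosed_compl)
    obtain ⟨q, hq, W, hW, hWq⟩ := exists_isolated_point_of_countable hclosed
      ((hc x).mono Set.inter_subset_left) ⟨p, hpx, hp⟩
    have hqW : q ∈ W := ((Set.ext_iff.1 hWq q).2 rfl).1
    obtain ⟨V, hV, hqV, hVW⟩ := hbasis.exists_subset_of_mem_open hqW hW
    have hxC : x ∉ C ⟨V, hV⟩ := by
      have := hq.2 ⟨V, hV⟩ hqV
      rwa [show f q = x from hq.1] at this
    obtain ⟨⟨r, s⟩, ⟨hr, hs, hrs, hfrs⟩, hrx⟩ := hx ⟨V, hV⟩ hxC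
    have hr' : r = q := (Set.ext_iff.1 hWq r).1 ⟨hVW hr.1, hrx, hr.2⟩
    have hs' : s = q := (Set.ext_iff.1 hWq s).1 ⟨hVW hs.1, hfrs.symm.trans hrx, hs.2⟩
    exact hrs (hr'.trans hs'.symm)
  exact (hempty.union hEci).mono fun p _ => em (p ∈ E)

/-- A finer Polish topology with the same Borel sets makes `f` continuous. -/
theorem injCovered_univ_of_countable_fibres {P X : Type*} [MeasurableSpace P]
    [StandardBorelSpace P] [MeasurableSpace X] [StandardBorelSpace X] (μ : Measure X)
    [IsFiniteMeasure μ] {f : P → X} (hf : Measurable f) (hc : ∀ x, (f ⁻¹' {x}).Countable) :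
    InjCovered μ f Set.univ := by
  let _ := upgradeStandardBorel X
  obtain ⟨t, hPb, hP⟩ := ‹StandardBorelSpace P›.polish
  obtain ⟨t', ht', hfc, hpol⟩ := hf.exists_continuous
  have hb : @BorelSpace P t' _ := by
    refine @BorelSpace.mk P t' _ ?_
    rw [hPb.measurable_eq]
    exact (borel_eq_borel_of_le hpol hP ht').symm
  exact @injCovered_univ_of_continuous P X t' hpol _ hb _ _ _ _ μ _ f hfc hc

/-! ### Borel bijections with graph in an equivalence relation -/

/-- The group of Borel bijections of `X` whose graph is contained in `r`. -/
def permGroup {X : Type*} [MeasurableSpace X] (r : Setoid X) : Subgroup (Equiv.Perm X) where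
  carrier := {e | Measurable e ∧ Measurable e.symm ∧ ∀ x, r x (e x)}
  mul_mem' := fun ha hb =>
    ⟨ha.1.comp hb.1, hb.2.1.comp ha.2.1, fun x => r.trans (hb.2.2 x) (ha.2.2 _)⟩
  one_mem' := ⟨measurable_id, measurable_id, fun x => r.refl x⟩
  inv_mem' := fun {a} ha => ⟨ha.2.1, ha.1, fun x => r.symm (by
    have := ha.2.2 (a⁻¹ x)
    rwa [show a (a⁻¹ x) = x from a.apply_symm_apply x] at this)⟩

section PermGroup

variable {X : Type*} [MeasurableSpace X] {r : Setoid X}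

theorem permGroup_measurable (g : permGroup r) : Measurable (g.1 : X → X) := g.2.1

theorem permGroup_rel (g : permGroup r) (x : X) : r x (g.1 x) := g.2.2.2 x

theorem measurable_symm_of_measurable [StandardBorelSpace X] {e : Equiv.Perm X}
    (he : Measurable e) : Measurable e.symm := fun B hB => by
  rw [← Equiv.image_eq_preimage_symm]
  exact hB.image_of_measurable_injOn he e.injective.injOn

theorem permGroup_measurableSet_image (g : permGroup r) {B : Set X} (hB : MeasurableSet B) :
    MeasurableSet (g.1 '' B) := by
  rw [Equiv.image_eq_preimage_symm]
  exact g.2.2.1 hB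

/-! ### Swaps -/

/-- `F` maps the Borel set `C` injectively to a set disjoint from `C`, inside the classes of `r`. -/
structure Swappable (r : Setoid X) (F : X → X) (C : Set X) : Prop where
  measurable : Measurable F
  measurableSet : MeasurableSet C
  injOn : Set.InjOn F C
  notMem : ∀ x ∈ C, F x ∉ C
  rel : ∀ x ∈ C, r x (F x)

open Classical in
/-- The map exchanging `x` and `F x` for `x ∈ C`. -/
noncomputable def swapFun (F : X → X) (C : Set X) (x : X) : X :=
  if x ∈ C then F x else if h : ∃ c ∈ C, F c = x then h.choose else x

theorem swapFun_of_mem {X : Type*} {F : X → X} {C : Set X} {x : X}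
    (hx : x ∈ C) : swapFun F C x = F x :=
  if_pos hx

theorem swapFun_of_notMem {X : Type*} {F : X → X} {C : Set X} {x : X}
    (hx : x ∉ C) (hx' : x ∉ F '' C) :
    swapFun F C x = x := by
  rw [swapFun, if_neg hx, dif_neg (by simpa using hx')]

namespace Swappable

variable {F : X → X} {C : Set X}

theorem swapFun_apply (h : Swappable r F C) {x : X} (hx : x ∈ C) : swapFun F C (F x) = x := by
  have hex : ∃ c ∈ C, F c = F x := ⟨x, hx, rfl⟩
  rw [swapFun, if_neg (h.notMem x hx), dif_pos hex]
  exact h.injOn hex.choose_spec.1 hx hex.choose_spec.2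

theorem swapFun_involutive (h : Swappable r F C) : Function.Involutive (swapFun F C) := by
  intro x
  by_cases hx : x ∈ C
  · rw [swapFun_of_mem hx, h.swapFun_apply hx]
  · by_cases hx' : x ∈ F '' C
    · obtain ⟨c, hc, rfl⟩ := hx'
      rw [h.swapFun_apply hc, swapFun_of_mem hc]
    · rw [swapFun_of_notMem hx hx', swapFun_of_notMem hx hx']

theorem measurable_swapFun [StandardBorelSpace X] (h : Swappable r F C) :
    Measurable (swapFun F C) := by
  intro B hB
  have himg : ∀ {D}, MeasurableSet D → D ⊆ C → MeasurableSet (F '' D) := fun hD hDC =>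
    hD.image_of_measurable_injOn h.measurable (h.injOn.mono hDC)
  have : swapFun F C ⁻¹' B = (C ∩ F ⁻¹' B) ∪ (F '' (C ∩ B) ∪ (B \ (C ∪ F '' C))) := by
    ext x
    simp only [Set.mem_preimage, Set.mem_union, Set.mem_inter_iff, Set.mem_sdiff, not_or]
    by_cases hx : x ∈ C
    · have : x ∉ F '' (C ∩ B) := by
        rintro ⟨c, hc, rfl⟩
        exact h.notMem c hc.1 hx
      simp [swapFun_of_mem, hx, this]
    · by_cases hx' : x ∈ F '' C
      · obtain ⟨c, hc, rfl⟩ := hx'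
        have : F c ∈ F '' (C ∩ B) ↔ c ∈ B := by
          constructor
          · rintro ⟨c', hc', hcc⟩
            rw [← h.injOn hc'.1 hc hcc]
            exact hc'.2
          · exact fun hcB => ⟨c, ⟨hc, hcB⟩, rfl⟩
        rw [this, h.swapFun_apply hc]
        simp [hx, Set.mem_image_of_mem F hc]
      · have : x ∉ F '' (C ∩ B) := fun hh => hx' (Set.image_mono Set.inter_subset_left hh)
        rw [swapFun_of_notMem hx hx']
        tauto
  rw [this]
  exact (h.measurableSet.inter (h.measurable hB)).union ((himg (h.measurableSet.inter hB)
    Set.inter_subset_left).union (MeasurableSet.diff hB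
      (h.measurableSet.union (himg h.measurableSet subset_rfl))))

theorem swapFun_rel (h : Swappable r F C) (x : X) : r x (swapFun F C x) := by
  by_cases hx : x ∈ C
  · rw [swapFun_of_mem hx]; exact h.rel x hx
  · by_cases hx' : x ∈ F '' C
    · obtain ⟨c, hc, rfl⟩ := hx'
      rw [h.swapFun_apply hc]; exact r.symm (h.rel c hc)
    · rw [swapFun_of_notMem hx hx']

/-- The involution exchanging `x` and `F x` for `x ∈ C`. -/
noncomputable def perm [StandardBorelSpace X] (h : Swappable r F C) : permGroup r :=
  ⟨h.swapFun_involutive.toPerm, h.measurable_swapFun,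
    measurable_symm_of_measurable h.measurable_swapFun, h.swapFun_rel⟩

variable [StandardBorelSpace X]

theorem perm_apply_of_mem (h : Swappable r F C) {x : X} (hx : x ∈ C) : h.perm.1 x = F x :=
  swapFun_of_mem hx

theorem perm_apply_apply (h : Swappable r F C) {x : X} (hx : x ∈ C) : h.perm.1 (F x) = x :=
  h.swapFun_apply hx

theorem perm_apply_of_notMem (h : Swappable r F C) {x : X} (hx : x ∉ C) (hx' : x ∉ F '' C) :
    h.perm.1 x = x :=
  swapFun_of_notMem hx hx'

theorem perm_perm (h : Swappable r F C) (x : X) : h.perm.1 (h.perm.1 x) = x :=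
  h.swapFun_involutive x

theorem perm_mul_perm (h : Swappable r F C) : h.perm * h.perm = 1 :=
  Subtype.ext (Equiv.ext h.perm_perm)

theorem measurableSet_image (h : Swappable r F C) : MeasurableSet (F '' C) :=
  h.measurableSet.image_of_measurable_injOn h.measurable h.injOn

end Swappable

/-- Half-lines in both directions are used because the separation is one-sided. The family cuts the
set where two maps differ into countably many pieces on each of which their images are disjoint. -/
theorem exists_separating_seq (X : Type*) [MeasurableSpace X] [StandardBorelSpace X] :
    ∃ S : ℕ → Set X, (∀ n, MeasurableSet (S n)) ∧ ∀ x y, x ≠ y → ∃ n, x ∈ S n ∧ y ∉ S n := by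
  obtain ⟨e, he⟩ := exists_measurableEmbedding_real X
  obtain ⟨u, hu⟩ := exists_surjective_nat (ℚ × Bool)
  refine ⟨fun n => if (u n).2 then e ⁻¹' Set.Iio ((u n).1 : ℝ) else e ⁻¹' Set.Ioi ((u n).1 : ℝ),
    fun n => ?_, fun x y hxy => ?_⟩
  · dsimp only
    split_ifs
    · exact he.measurable measurableSet_Iio
    · exact he.measurable measurableSet_Ioi
  · rcases lt_or_gt_of_ne (he.injective.ne hxy) with h | h
    · obtain ⟨q, hq, hq'⟩ := exists_rat_btwn h
      obtain ⟨n, hn⟩ := hu (q, true)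
      exact ⟨n, by simp [hn, hq, hq'.le]⟩
    · obtain ⟨q, hq, hq'⟩ := exists_rat_btwn h
      obtain ⟨n, hn⟩ := hu (q, false)
      exact ⟨n, by simp [hn, hq', hq.le]⟩

end PermGroup

/-! ### Invariance of the measure -/

section Invariance

open Classical in
/-- The restriction of an injective map to a set, as a partial bijection. -/
noncomputable def pequivOn {X : Type*} {F : X → X} {A : Set X} (h : Set.InjOn F A) : X ≃. X where
  toFun x := if x ∈ A then some (F x) else none
  invFun y := if h : ∃ x ∈ A, F x = y then some h.choose else none
  inv a b := by
    constructor
    · intro hb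
      have hex : ∃ x ∈ A, F x = b := by
        by_contra hc
        simp [hc] at hb
      rw [dif_pos hex, Option.some.injEq] at hb
      have := hex.choose_spec
      rw [hb] at this
      rw [if_pos this.1, this.2]
    · intro ha
      have haA : a ∈ A := by
        by_contra hc
        simp [hc] at ha
      rw [if_pos haA, Option.some.injEq] at ha
      have hex : ∃ x ∈ A, F x = b := ⟨a, haA, ha⟩
      rw [dif_pos hex]
      refine congrArg some ?_
      exact h hex.choose_spec.1 haA (hex.choose_spec.2.trans ha.symm)

open Classical in
theorem pequivOn_eq_some {X : Type*} {F : X → X} {A : Set X} (h : Set.InjOn F A) {x y : X} :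
    pequivOn h x = some y ↔ x ∈ A ∧ F x = y := by
  change (if x ∈ A then some (F x) else none) = some y ↔ _
  split_ifs with hx <;> simp [hx]

variable {X : Type*} [MeasurableSpace X] [StandardBorelSpace X] {μ : Measure X}

theorem PMPRelation.measure_image_of_injOn (R : PMPRelation X μ) {F : X → X} {A : Set X}
    (hF : Measurable F) (hA : MeasurableSet A) (hi : Set.InjOn F A) (hr : ∀ x ∈ A, R.rel x (F x)) :
    μ (F '' A) = μ A := by
  have him : ∀ B, image (pequivOn hi) B = F '' (B ∩ A) := by
    intro B
    ext y
    simp only [image, pequivOn_eq_some, Set.mem_ofPred_eq, Set.mem_image, Set.mem_inter_iff,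
      and_assoc]
  have him' : ∀ B, image (pequivOn hi).symm B = A ∩ F ⁻¹' B := by
    intro B
    ext x
    simp only [image, PEquiv.eq_some_iff, pequivOn_eq_some, Set.mem_ofPred_eq, Set.mem_inter_iff,
      Set.mem_preimage]
    constructor
    · rintro ⟨y, hy, hx, rfl⟩; exact ⟨hx, hy⟩
    · rintro ⟨hx, hy⟩; exact ⟨_, hy, hx, rfl⟩
  have := R.invariant (pequivOn hi) ⟨⟨fun B hB => ?_, fun B hB => ?_⟩, fun x y hxy => ?_⟩ A hA
    fun x hx => ⟨F x, (pequivOn_eq_some hi).2 ⟨hx, rfl⟩⟩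
  · rwa [him, Set.inter_self] at this
  · rw [him]
    exact (hB.inter hA).image_of_measurable_injOn hF (hi.mono Set.inter_subset_right)
  · rw [him']
    exact hA.inter (hF hB)
  · obtain ⟨hx, rfl⟩ := (pequivOn_eq_some hi).1 hxy
    exact hr x hx

theorem PMPRelation.measure_image (R : PMPRelation X μ) (g : permGroup R.rel) {A : Set X}
    (hA : MeasurableSet A) : μ (g.1 '' A) = μ A :=
  R.measure_image_of_injOn (permGroup_measurable g) hA g.1.injective.injOn
    fun x _ => permGroup_rel g x

theorem PMPRelation.measurePreserving (R : PMPRelation X μ) (g : permGroup R.rel) :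
    MeasurePreserving (g.1 : X → X) μ μ := by
  refine ⟨permGroup_measurable g, Measure.ext fun B hB => ?_⟩
  rw [Measure.map_apply (permGroup_measurable g) hB,
    ← R.measure_image g (permGroup_measurable g hB), Set.image_preimage_eq _ g.1.surjective]

end Invariance

/-! ### Generation of the relation by countably many Borel bijections -/

section Generators

variable {X : Type*} [MeasurableSpace X] [StandardBorelSpace X] {μ : Measure X}

/-- The first projection of the relation is countable-to-one. A Borel set on which it is injective
is the graph of a partial function, extended here by the identity. -/
theorem PMPRelation.exists_seq_measurable [IsProbabilityMeasure μ] (R : PMPRelation X μ) :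
    ∃ f : ℕ → X → X, (∀ n, Measurable (f n)) ∧ (∀ n x, R.rel x (f n x)) ∧
      ∀ᵐ x ∂μ, ∀ y, R.rel x y → ∃ n, f n x = y := by
  classical
  let P : Set (X × X) := {p | R.rel p.1 p.2}
  have := R.measurableSet_rel.standardBorel
  let π₁ : P → X := fun p => p.1.1
  let π₂ : P → X := fun p => p.1.2
  have h1 : Measurable π₁ := measurable_fst.comp measurable_subtype_coe
  have h2 : Measurable π₂ := measurable_snd.comp measurable_subtype_coe
  have hcount : ∀ x, (π₁ ⁻¹' {x}).Countable := by
    intro x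
    refine Set.MapsTo.countable_of_injOn (f := π₂) (t := {y | R.rel x y}) ?_ ?_
      (R.countable_class x)
    · rintro p rfl
      exact p.2
    · rintro p hp q hq hpq
      exact Subtype.ext (Prod.ext (hp.trans hq.symm) hpq)
  obtain ⟨E, hE, hcov⟩ := injCovered_univ_of_countable_fibres μ h1 hcount
  let f : ℕ → X → X := fun n x => if h : ∃ p ∈ E n, π₁ p = x then π₂ h.choose else x
  have hf : ∀ n, ∀ p ∈ E n, f n (π₁ p) = π₂ p := by
    intro n p hp
    have hex : ∃ q ∈ E n, π₁ q = π₁ p := ⟨p, hp, rfl⟩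
    simp only [f, dif_pos hex]
    rw [(hE n).2 hex.choose_spec.1 hp hex.choose_spec.2]
  have hf' : ∀ n x, x ∉ π₁ '' E n → f n x = x := fun n x hx => dif_neg hx
  refine ⟨f, fun n B hB => ?_, fun n x => ?_, ?_⟩
  · have : f n ⁻¹' B = π₁ '' (E n ∩ π₂ ⁻¹' B) ∪ B \ (π₁ '' E n) := by
      ext x
      by_cases hx : x ∈ π₁ '' E n
      · obtain ⟨p, hp, rfl⟩ := hx
        have hiff : π₁ p ∈ π₁ '' (E n ∩ π₂ ⁻¹' B) ↔ π₂ p ∈ B := by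
          constructor
          · rintro ⟨q, hq, hqp⟩
            rw [← (hE n).2 hq.1 hp hqp]
            exact hq.2
          · exact fun h => ⟨p, ⟨hp, h⟩, rfl⟩
        simp only [Set.mem_preimage, Set.mem_union, Set.mem_sdiff, hf n p hp, hiff,
          Set.mem_image_of_mem π₁ hp, not_true, and_false, or_false]
      · have : x ∉ π₁ '' (E n ∩ π₂ ⁻¹' B) := fun hh =>
          hx (Set.image_mono Set.inter_subset_left hh)
        simp only [Set.mem_preimage, Set.mem_union, Set.mem_sdiff, hf' n x hx, hx, this,
          not_false_eq_true, and_true, false_or]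
    rw [this]
    exact (((hE n).1.inter (h2 hB)).image_of_measurable_injOn h1
      ((hE n).2.mono Set.inter_subset_left)).union
      (MeasurableSet.diff hB ((hE n).1.image_of_measurable_injOn h1 (hE n).2))
  · by_cases hx : x ∈ π₁ '' E n
    · obtain ⟨p, hp, rfl⟩ := hx
      rw [hf n p hp]
      exact p.2
    · rw [hf' n x hx]
  · filter_upwards [hcov] with x hx y hxy
    obtain ⟨n, hn⟩ := hx ⟨(x, y), hxy⟩ trivial rfl
    exact ⟨n, hf n _ hn⟩

/-- The sequence `γ` contains the identity and generates `R` almost everywhere. -/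
def Generates (R : PMPRelation X μ) (γ : ℕ → permGroup R.rel) : Prop :=
  (∃ n, γ n = 1) ∧ ∀ᵐ x ∂μ, ∀ y, R.rel x y → ∃ n, (γ n).1 x = y

/-- The Feldman–Moore theorem up to a null set: each `f n` is cut into injective pieces that move
their domains off themselves, and each piece is completed to an involution by swapping. -/
theorem PMPRelation.exists_generates [IsProbabilityMeasure μ] (R : PMPRelation X μ) :
    ∃ γ : ℕ → permGroup R.rel, Generates R γ := by
  obtain ⟨f, hf, hfr, hcov⟩ := R.exists_seq_measurable
  obtain ⟨S, hS, hsep⟩ := exists_separating_seq X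
  have hfib : ∀ n x, (f n ⁻¹' {x}).Countable := fun n x =>
    (R.countable_class x).mono fun y hy => by
      have := R.rel.symm (hfr n y)
      rwa [show f n y = x from hy] at this
  -- The exceptional set of a cover lies in the target of `f n`; for the pushforward measure it
  -- pulls back to a `μ`-null set.
  have hinj := fun n => injCovered_univ_of_countable_fibres (μ.map (f n)) (hf n) (hfib n)
  choose E hE hEcov using hinj
  have hEcov' : ∀ᵐ x ∂μ, ∀ n, ∃ m, x ∈ E n m := by
    refine ae_all_iff.2 fun n => ?_
    filter_upwards [ae_of_ae_map (hf n).aemeasurable (hEcov n)] with x hx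
    exact hx x trivial rfl
  let C : ℕ × ℕ × ℕ → Set X := fun i => E i.1 i.2.1 ∩ (S i.2.2 ∩ (f i.1 ⁻¹' S i.2.2)ᶜ)
  have hsw : ∀ i, Swappable R.rel (f i.1) (C i) := fun i =>
    ⟨hf _, (hE _ _).1.inter ((hS _).inter (hf _ (hS _)).compl),
      (hE _ _).2.mono Set.inter_subset_left, fun x hx hx' => hx.2.2 hx'.2.1, fun x _ => hfr _ x⟩
  obtain ⟨e, he⟩ := exists_surjective_nat (Option (ℕ × ℕ × ℕ))
  refine ⟨fun n => (e n).elim 1 fun i => (hsw i).perm, ?_, ?_⟩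
  · obtain ⟨n, hn⟩ := he none
    exact ⟨n, by simp [hn]⟩
  · filter_upwards [hcov, hEcov'] with x hx hxE y hxy
    by_cases hne : x = y
    · obtain ⟨n, hn⟩ := he none
      exact ⟨n, by simp [hn, hne]⟩
    · obtain ⟨n, rfl⟩ := hx y hxy
      obtain ⟨m, hm⟩ := hxE n
      obtain ⟨k, hk, hk'⟩ := hsep _ _ hne
      obtain ⟨j, hj⟩ := he (some (n, m, k))
      refine ⟨j, ?_⟩
      rw [hj]
      exact (hsw (n, m, k)).perm_apply_of_mem ⟨hm, hk, hk'⟩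

/-- Removing `Z` removes whole classes, which turns almost-everywhere information into information
on every remaining class. `Z` is the union of the preimages of a null Borel set under all `γ n`; the
identity among them gives `N ⊆ Z`. -/
theorem Generates.exists_saturated {R : PMPRelation X μ} {γ : ℕ → permGroup R.rel}
    (hγ : Generates R γ) {N : Set X} (hN : μ N = 0) :
    ∃ Z, MeasurableSet Z ∧ μ Z = 0 ∧ N ⊆ Z ∧ (∀ x y, R.rel x y → x ∉ Z → y ∉ Z) ∧
      ∀ x ∉ Z, ∀ y, R.rel x y → ∃ n, (γ n).1 x = y := by
  obtain ⟨⟨n₀, hn₀⟩, hae⟩ := hγ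
  let N' := toMeasurable μ (N ∪ {x | ¬ ∀ y, R.rel x y → ∃ n, (γ n).1 x = y})
  have hN' : μ N' = 0 := by
    rw [measure_toMeasurable]
    exact measure_union_null hN hae
  have hsub := subset_toMeasurable μ (N ∪ {x | ¬ ∀ y, R.rel x y → ∃ n, (γ n).1 x = y})
  have hN'm : MeasurableSet N' := measurableSet_toMeasurable _ _
  have hZ : ∀ x ∉ ⋃ n, (γ n).1 ⁻¹' N', x ∉ N' := by
    intro x hx hxN
    refine hx (Set.mem_iUnion.2 ⟨n₀, ?_⟩)
    rw [hn₀]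
    exact hxN
  have hgen : ∀ x ∉ ⋃ n, (γ n).1 ⁻¹' N', ∀ y, R.rel x y → ∃ n, (γ n).1 x = y := by
    intro x hx
    by_contra hc
    exact hZ x hx (hsub (Or.inr hc))
  refine ⟨⋃ n, (γ n).1 ⁻¹' N', MeasurableSet.iUnion fun n => permGroup_measurable _ hN'm,
    measure_iUnion_null fun n => ?_, fun x hx => ?_, fun x y hxy hx hy => ?_, hgen⟩
  · rw [(R.measurePreserving (γ n)).measure_preimage hN'm.nullMeasurableSet, hN']
  · by_contra hc
    exact hZ x hc (hsub (Or.inl hx))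
  · obtain ⟨n, hn⟩ := Set.mem_iUnion.1 hy
    obtain ⟨m, hm⟩ := hgen x hx _ (R.rel.trans hxy (permGroup_rel (γ n) y))
    exact hx (Set.mem_iUnion.2 ⟨m, by rw [Set.mem_preimage, hm]; exact hn⟩)

/-- By invariance of the measure the image of `F` is conull. On a suitable null union of classes `F`
is replaced by the identity, and elsewhere it is bijective. -/
theorem Generates.exists_perm_ae_eq [IsProbabilityMeasure μ] {R : PMPRelation X μ}
    {γ : ℕ → permGroup R.rel}
    (hγ : Generates R γ) {F : X → X} (hF : Measurable F) (hr : ∀ x, R.rel x (F x)) {N : Set X}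
    (hN : μ N = 0) (hi : Set.InjOn F Nᶜ) : ∃ g : permGroup R.rel, ∀ᵐ x ∂μ, g.1 x = F x := by
  classical
  let A := (toMeasurable μ N)ᶜ
  have hA : MeasurableSet A := (measurableSet_toMeasurable _ _).compl
  have hiA : Set.InjOn F A := hi.mono (Set.compl_subset_compl.2 (subset_toMeasurable μ N))
  have hAc : μ Aᶜ = 0 := by simp only [A, compl_compl, measure_toMeasurable, hN]
  have himc : μ (F '' A)ᶜ = 0 := by
    rw [prob_compl_eq_zero_iff (hA.image_of_measurable_injOn hF hiA),
      R.measure_image_of_injOn hF hA hiA fun x _ => hr x, ← prob_compl_eq_zero_iff hA, hAc]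
  obtain ⟨Z, hZ, hZ0, hsub, hsat, -⟩ := hγ.exists_saturated (measure_union_null hAc himc)
  let G : X → X := fun x => if x ∈ Z then x else F x
  have hG : Measurable G := Measurable.ite hZ measurable_id hF
  have hbij : Function.Bijective G := by
    constructor
    · intro x y hxy
      by_cases hx : x ∈ Z <;> by_cases hy : y ∈ Z <;>
        simp only [G, hx, hy, if_true, if_false] at hxy
      · exact hxy
      · exact absurd (hxy ▸ hx) (hsat _ _ (hr y) hy)
      · exact absurd (hxy ▸ hy) (hsat _ _ (hr x) hx)
      · refine hiA ?_ ?_ hxy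
        · by_contra hc; exact hx (hsub (Or.inl hc))
        · by_contra hc; exact hy (hsub (Or.inl hc))
    · intro y
      by_cases hy : y ∈ Z
      · exact ⟨y, if_pos hy⟩
      · have : y ∈ F '' A := by
          by_contra hc; exact hy (hsub (Or.inr hc))
        obtain ⟨x, -, rfl⟩ := this
        exact ⟨x, if_neg (hsat _ _ (R.rel.symm (hr x)) hy)⟩
  refine ⟨⟨Equiv.ofBijective G hbij, hG, measurable_symm_of_measurable hG, fun x => ?_⟩, ?_⟩
  · change R.rel x (G x)
    simp only [G]
    split_ifs
    · exact R.rel.refl x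
    · exact hr x
  · filter_upwards [measure_eq_zero_iff_ae_notMem.1 hZ0] with x hx
    exact if_neg hx

end Generators

/-! ### Two-element classes, and extension of partial isomorphisms to the full group -/

section Structure

variable {X : Type*} [MeasurableSpace X] [StandardBorelSpace X] {μ : Measure X}

theorem measurableSet_eq_of_measurable {f g : X → X} (hf : Measurable f) (hg : Measurable g) :
    MeasurableSet {x | f x = g x} := by
  let _ := upgradeStandardBorel X
  exact measurableSet_eq_fun hf hg

/-- An involution whose support is the union of the classes with exactly two elements, up to a null
set. -/
theorem Generates.exists_involution {R : PMPRelation X μ} {γ : ℕ → permGroup R.rel}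
    (hγ : Generates R γ) (hR : ∀ᵐ x ∂μ, ∃ y, R.rel x y ∧ y ≠ x) :
    ∃ τ : permGroup R.rel, (∀ x, τ.1 (τ.1 x) = x) ∧
      (∀ x, τ.1 x ≠ x → ∀ y, R.rel x y → y = x ∨ y = τ.1 x) ∧
      ∀ᵐ x ∂μ, τ.1 x = x → ∃ n m, (γ n).1 x ≠ x ∧ (γ m).1 x ≠ x ∧ (γ n).1 x ≠ (γ m).1 x := by
  classical
  obtain ⟨Z, hZ, hZ0, hsub, hsat, hgen⟩ := hγ.exists_saturated hR
  -- Outside `Z`, these are the points in classes with at least three elements; so `W` below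
  -- consists of classes with exactly two.
  let T : Set X := {x | ∃ n m, (γ n).1 x ≠ x ∧ (γ m).1 x ≠ x ∧ (γ n).1 x ≠ (γ m).1 x}
  have hne : ∀ g h : permGroup R.rel, MeasurableSet {x | g.1 x ≠ h.1 x} := fun g h =>
    (measurableSet_eq_of_measurable (permGroup_measurable g) (permGroup_measurable h)).compl
  have hT : MeasurableSet T := by
    have : T = ⋃ n, ⋃ m, {x | (γ n).1 x ≠ (1 : permGroup R.rel).1 x} ∩
        ({x | (γ m).1 x ≠ (1 : permGroup R.rel).1 x} ∩ {x | (γ n).1 x ≠ (γ m).1 x}) := by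
      ext x
      simp [T]
    rw [this]
    exact MeasurableSet.iUnion fun n => MeasurableSet.iUnion fun m =>
      (hne _ _).inter ((hne _ _).inter (hne _ _))
  let W : Set X := (Z ∪ T)ᶜ
  have hW : MeasurableSet W := (hZ.union hT).compl
  have hWex : ∀ x ∈ W, ∃ y, y ≠ x ∧ R.rel x y ∧ ∀ z, R.rel x z → z = x ∨ z = y := by
    intro x hx
    have hxZ : x ∉ Z := fun h => hx (Or.inl h)
    obtain ⟨y, hxy, hyx⟩ : ∃ y, R.rel x y ∧ y ≠ x := by
      by_contra hc
      exact hxZ (hsub hc)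
    refine ⟨y, hyx, hxy, fun z hxz => ?_⟩
    by_contra! hc
    obtain ⟨n, rfl⟩ := hgen x hxZ y hxy
    obtain ⟨m, rfl⟩ := hgen x hxZ z hxz
    exact hx (Or.inr ⟨n, m, hyx, hc.1, hc.2.symm⟩)
  have hWsat : ∀ x ∈ W, ∀ y, R.rel x y → y ∈ W := by
    intro x hx y hxy hy
    have hxZ : x ∉ Z := fun h => hx (Or.inl h)
    rcases hy with hy | ⟨n, m, hn, hm, hnm⟩
    · exact hsat _ _ hxy hxZ hy
    · obtain ⟨w, -, -, hw⟩ := hWex x hx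
      have h1 := hw _ hxy
      have h2 := hw _ (R.rel.trans hxy (permGroup_rel (γ n) y))
      have h3 := hw _ (R.rel.trans hxy (permGroup_rel (γ m) y))
      -- `y` and its two images are three distinct points of `{x, w}`.
      grind
  choose! F hFne hFr hFu using hWex
  let G : X → X := fun x => if x ∈ W then F x else x
  have hGW : ∀ x ∈ W, G x = F x := fun x hx => if_pos hx
  have hGW' : ∀ x ∉ W, G x = x := fun x hx => if_neg hx
  have hinv : Function.Involutive G := by
    intro x
    by_cases hx : x ∈ W
    · have hFW := hWsat x hx _ (hFr x hx)
      rw [hGW x hx, hGW _ hFW]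
      exact (hFu x hx _ (R.rel.trans (hFr x hx) (hFr _ hFW))).resolve_right (hFne _ hFW)
    · rw [hGW' x hx, hGW' x hx]
  have hGm : Measurable G := by
    intro B hB
    have : G ⁻¹' B = Wᶜ ∩ B ∪
        ⋃ n, W ∩ ({x | (γ n).1 x ≠ (1 : permGroup R.rel).1 x} ∩ (γ n).1 ⁻¹' B) := by
      ext x
      by_cases hx : x ∈ W
      · simp only [Set.mem_preimage, hGW x hx, Set.mem_union, Set.mem_inter_iff, Set.mem_compl_iff,
          hx, not_true, false_and, false_or, Set.mem_iUnion, true_and, Set.mem_ofPred_eq]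
        constructor
        · intro h
          obtain ⟨n, hn⟩ := hgen x (fun h => hx (Or.inl h)) _ (hFr x hx)
          exact ⟨n, by rw [hn]; exact hFne x hx, by rw [hn]; exact h⟩
        · rintro ⟨n, hn, hnB⟩
          rwa [← (hFu x hx _ (permGroup_rel (γ n) x)).resolve_left hn]
      · simp [hGW' x hx, hx]
    rw [this]
    exact (hW.compl.inter hB).union (MeasurableSet.iUnion fun n =>
      hW.inter ((hne _ _).inter (permGroup_measurable _ hB)))
  refine ⟨⟨hinv.toPerm, hGm, measurable_symm_of_measurable hGm, fun x => ?_⟩, hinv,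
    fun x hx y hxy => ?_, ?_⟩
  · change R.rel x (G x)
    by_cases hx : x ∈ W
    · rw [hGW x hx]; exact hFr x hx
    · rw [hGW' x hx]
  · change G x ≠ x at hx
    change y = x ∨ y = G x
    by_cases hxW : x ∈ W
    · rw [hGW x hxW]; exact hFu x hxW y hxy
    · exact absurd (hGW' x hxW) hx
  · filter_upwards [measure_eq_zero_iff_ae_notMem.1 hZ0] with x hx hxG
    change G x = x at hxG
    by_contra hc
    have hxW : x ∈ W := by
      rintro (h | h)
      · exact hx h
      · exact hc h
    rw [hGW x hxW] at hxG
    exact hFne x hxW hxG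

/-- Extension of a measurable injection within `R` on a Borel set to a Borel bijection. -/
theorem Generates.exists_perm_extension [IsProbabilityMeasure μ] {R : PMPRelation X μ}
    {γ : ℕ → permGroup R.rel} (hγ : Generates R γ) {F : X → X} (hF : Measurable F)
    (hr : ∀ x, R.rel x (F x)) {A : Set X} (hA : MeasurableSet A) (hi : Set.InjOn F A) :
    ∃ g : permGroup R.rel, ∀ᵐ x ∂μ, x ∈ A → g.1 x = F x := by
  classical
  let St := {p : (X → X) × Set X // Measurable p.1 ∧ MeasurableSet p.2 ∧ Set.InjOn p.1 p.2 ∧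
    ∀ x, R.rel x (p.1 x)}
  -- The greedy step: `γ n` is used at those points outside the current domain that it sends outside
  -- the current image.
  let C : ℕ → St → Set X := fun n p => p.1.2ᶜ ∩ (γ n).1 ⁻¹' (p.1.1 '' p.1.2)ᶜ
  have hC : ∀ n p, MeasurableSet (C n p) := fun n p =>
    p.2.2.1.compl.inter (permGroup_measurable _
      (p.2.2.1.image_of_measurable_injOn p.2.1 p.2.2.2.1).compl)
  let next : ℕ → St → St := fun n p => ⟨(fun x => if x ∈ C n p then (γ n).1 x else p.1.1 x,
      p.1.2 ∪ C n p), by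
    refine ⟨Measurable.ite (hC n p) (permGroup_measurable _) p.2.1, p.2.2.1.union (hC n p),
      fun x hx y hy hxy => ?_, fun x => ?_⟩
    · dsimp only at hxy
      split_ifs at hxy with h1 h2 h2
      · exact (γ n).1.injective hxy
      · exact absurd ⟨y, hy.resolve_right h2, hxy.symm⟩ h1.2
      · exact absurd ⟨x, hx.resolve_right h1, hxy⟩ h2.2
      · exact p.2.2.2.1 (hx.resolve_right h1) (hy.resolve_right h2) hxy
    · dsimp only
      split_ifs
      · exact permGroup_rel _ _
      · exact p.2.2.2.2 x⟩
  let S : ℕ → St := fun n => Nat.rec ⟨(F, A), hF, hA, hi, hr⟩ next n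
  let D : ℕ → Set X := fun n => (S n).1.2
  let f : ℕ → X → X := fun n => (S n).1.1
  have hDm : ∀ n, MeasurableSet (D n) := fun n => (S n).2.2.1
  have hfm : ∀ n, Measurable (f n) := fun n => (S n).2.1
  have hfi : ∀ n, Set.InjOn (f n) (D n) := fun n => (S n).2.2.2.1
  have hfr : ∀ n x, R.rel x (f n x) := fun n => (S n).2.2.2.2
  have hDs : ∀ n, D (n + 1) = D n ∪ C n (S n) := fun n => rfl
  have hfs : ∀ n, ∀ x ∈ D n, f (n + 1) x = f n x := fun n x hx => if_neg fun h => h.1 hx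
  have hDmono : Monotone D := monotone_nat_of_le_succ fun n => by
    rw [hDs]; exact Set.subset_union_left
  have hfmono : ∀ n m, n ≤ m → ∀ x ∈ D n, f m x = f n x := by
    intro n m hnm
    induction m, hnm using Nat.le_induction with
    | base => exact fun x _ => rfl
    | succ m hnm ih => exact fun x hx => (hfs m x (hDmono hnm hx)).trans (ih x hx)
  let f' : X → X := fun x => if h : ∃ n, x ∈ D n then f h.choose x else x
  have hf' : ∀ n, ∀ x ∈ D n, f' x = f n x := by
    intro n x hx
    have hex : ∃ n, x ∈ D n := ⟨n, hx⟩
    simp only [f', dif_pos hex]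
    rcases le_total n hex.choose with h | h
    · exact hfmono _ _ h x hx
    · exact (hfmono _ _ h x hex.choose_spec).symm
  have hf'c : ∀ x ∉ ⋃ n, D n, f' x = x := fun x hx => dif_neg (by simpa using hx)
  have hf'm : Measurable f' := by
    intro B hB
    have : f' ⁻¹' B = (⋃ n, D n ∩ f n ⁻¹' B) ∪ (⋃ n, D n)ᶜ ∩ B := by
      ext x
      by_cases hx : x ∈ ⋃ n, D n
      · simp only [Set.mem_union, Set.mem_inter_iff, Set.mem_compl_iff, hx, not_true, false_and,
          or_false, Set.mem_preimage, Set.mem_iUnion]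
        constructor
        · intro h
          obtain ⟨n, hn⟩ := Set.mem_iUnion.1 hx
          exact ⟨n, hn, by rwa [← hf' n x hn]⟩
        · rintro ⟨n, hn, h⟩
          rwa [hf' n x hn]
      · have : ∀ n, x ∉ D n := by simpa using hx
        simp [hf'c x hx, this]
    rw [this]
    exact (MeasurableSet.iUnion fun n => (hDm n).inter (hfm n hB)).union
      ((MeasurableSet.iUnion hDm).compl.inter hB)
  have hf'r : ∀ x, R.rel x (f' x) := by
    intro x
    by_cases hx : ∃ n, x ∈ D n
    · obtain ⟨n, hn⟩ := hx
      rw [hf' n x hn]; exact hfr n x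
    · rw [hf'c x (by simpa using hx)]
  have hf'i : Set.InjOn f' (⋃ n, D n) := by
    intro x hx y hy hxy
    obtain ⟨n, hn⟩ := Set.mem_iUnion.1 hx
    obtain ⟨m, hm⟩ := Set.mem_iUnion.1 hy
    have hn' := hDmono (le_max_left n m) hn
    have hm' := hDmono (le_max_right n m) hm
    rw [hf' _ x hn', hf' _ y hm'] at hxy
    exact hfi _ hn' hm' hxy
  obtain ⟨Z, hZ, hZ0, -, hsat, hgen⟩ := hγ.exists_saturated (measure_empty (μ := μ))
  -- If a point `γ n x` of the class were never attained, stage `n` would have added `x` to the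
  -- domain.
  have hfar : ∀ x ∉ ⋃ n, D n, x ∉ Z → ∀ y, R.rel x y → y ∈ f' '' ⋃ n, D n := by
    intro x hx hxZ y hxy
    obtain ⟨n, rfl⟩ := hgen x hxZ y hxy
    by_contra hc
    have hxn : x ∉ D n := fun h => hx (Set.mem_iUnion.2 ⟨n, h⟩)
    refine hx (Set.mem_iUnion.2 ⟨n + 1, ?_⟩)
    rw [hDs]
    refine Or.inr ⟨hxn, ?_⟩
    rintro ⟨z, hz, hzx⟩
    exact hc ⟨z, Set.mem_iUnion.2 ⟨n, hz⟩, (hf' n z hz).trans hzx⟩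
  obtain ⟨n₀, hn₀⟩ := hγ.1
  have hDU : MeasurableSet (⋃ n, D n) := MeasurableSet.iUnion hDm
  -- Off `Z`, this is the union of the classes not contained in the final domain. There `f'` maps
  -- the domain onto all of `Y`, and since it preserves a finite measure, the part of `Y` outside
  -- the domain is null.
  let Y : Set X := (⋃ n, (γ n).1 ⁻¹' (⋃ n, D n)ᶜ) \ Z
  have hY : MeasurableSet Y :=
    (MeasurableSet.iUnion fun n => permGroup_measurable _ hDU.compl).diff hZ
  have hYsub : Y ⊆ f' '' ((⋃ n, D n) ∩ Y) := by
    rintro y ⟨hy, hyZ⟩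
    obtain ⟨n, hn⟩ := Set.mem_iUnion.1 hy
    obtain ⟨x, hx, rfl⟩ := hfar _ hn (hsat _ _ (permGroup_rel (γ n) y) hyZ) y
      (R.rel.symm (permGroup_rel (γ n) y))
    have hxZ := hsat _ _ (R.rel.symm (hf'r x)) hyZ
    refine ⟨x, ⟨hx, ?_, hxZ⟩, rfl⟩
    obtain ⟨m, hm⟩ := hgen x hxZ _ (R.rel.trans (hf'r x) (permGroup_rel (γ n) (f' x)))
    exact Set.mem_iUnion.2 ⟨m, by rw [Set.mem_preimage, hm]; exact hn⟩
  have hle : μ Y ≤ μ ((⋃ n, D n) ∩ Y) := (measure_mono hYsub).trans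
    (R.measure_image_of_injOn hf'm (hDU.inter hY) (hf'i.mono Set.inter_subset_left)
      fun x _ => hf'r x).le
  have hrest : μ (⋃ n, D n)ᶜ = 0 := by
    have h1 : μ (Y \ ((⋃ n, D n) ∩ Y)) = 0 := by
      rw [measure_sdiff Set.inter_subset_right
            (hDU.inter hY).nullMeasurableSet (measure_ne_top _ _)]
      exact tsub_eq_zero_of_le hle
    refine measure_mono_null ?_ (measure_union_null h1 hZ0)
    intro x hx
    by_cases hxZ : x ∈ Z
    · exact Or.inr hxZ
    · refine Or.inl ⟨⟨Set.mem_iUnion.2 ⟨n₀, ?_⟩, hxZ⟩, fun h => hx h.1⟩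
      rw [hn₀]
      exact hx
  obtain ⟨g, hg⟩ := hγ.exists_perm_ae_eq hf'm hf'r hrest (by rwa [compl_compl])
  exact ⟨g, hg.mono fun x hx hxA => hx.trans (hf' 0 x hxA)⟩

/-- This reduces an element of the full semigroup to its domain and an element of the full group. -/
theorem Generates.exists_perm_of_memBorelFullSemigroup [IsProbabilityMeasure μ]
    {R : PMPRelation X μ} {γ : ℕ → permGroup R.rel} (hγ : Generates R γ) {φ : X ≃. X}
    (hφ : MemBorelFullSemigroup R.rel φ) :
    ∃ g : permGroup R.rel, ∀ᵐ x ∂μ, x ∈ dom φ → φ x = some (g.1 x) := by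
  let F : X → X := fun x => (φ x).getD x
  have hF : ∀ x y, φ x = some y → F x = y := fun x y h => by simp [F, h]
  have hFc : ∀ x ∉ dom φ, F x = x := fun x hx => by
    cases h : φ x with
    | none => simp [F, h]
    | some y => exact absurd ⟨y, h⟩ hx
  have hdom := measurableSet_dom hφ.1
  have hFm : Measurable F := by
    intro B hB
    have : F ⁻¹' B = image φ.symm B ∪ (dom φ)ᶜ ∩ B := by
      ext x
      by_cases hx : x ∈ dom φ
      · obtain ⟨y, hy⟩ := hx
        simp only [Set.mem_preimage, hF x y hy, image, Set.mem_union, Set.mem_ofPred_eq,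
          PEquiv.eq_some_iff, hy, Option.some.injEq, exists_eq_right', Set.mem_inter_iff,
          Set.mem_compl_iff, show x ∈ dom φ from ⟨y, hy⟩, not_true, false_and, or_false]
      · have : x ∉ image φ.symm B := by
          rintro ⟨y, -, hy⟩
          exact hx ⟨y, φ.eq_some_iff.1 hy⟩
        simp [hFc x hx, hx, this]
    rw [this]
    exact (hφ.1.2 B hB).union (hdom.compl.inter hB)
  have hFr : ∀ x, R.rel x (F x) := by
    intro x
    by_cases hx : x ∈ dom φ
    · obtain ⟨y, hy⟩ := hx
      rw [hF x y hy]
      exact hφ.2 x y hy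
    · rw [hFc x hx]
  have hFi : Set.InjOn F (dom φ) := by
    rintro x ⟨y, hy⟩ x' ⟨y', hy'⟩ hxx
    rw [hF x y hy, hF x' y' hy'] at hxx
    exact φ.inj (b := y) hy (hxx ▸ hy')
  obtain ⟨g, hg⟩ := hγ.exists_perm_extension hFm hFr hdom hFi
  refine ⟨g, hg.mono fun x hx hxd => ?_⟩
  obtain ⟨y, hy⟩ := hxd
  rw [hx ⟨y, hy⟩, hF x y hy, hy]

end Structure

/-! ### The full group as a quotient of the group of Borel bijections -/

section FullGroup

variable {X : Type*} [MeasurableSpace X] {μ : Measure X}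

theorem memBorelFullSemigroup_toPEquiv {r : Setoid X} (g : permGroup r) :
    MemBorelFullSemigroup r g.1.toPEquiv := by
  have h1 : ∀ B, image g.1.toPEquiv B = g.1 '' B := by
    intro B; ext y; simp only [image, Equiv.toPEquiv_apply, Option.some.injEq]; rfl
  have h2 : ∀ B, image g.1.toPEquiv.symm B = g.1 ⁻¹' B := by
    intro B; ext y; simp [image, PEquiv.eq_some_iff, Equiv.toPEquiv_apply]
  refine ⟨⟨fun B hB => ?_, fun B hB => ?_⟩, fun x y h => ?_⟩
  · rw [h1, Equiv.image_eq_preimage_symm]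
    exact g.2.2.1 hB
  · rw [h2]
    exact g.2.1 hB
  · rw [Equiv.toPEquiv_apply, Option.some.injEq] at h
    exact h ▸ permGroup_rel g x

/-- A Borel bijection as an element of the Borel full semigroup. -/
def toBorelFullSemigroup (R : PMPRelation X μ) (g : permGroup R.rel) : BorelFullSemigroup R :=
  ⟨g.1.toPEquiv, memBorelFullSemigroup_toPEquiv g⟩

theorem toBorelFullSemigroup_apply (R : PMPRelation X μ) (g : permGroup R.rel) (x : X) :
    (toBorelFullSemigroup R g).1 x = some (g.1 x) := rfl

theorem toBorelFullSemigroup_mem (R : PMPRelation X μ) (g : permGroup R.rel) :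
    toBorelFullSemigroup R g ∈ borelFullGroup R := by
  refine ⟨Set.eq_univ_of_forall fun x => ⟨g.1 x, rfl⟩, Set.eq_univ_of_forall fun y => ?_⟩
  exact ⟨g.1.symm y, trivial, by simp [toBorelFullSemigroup_apply]⟩

theorem exists_toBorelFullSemigroup_eq [StandardBorelSpace X] {R : PMPRelation X μ}
    {φ : BorelFullSemigroup R} (hφ : φ ∈ borelFullGroup R) :
    ∃ g, toBorelFullSemigroup R g = φ := by
  have hd : ∀ x, ∃ y, φ.1 x = some y := fun x => hφ.1.symm.subset (Set.mem_univ x)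
  choose f hf using hd
  have hbij : Function.Bijective f := by
    constructor
    · intro x y hxy
      exact φ.1.inj (b := f x) (hf x) (by rw [hxy]; exact hf y)
    · intro y
      obtain ⟨x, -, hx⟩ : y ∈ image φ.1 Set.univ := hφ.2.symm.subset (Set.mem_univ y)
      exact ⟨x, by rw [hf x, Option.some.injEq] at hx; exact hx⟩
  have hm : Measurable f := by
    intro B hB
    have : f ⁻¹' B = image φ.1.symm B := by
      ext x
      simp [image, PEquiv.eq_some_iff, hf]
    rw [this]
    exact φ.2.1.2 B hB
  refine ⟨⟨Equiv.ofBijective f hbij, hm, measurable_symm_of_measurable hm,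
    fun x => φ.2.2 _ _ (hf x)⟩, Subtype.ext (PEquiv.ext fun x => ?_)⟩
  exact (hf x).symm

variable [IsProbabilityMeasure μ]

/-- The quotient map from the group of Borel bijections to the full group. -/
noncomputable def toFullGroup (R : PMPRelation X μ) : permGroup R.rel →* fullGroup R where
  toFun g := ⟨SeparationQuotient.mk (toBorelFullSemigroup R g),
    _, toBorelFullSemigroup_mem R g, rfl⟩
  map_one' := rfl
  map_mul' _ _ := rfl

theorem toFullGroup_surjective [StandardBorelSpace X] (R : PMPRelation X μ) :
    Function.Surjective (toFullGroup R) := by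
  rintro ⟨φ, ψ, hψ, rfl⟩
  obtain ⟨g, rfl⟩ := exists_toBorelFullSemigroup_eq hψ
  exact ⟨g, rfl⟩

theorem dist_toFullGroup (R : PMPRelation X μ) (g h : permGroup R.rel) :
    dist (toFullGroup R g) (toFullGroup R h) = μ.real {x | g.1 x ≠ h.1 x} := by
  change dist (SeparationQuotient.mk (toBorelFullSemigroup R g))
    (SeparationQuotient.mk (toBorelFullSemigroup R h)) = _
  rw [SeparationQuotient.dist_mk, BorelFullSemigroup.dist_def]
  simp [toBorelFullSemigroup_apply]

/-- Up to small measure `g` is determined by finitely many of the sets `{g = γ i}`, and each of them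
can be replaced by a member of a countable dense family of Borel sets. This leaves countably many
codes. -/
theorem Generates.secondCountable_fullGroup [StandardBorelSpace X] {R : PMPRelation X μ}
    {γ : ℕ → permGroup R.rel} (hγ : Generates R γ) : SecondCountableTopology (fullGroup R) := by
  obtain ⟨𝒜, h𝒜c, h𝒜⟩ := exists_countable_measureDense (μ := μ)
  obtain ⟨S, hS⟩ := h𝒜c.exists_eq_range h𝒜.nonempty
  refine Metric.secondCountable_of_countable_discretization fun ε hε => ?_
  let A : permGroup R.rel → ℕ → Set X := fun g i => {x | g.1 x = (γ i).1 x}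
  have hA : ∀ g i, MeasurableSet (A g i) := fun g i =>
    measurableSet_eq_of_measurable (permGroup_measurable _) (permGroup_measurable _)
  have hI : ∀ g, ∃ I : ℕ, μ.real (⋃ i < I, A g i)ᶜ < ε / 2 := by
    intro g
    have hmono : Antitone fun I : ℕ => (⋃ i < I, A g i)ᶜ := fun I J hIJ =>
      Set.compl_subset_compl.2 (Set.biUnion_mono (fun i hi => lt_of_lt_of_le hi hIJ)
        fun _ _ => subset_rfl)
    have hlim := tendsto_measure_iInter_atTop (μ := μ) (s := fun I : ℕ => (⋃ i < I, A g i)ᶜ)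
      (fun I => (MeasurableSet.iUnion fun i => MeasurableSet.iUnion fun _ =>
        hA g i).compl.nullMeasurableSet) hmono ⟨0, measure_ne_top _ _⟩
    have h0 : μ (⋂ I : ℕ, (⋃ i < I, A g i)ᶜ) = 0 := by
      rw [measure_eq_zero_iff_ae_notMem]
      filter_upwards [hγ.2] with x hx hc
      obtain ⟨n, hn⟩ := hx _ (permGroup_rel g x)
      refine Set.mem_iInter.1 hc (n + 1) ?_
      exact Set.mem_biUnion (show n < n + 1 from n.lt_succ_self) hn.symm
    rw [h0] at hlim
    have hlim' : Tendsto (fun I : ℕ => μ.real (⋃ i < I, A g i)ᶜ) atTop (𝓝 0) :=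
      (ENNReal.tendsto_toReal ENNReal.zero_ne_top).comp hlim
    exact (hlim'.eventually_lt_const (half_pos hε)).exists
  choose I hI using hI
  -- Comparing two elements with the same code doubles this tolerance, and the `I g` indices then
  -- contribute at most `ε / 2`.
  have hn : ∀ g, ∀ i : Fin (I g), ∃ n, μ.real (symmDiff (A g i) (S n)) < ε / (4 * (I g + 1)) := by
    intro g i
    obtain ⟨t, ht, htlt⟩ := h𝒜.approx (A g i) (hA g i) (measure_ne_top _ _) (ε / (4 * (I g + 1)))
      (by positivity)
    obtain ⟨n, rfl⟩ := (hS ▸ ht : t ∈ Set.range S)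
    exact ⟨n, by
      rw [measureReal_def]
      exact (ENNReal.ofReal_lt_ofReal_iff (by positivity)).1
        (by rwa [ENNReal.ofReal_toReal (measure_ne_top _ _)])⟩
  choose n hn using hn
  have key : ∀ (g h : permGroup R.rel), (⟨I g, n g⟩ : Σ k : ℕ, Fin k → ℕ) = ⟨I h, n h⟩ →
      μ.real {x | g.1 x ≠ h.1 x} ≤ ε := by
    intro g h hgh
    have hsub : {x | g.1 x ≠ h.1 x} ⊆ (⋃ i < I g, A g i)ᶜ ∪
        ⋃ i : Fin (I g), symmDiff (A g i) (A h i) := by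
      intro x hx
      by_cases hxA : x ∈ ⋃ i < I g, A g i
      · refine Or.inr ?_
        simp only [Set.mem_iUnion] at hxA
        obtain ⟨i, hi, hxi⟩ := hxA
        refine Set.mem_iUnion.2 ⟨⟨i, hi⟩, Or.inl ⟨hxi, fun hxh => hx ?_⟩⟩
        exact (show g.1 x = _ from hxi).trans (show h.1 x = _ from hxh).symm
      · exact Or.inl hxA
    have hsd : ∀ i : Fin (I g), μ.real (symmDiff (A g i) (A h i)) ≤ ε / (2 * (I g + 1)) := by
      intro i
      obtain ⟨hIe, hne⟩ := Sigma.mk.inj_iff.1 hgh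
      have h1 := hn g i
      have h2 := hn h ⟨i, hIe ▸ i.2⟩
      have hne' : n g i = n h ⟨i, hIe ▸ i.2⟩ := by
        have : ∀ (a b : ℕ) (hab : a = b) (u : Fin a → ℕ) (v : Fin b → ℕ) (_ : HEq u v)
            (i : Fin a), u i = v ⟨i, hab ▸ i.2⟩ := by
          rintro a _ rfl u v huv i
          rw [eq_of_heq huv]
        exact this _ _ hIe _ _ hne i
      rw [← hne', show (I h : ℝ) = I g from congrArg _ hIe.symm] at h2
      have h3 : μ.real (symmDiff (A g i) (A h i)) ≤
          μ.real (symmDiff (A g i) (S (n g i))) + μ.real (symmDiff (S (n g i)) (A h i)) :=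
        (measureReal_mono (symmDiff_triangle _ _ _)).trans (measureReal_union_le _ _)
      rw [symmDiff_comm (S (n g i))] at h3
      have : ε / (2 * ((I g : ℝ) + 1)) = ε / (4 * (I g + 1)) + ε / (4 * (I g + 1)) := by
        field_simp; norm_num
      rw [this]
      exact h3.trans (add_le_add h1.le h2.le)
    have hsum : μ.real (⋃ i : Fin (I g), symmDiff (A g i) (A h i)) ≤ ε / 2 := by
      refine (measureReal_iUnion_fintype_le _).trans ((Finset.sum_le_sum fun i _ => hsd i).trans ?_)
      rw [Finset.sum_const, Finset.card_univ, Fintype.card_fin, nsmul_eq_mul]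
      have : (I g : ℝ) * (ε / (2 * (I g + 1))) = ε / 2 * (I g / (I g + 1)) := by
        field_simp
      rw [this]
      refine mul_le_of_le_one_right (half_pos hε).le ?_
      rw [div_le_one (by positivity)]
      linarith
    refine (measureReal_mono hsub).trans ((measureReal_union_le _ _).trans ?_)
    linarith [hI g]
  choose rep hrep using toFullGroup_surjective R
  refine ⟨Σ k : ℕ, Fin k → ℕ, inferInstance, fun φ => ⟨I (rep φ), n (rep φ)⟩, fun φ ψ h => ?_⟩
  rw [← hrep φ, ← hrep ψ, dist_toFullGroup]
  exact key _ _ h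

end FullGroup

/-! ### Normalized counting on finite sets -/

/-- The normalized counting measure of a subset of an `n`-element set. -/
noncomputable def density {n : ℕ} (s : Set (Fin n)) : ℝ := s.ncard / n

theorem density_nonneg {n : ℕ} (s : Set (Fin n)) : 0 ≤ density s := by
  unfold density; positivity

theorem density_mono {n : ℕ} {s t : Set (Fin n)} (h : s ⊆ t) : density s ≤ density t := by
  unfold density
  gcongr
  exact Set.toFinite t

theorem density_union_le {n : ℕ} (s t : Set (Fin n)) : density (s ∪ t) ≤ density s + density t := by
  unfold density
  rw [← add_div]
  gcongr
  exact_mod_cast Set.ncard_union_le s t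

theorem density_union_of_disjoint {n : ℕ} {s t : Set (Fin n)} (h : Disjoint s t) :
    density (s ∪ t) = density s + density t := by
  unfold density
  rw [← add_div, Set.ncard_union_eq h, Nat.cast_add]

theorem density_univ {n : ℕ} (hn : 0 < n) : density (Set.univ : Set (Fin n)) = 1 := by
  unfold density
  rw [Set.ncard_univ, Nat.card_eq_fintype_card, Fintype.card_fin, div_self]
  exact_mod_cast hn.ne'

theorem density_le_one {n : ℕ} (s : Set (Fin n)) : density s ≤ 1 := by
  refine div_le_one_of_le₀ ?_ (Nat.cast_nonneg n)
  have h := Set.ncard_le_ncard (Set.subset_univ s)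
  rw [Set.ncard_univ, Nat.card_eq_fintype_card, Fintype.card_fin] at h
  exact_mod_cast h

theorem density_compl {n : ℕ} (hn : 0 < n) (s : Set (Fin n)) : density sᶜ = 1 - density s := by
  rw [← density_univ hn, ← Set.union_compl_self s, density_union_of_disjoint disjoint_compl_right]
  ring

theorem density_preimage {n : ℕ} (σ : Equiv.Perm (Fin n)) (s : Set (Fin n)) :
    density (σ ⁻¹' s) = density s := by
  unfold density
  rw [Set.ncard_preimage_of_injective_subset_range σ.injective (by simp)]

theorem abs_density_sub_le {n : ℕ} {s t b : Set (Fin n)} (h : ∀ i ∉ b, i ∈ s ↔ i ∈ t) :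
    |density s - density t| ≤ density b := by
  rw [abs_le]
  have h1 : density s ≤ density t + density b := (density_mono fun i hi => by
    by_cases hb : i ∈ b
    · exact Or.inr hb
    · exact Or.inl ((h i hb).1 hi)).trans (density_union_le _ _)
  have h2 : density t ≤ density s + density b := (density_mono fun i hi => by
    by_cases hb : i ∈ b
    · exact Or.inr hb
    · exact Or.inl ((h i hb).2 hi)).trans (density_union_le _ _)
  constructor <;> linarith

theorem pbijDist_eq_density {n : ℕ} (f g : Fin n ≃. Fin n) :
    pbijDist f g = density {i | f i ≠ g i} := rfl

theorem permDist_eq_density {n : ℕ} (σ τ : Equiv.Perm (Fin n)) :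
    permDist σ τ = density {i | σ i ≠ τ i} := rfl

theorem finTrace_eq_density {n : ℕ} (f : Fin n ≃. Fin n) :
    finTrace f = density {i | f i = some i} := rfl

theorem pbijDist_comm {n : ℕ} (f g : Fin n ≃. Fin n) : pbijDist f g = pbijDist g f := by
  simp only [pbijDist, ne_comm]

theorem pbijDist_triangle {n : ℕ} (f g h : Fin n ≃. Fin n) :
    pbijDist f h ≤ pbijDist f g + pbijDist g h := by
  refine (density_mono fun i hi => ?_).trans (density_union_le _ _)
  by_contra hc
  simp only [Set.mem_union, Set.mem_ofPred_eq, not_or, not_not] at hc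
  exact hi (hc.1.trans hc.2)

theorem density_preimage_pequiv_le {n : ℕ} (g : Fin n ≃. Fin n) (s : Set (Fin n)) :
    density {i | ∃ j ∈ s, g i = some j} ≤ density s := by
  refine div_le_div_of_nonneg_right (Nat.cast_le.2 ?_) (Nat.cast_nonneg n)
  refine Set.ncard_le_ncard_of_injOn (fun i => (g i).getD i) ?_ ?_ (Set.toFinite s)
  · rintro i ⟨j, hj, hij⟩
    simpa [hij] using hj
  · rintro i ⟨j, hj, hij⟩ i' ⟨j', hj', hij'⟩ h
    simp only [hij, hij', Option.getD_some] at h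
    exact g.inj (b := j) hij (h ▸ hij')

theorem pbijDist_trans_trans_le {n : ℕ} (g g' h h' : Fin n ≃. Fin n) :
    pbijDist (g.trans h) (g'.trans h') ≤ pbijDist g g' + pbijDist h h' := by
  refine (density_mono (t := {i | g i ≠ g' i} ∪ {i | ∃ j ∈ {j | h j ≠ h' j}, g i = some j})
    fun i hi => ?_).trans ((density_union_le _ _).trans
      (add_le_add le_rfl (density_preimage_pequiv_le _ _)))
  by_cases hgg : g i = g' i
  · right
    change (g i).bind h ≠ (g' i).bind h' at hi
    rw [← hgg] at hi
    cases hy : g i with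
    | none => simp [hy] at hi
    | some y =>
      rw [hy] at hi
      exact ⟨y, hi, hy⟩
  · exact Or.inl hgg

theorem abs_finTrace_sub_le {n : ℕ} (f g : Fin n ≃. Fin n) :
    |finTrace f - finTrace g| ≤ pbijDist f g := by
  refine abs_density_sub_le fun i hi => ?_
  have : f i = g i := by
    by_contra hc; exact hi hc
  simp [this]

theorem exists_perm_extending {n : ℕ} (f : Fin n ≃. Fin n) :
    ∃ σ : Equiv.Perm (Fin n), ∀ i j, f i = some j → σ i = j := by
  obtain ⟨g, hg⟩ := Set.MapsTo.exists_equiv_extend_of_card_eq (α := Fin n) (β := Fin n)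
    (t := Finset.univ) (by simp) (s := {i | ∃ j, f i = some j}) (f := fun i => (f i).getD i)
    (by simp) (by
      rintro i ⟨j, hij⟩ i' ⟨j', hij'⟩ h
      simp only [hij, hij', Option.getD_some] at h
      exact f.inj (b := j) hij (h ▸ hij'))
  refine ⟨g.trans (Equiv.subtypeUnivEquiv fun i => Finset.mem_univ i), fun i j hij => ?_⟩
  have := hg i ⟨j, hij⟩
  simpa [hij] using this

/-- `f` and `σ` differ only where `f` is undefined, and there `f.trans g` is undefined as well. -/
theorem pbijDist_toPEquiv_le {n : ℕ} {f g : Fin n ≃. Fin n} {σ : Equiv.Perm (Fin n)}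
    (h : ∀ i j, f i = some j → σ i = j) :
    pbijDist f σ.toPEquiv ≤ pbijDist (PEquiv.refl _) (f.trans g) := by
  refine density_mono fun i hi hc => hi ?_
  obtain ⟨j, hj, -⟩ := (PEquiv.trans_eq_some f g i i).1 hc.symm
  rw [hj, Equiv.toPEquiv_apply, h i j hj]

/-! ### Sofic approximations restricted to the full group -/

section FullGroup

variable {X : Type*} [MeasurableSpace X] {μ : Measure X} [IsProbabilityMeasure μ]

theorem tr_toFullGroup (R : PMPRelation X μ) (g : permGroup R.rel) :
    FullSemigroup.tr (toFullGroup R g : FullSemigroup R) = μ.real {x | g.1 x = x} := by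
  change μ.real {x | (toBorelFullSemigroup R g).1 x = some x} = _
  simp [toBorelFullSemigroup_apply]

/-- The fixed points of `c⁻¹ u` are the points where `u` and `c` agree; thus control of traces
becomes control of distances. -/
theorem tr_inv_mul [StandardBorelSpace X] (R : PMPRelation X μ) (u c : fullGroup R) :
    FullSemigroup.tr ((c⁻¹ * u : fullGroup R) : FullSemigroup R) = 1 - dist u c := by
  obtain ⟨g, rfl⟩ := toFullGroup_surjective R u
  obtain ⟨h, rfl⟩ := toFullGroup_surjective R c
  rw [← map_inv, ← map_mul, tr_toFullGroup, dist_toFullGroup]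
  have hm := measurableSet_eq_of_measurable (permGroup_measurable g) (permGroup_measurable h)
  have h1 : {x | g.1 x ≠ h.1 x} = {x | g.1 x = h.1 x}ᶜ := rfl
  have h2 : {x | (h⁻¹ * g).1 x = x} = {x | g.1 x = h.1 x} := by
    ext x
    exact Equiv.Perm.inv_eq_iff_eq
  rw [h1, h2, probReal_compl_eq_one_sub hm]
  ring

/-- Comparing a product with a third element puts almost multiplicativity and almost isometry into
one inequality. -/
theorem IsSofic.exists_perm_approximation [StandardBorelSpace X] {R : PMPRelation X μ}
    (hR : IsSofic R)
    {F : Set (fullGroup R)} (hF : F.Finite) {ε : ℝ} (hε : 0 < ε) :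
    ∃ N : ℕ, 0 < N ∧ ∃ σ : fullGroup R → Equiv.Perm (Fin N), ∀ a ∈ F, ∀ b ∈ F, ∀ c ∈ F,
      |permDist (σ a * σ b) (σ c) - dist (a * b) c| < ε := by
  let S : Set (fullGroup R) := F ∪ Set.image2 (· * ·) F F
  have hS : S.Finite := hF.union (hF.image2 _ hF)
  -- The inverses make `π u` almost invertible for `u ∈ S`; the products added in `K` give access to
  -- the trace of `c⁻¹ u`.
  let T : Set (fullGroup R) := S ∪ (fun u => u⁻¹) '' S
  have hT : T.Finite := hS.union (hS.image _)
  let K : Set (fullGroup R) := T ∪ Set.image2 (· * ·) T T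
  have hK : K.Finite := hT.union (hT.image2 _ hT)
  -- Multiplicativity of the permutations costs four of these errors, recovering a distance from a
  -- trace five.
  obtain ⟨N, hN, π, ⟨hπ1, -⟩, hπm, hπt⟩ := hR _ (hK.image Subtype.val) (ε / 10) (by positivity)
  let p : fullGroup R → (Fin N ≃. Fin N) := fun u => π u.1
  have hp1 : p 1 = PEquiv.refl _ := hπ1
  have hpm : ∀ u ∈ T, ∀ v ∈ T, pbijDist (p (u * v)) ((p v).trans (p u)) < ε / 10 :=
    fun u hu v hv => hπm _ ⟨u, Or.inl hu, rfl⟩ _ ⟨v, Or.inl hv, rfl⟩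
  have hpt : ∀ u ∈ K, |FullSemigroup.tr u.1 - finTrace (p u)| < ε / 10 :=
    fun u hu => hπt _ ⟨u, hu, rfl⟩
  choose σ hσ using fun u => exists_perm_extending (p u)
  have hinv : ∀ u ∈ S, pbijDist (PEquiv.refl _) ((p u).trans (p u⁻¹)) < ε / 10 := by
    intro u hu
    have := hpm u⁻¹ (Or.inr ⟨u, hu, rfl⟩) u (Or.inl hu)
    rwa [inv_mul_cancel, hp1] at this
  have hσd : ∀ u ∈ S, pbijDist (p u) (σ u).toPEquiv < ε / 10 := fun u hu =>
    (pbijDist_toPEquiv_le (hσ u)).trans_lt (hinv u hu)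
  refine ⟨N, hN, σ, fun a ha b hb c hc => ?_⟩
  have haS : a ∈ S := Or.inl ha
  have hbS : b ∈ S := Or.inl hb
  have hcS : c ∈ S := Or.inl hc
  have habS : a * b ∈ S := Or.inr ⟨a, ha, b, hb, rfl⟩
  have h1 : permDist (σ a * σ b) (σ (a * b)) < 4 * (ε / 10) := by
    have e1 : (σ a * σ b).toPEquiv = (σ b).toPEquiv.trans (σ a).toPEquiv := by
      rw [← Equiv.toPEquiv_trans]; rfl
    rw [permDist_eq_pbijDist, e1]
    have t1 := pbijDist_triangle ((σ b).toPEquiv.trans (σ a).toPEquiv) ((p b).trans (p a))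
      (σ (a * b)).toPEquiv
    have t2 := pbijDist_triangle ((p b).trans (p a)) (p (a * b)) (σ (a * b)).toPEquiv
    have t3 := pbijDist_trans_trans_le (σ b).toPEquiv (p b) (σ a).toPEquiv (p a)
    have t4 := hpm a (Or.inl haS) b (Or.inl hbS)
    rw [pbijDist_comm] at t4
    rw [pbijDist_comm (σ b).toPEquiv, pbijDist_comm (σ a).toPEquiv] at t3
    linarith [hσd a haS, hσd b hbS, hσd _ habS]
  have h2 : |permDist (σ (a * b)) (σ c) - dist (a * b) c| < 5 * (ε / 10) := by
    set u := a * b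
    have hciT : c⁻¹ ∈ T := Or.inr ⟨c, hcS, rfl⟩
    have t1 : |density {i | σ u i = σ c i} - finTrace ((p u).trans (p c⁻¹))| ≤ 3 * (ε / 10) := by
      have hbad : density ({i | p u i ≠ (σ u).toPEquiv i} ∪ ({i | p c i ≠ (σ c).toPEquiv i} ∪
          {i | PEquiv.refl _ i ≠ ((p c).trans (p c⁻¹)) i})) ≤ 3 * (ε / 10) := by
        refine (density_union_le _ _).trans ?_
        have := density_union_le {i | p c i ≠ (σ c).toPEquiv i}
          {i | PEquiv.refl _ i ≠ ((p c).trans (p c⁻¹)) i}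
        have b1 := hσd u habS
        have b2 := hσd c hcS
        have b3 := hinv c hcS
        rw [pbijDist_eq_density] at b1 b2 b3
        linarith
      refine (abs_density_sub_le fun i hi => ?_).trans hbad
      simp only [Set.mem_union, Set.mem_ofPred_eq, not_or, not_not, Equiv.toPEquiv_apply,
        PEquiv.refl_apply] at hi ⊢
      obtain ⟨hu, hc', hcc⟩ := hi
      obtain ⟨j, hj, hji⟩ := (PEquiv.trans_eq_some _ _ _ _).1 hcc.symm
      rw [hc', Option.some.injEq] at hj
      constructor
      · intro h
        exact (PEquiv.trans_eq_some _ _ _ _).2 ⟨σ u i, hu, by rw [h, hj]; exact hji⟩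
      · intro h
        obtain ⟨k, hk, hki⟩ := (PEquiv.trans_eq_some _ _ _ _).1 h
        rw [hu, Option.some.injEq] at hk
        rw [hk, hj]
        exact (p c⁻¹).inj hki hji
    have t2 := hpm c⁻¹ hciT u (Or.inl habS)
    have t3 := abs_finTrace_sub_le (p (c⁻¹ * u)) ((p u).trans (p c⁻¹))
    have t4 := hpt (c⁻¹ * u) (Or.inr ⟨c⁻¹, hciT, u, Or.inl habS, rfl⟩)
    rw [tr_inv_mul] at t4
    have t5 : permDist (σ u) (σ c) = 1 - density {i | σ u i = σ c i} := density_compl hN _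
    rw [t5, abs_lt]
    rw [abs_lt] at t4
    rw [abs_le] at t1 t3
    constructor <;> linarith
  have h3 := permDist_triangle (σ a * σ b) (σ (a * b)) (σ c)
  have h4 := permDist_triangle (σ (a * b)) (σ a * σ b) (σ c)
  rw [permDist_comm (σ (a * b)) (σ a * σ b)] at h4
  rw [abs_lt] at h2 ⊢
  constructor <;> linarith

end FullGroup

/-- At stage `k` an element is replaced by a nearest one among `γ 0, …, γ k`, where `σ k` is
accurate to `1 / (k + 1)`. -/
theorem isMetricallySofic_of_approximations {U : Ultrafilter ℕ} (hU : (U : Filter ℕ) ≤ cofinite)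
    {G : Type*} [Group G] [MetricSpace G] [ContinuousMul G] [TopologicalSpace.SeparableSpace G]
    (h : ∀ F : Set G, F.Finite → ∀ ε : ℝ, 0 < ε → ∃ N : ℕ, 0 < N ∧
      ∃ σ : G → Equiv.Perm (Fin N), ∀ a ∈ F, ∀ b ∈ F, ∀ c ∈ F,
        |permDist (σ a * σ b) (σ c) - dist (a * b) c| < ε) :
    IsMetricallySofic U G := by
  let γ : ℕ → G := TopologicalSpace.denseSeq G
  have hγ : DenseRange γ := TopologicalSpace.denseRange_denseSeq G
  choose N hN σ hσ using fun k : ℕ => h (γ '' Set.Iic k) ((Set.finite_Iic k).image γ)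
    (1 / ((k : ℝ) + 1)) (by positivity)
  have hmin : ∀ (g : G) (k : ℕ), ∃ i ∈ Set.Iic k, ∀ j ∈ Set.Iic k, dist (γ i) g ≤ dist (γ j) g :=
    fun g k => (Set.finite_Iic k).exists_minimalFor (fun i => dist (γ i) g) _ ⟨0, Nat.zero_le k⟩
      |>.imp fun i hi => ⟨hi.1, fun j hj => (le_total _ _).elim id (hi.2 hj)⟩
  choose a ha hamin using hmin
  have hlim : ∀ g, Tendsto (fun k => γ (a g k)) atTop (𝓝 g) := by
    intro g
    rw [Metric.tendsto_atTop]
    intro ε hε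
    obtain ⟨i, hi⟩ := hγ.exists_dist_lt g hε
    exact ⟨i, fun k hk => (hamin g k i hk).trans_lt (by rwa [dist_comm])⟩
  have hUat : (U : Filter ℕ) ≤ atTop := Nat.cofinite_eq_atTop ▸ hU
  let θ : G → PermSeq U N := fun g k => σ k (γ (a g k))
  -- The case `c = g * h` gives multiplicativity, the case `h = 1` the isometry.
  have hθ : ∀ g h c, dist (θ g * θ h) (θ c) = dist (g * h) c := by
    intro g h c
    refine tendsto_nhds_unique (tendsto_permDist (θ g * θ h) (θ c)) ?_
    have h1 : Tendsto (fun k => dist (γ (a g k) * γ (a h k)) (γ (a c k))) atTop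
        (𝓝 (dist (g * h) c)) := ((hlim g).mul (hlim h)).dist (hlim c)
    have h2 : Tendsto (fun k => permDist (σ k (γ (a g k)) * σ k (γ (a h k))) (σ k (γ (a c k))) -
        dist (γ (a g k) * γ (a h k)) (γ (a c k))) atTop (𝓝 0) :=
      squeeze_zero_norm (fun k => (hσ k _ ⟨_, ha g k, rfl⟩ _ ⟨_, ha h k, rfl⟩ _
        ⟨_, ha c k, rfl⟩).le) tendsto_one_div_add_atTop_nhds_zero_nat
    have h3 := (h2.add h1).mono_left hUat
    simp only [sub_add_cancel, zero_add] at h3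
    exact h3
  have hmul : ∀ g h, (SeparationQuotient.mk (θ (g * h)) : PermUltraproduct U N) =
      SeparationQuotient.mk (θ g) * SeparationQuotient.mk (θ h) := by
    intro g h
    rw [← SeparationQuotient.mk_mul, ← dist_eq_zero, dist_comm, SeparationQuotient.dist_mk, hθ,
      dist_self]
  refine ⟨N, hN, MonoidHom.mk' (fun g => SeparationQuotient.mk (θ g)) hmul,
    Isometry.of_dist_eq fun g h => ?_⟩
  change dist (SeparationQuotient.mk (θ g) : PermUltraproduct U N) (SeparationQuotient.mk (θ h)) = _
  conv_lhs => rw [← mul_one g, hmul]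
  rw [← SeparationQuotient.mk_mul, SeparationQuotient.dist_mk, hθ, mul_one]

theorem IsSofic.isMetricallySofic {X : Type*} [MeasurableSpace X] [StandardBorelSpace X]
    {μ : Measure X} [IsProbabilityMeasure μ] {R : PMPRelation X μ} (hR : IsSofic R)
    {U : Ultrafilter ℕ} (hU : (U : Filter ℕ) ≤ cofinite) :
    IsMetricallySofic U (fullGroup R) := by
  obtain ⟨γ, hγ⟩ := R.exists_generates
  have := hγ.secondCountable_fullGroup
  have hc : ContinuousMul (fullGroup R) := Submonoid.continuousMul (fullGroup R)
  exact isMetricallySofic_of_approximations hU fun F hF ε hε =>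
    hR.exists_perm_approximation hF hε

/-! ### Finitely additive probabilities -/

/-- A finitely additive probability defined on all subsets. -/
structure FinAddProb (Ω : Type*) where
  /-- the value on a set -/
  m : Set Ω → ℝ
  nonneg : ∀ s, 0 ≤ m s
  union : ∀ s t, Disjoint s t → m (s ∪ t) = m s + m t
  univ : m Set.univ = 1

namespace FinAddProb

variable {Ω : Type*} (P : FinAddProb Ω)

theorem mono {s t : Set Ω} (h : s ⊆ t) : P.m s ≤ P.m t := by
  have := P.union s (t \ s) Set.disjoint_sdiff_right
  rw [Set.union_sdiff_cancel h] at this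
  linarith [P.nonneg (t \ s)]

theorem empty : P.m ∅ = 0 := by
  have := P.union ∅ ∅ (Set.disjoint_empty _)
  rw [Set.union_empty] at this
  linarith

theorem union_add_inter (s t : Set Ω) : P.m (s ∪ t) + P.m (s ∩ t) = P.m s + P.m t := by
  have h1 := P.union s (t \ s) Set.disjoint_sdiff_right
  have h2 := P.union (t ∩ s) (t \ s) (Set.disjoint_sdiff_right.mono_left Set.inter_subset_right)
  rw [Set.union_sdiff_self] at h1
  rw [Set.inter_union_sdiff, Set.inter_comm] at h2
  linarith

theorem union_le (s t : Set Ω) : P.m (s ∪ t) ≤ P.m s + P.m t := by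
  linarith [P.union_add_inter s t, P.nonneg (s ∩ t)]

theorem compl (s : Set Ω) : P.m sᶜ = 1 - P.m s := by
  have := P.union s sᶜ disjoint_compl_right
  rw [Set.union_compl_self, P.univ] at this
  linarith

/-- The filter of sets of full probability. -/
def ae : Filter Ω where
  sets := {s | P.m sᶜ = 0}
  univ_sets := by simp [P.empty]
  sets_of_superset := fun {s t} hs hst =>
    le_antisymm ((P.mono (Set.compl_subset_compl.2 hst)).trans hs.le) (P.nonneg _)
  inter_sets := fun {s t} hs ht => by
    refine le_antisymm ?_ (P.nonneg _)
    rw [Set.compl_inter]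
    have := P.union_le sᶜ tᶜ
    rwa [show P.m sᶜ = 0 from hs, show P.m tᶜ = 0 from ht, add_zero] at this

theorem eventually_iff {p : Ω → Prop} : (∀ᶠ ω in P.ae, p ω) ↔ P.m {ω | ¬ p ω} = 0 := Iff.rfl

theorem eventually_notMem_iff {s : Set Ω} : (∀ᶠ ω in P.ae, ω ∉ s) ↔ P.m s = 0 := by
  rw [eventually_iff]
  simp

theorem eventually_of_le_zero {s : Set Ω} (h : P.m s ≤ 0) : ∀ᶠ ω in P.ae, ω ∉ s :=
  P.eventually_notMem_iff.2 (le_antisymm h (P.nonneg _))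

theorem mono_ae {s t : Set Ω} (h : ∀ᶠ ω in P.ae, ω ∈ s → ω ∈ t) : P.m s ≤ P.m t := by
  have h1 : s ⊆ t ∪ {ω | ¬ (ω ∈ s → ω ∈ t)} := by
    intro ω hω
    by_cases ht : ω ∈ t
    · exact Or.inl ht
    · exact Or.inr fun hc => ht (hc hω)
  have h2 := (P.mono h1).trans (P.union_le _ _)
  rwa [P.eventually_iff.1 h, add_zero] at h2

theorem congr_ae {s t : Set Ω} (h : ∀ᶠ ω in P.ae, ω ∈ s ↔ ω ∈ t) : P.m s = P.m t :=
  le_antisymm (P.mono_ae (h.mono fun _ h => h.1)) (P.mono_ae (h.mono fun _ h => h.2))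

theorem union_of_ae {s t : Set Ω} (h : ∀ᶠ ω in P.ae, ω ∈ s → ω ∉ t) :
    P.m (s ∪ t) = P.m s + P.m t := by
  have h0 : P.m (s ∩ t) = 0 :=
    P.eventually_notMem_iff.1 (h.mono fun ω h hc => h hc.1 hc.2)
  linarith [P.union_add_inter s t]

end FinAddProb

/-! ### Swaps: unions, conjugates, supports -/

section Swaps

variable {X : Type*} [MeasurableSpace X] [StandardBorelSpace X] {r : Setoid X}

theorem Swappable.of_perm {X : Type*} [MeasurableSpace X] {r : Setoid X} {C : Set X}
    (α : permGroup r) (hC : MeasurableSet C) (h : ∀ x ∈ C, α.1 x ∉ C) :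
    Swappable r α.1 C :=
  ⟨permGroup_measurable α, hC, α.1.injective.injOn, h, fun x _ => permGroup_rel α x⟩

namespace Swappable

variable {F : X → X} {C : Set X}

theorem mem_or_mem_of_perm_ne (h : Swappable r F C) {x : X} (hx : h.perm.1 x ≠ x) :
    x ∈ C ∨ x ∈ F '' C := by
  by_contra! hc
  exact hx (h.perm_apply_of_notMem hc.1 hc.2)

theorem perm_ne_of_mem (h : Swappable r F C) {x : X} (hx : x ∈ C) : h.perm.1 x ≠ x := by
  rw [h.perm_apply_of_mem hx]
  intro hc
  exact h.notMem x hx (hc.symm ▸ hx)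

theorem perm_ne_of_mem_image (h : Swappable r F C) {x : X} (hx : x ∈ F '' C) :
    h.perm.1 x ≠ x := by
  obtain ⟨c, hc, rfl⟩ := hx
  rw [h.perm_apply_apply hc]
  intro hcc
  exact h.notMem c hc (hcc ▸ hc)

theorem setOf_perm_ne (h : Swappable r F C) : {x | h.perm.1 x ≠ x} = C ∪ F '' C := by
  ext x
  exact ⟨h.mem_or_mem_of_perm_ne, fun hx => hx.elim h.perm_ne_of_mem h.perm_ne_of_mem_image⟩

/-- The supports of the two factors are disjoint because `F` is injective on `C` and moves `C` off
itself. This is what allows cores and halves to be cut along partitions. -/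
theorem perm_eq_mul (h : Swappable r F C) {C₁ C₂ : Set X} (h₁ : Swappable r F C₁)
    (h₂ : Swappable r F C₂) (hC : C = C₁ ∪ C₂) (hd : Disjoint C₁ C₂) :
    h.perm = h₁.perm * h₂.perm := by
  subst hC
  refine Subtype.ext (Equiv.ext fun x => ?_)
  change h.perm.1 x = h₁.perm.1 (h₂.perm.1 x)
  have key : ∀ y ∈ C₂, h₁.perm.1 y = y ∧ h₁.perm.1 (F y) = F y := by
    intro y hy
    constructor
    · refine h₁.perm_apply_of_notMem (Set.disjoint_right.1 hd hy) ?_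
      rintro ⟨z, hz, rfl⟩
      exact h.notMem z (Or.inl hz) (Or.inr hy)
    · refine h₁.perm_apply_of_notMem (fun hc => h.notMem y (Or.inr hy) (Or.inl hc)) ?_
      rintro ⟨z, hz, hzy⟩
      have := h.injOn (Or.inl hz) (Or.inr hy) hzy
      exact Set.disjoint_right.1 hd hy (this ▸ hz)
  by_cases hx2 : x ∈ C₂
  · rw [h.perm_apply_of_mem (Or.inr hx2), h₂.perm_apply_of_mem hx2, (key x hx2).2]
  by_cases hx2' : x ∈ F '' C₂
  · obtain ⟨y, hy, rfl⟩ := hx2'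
    rw [h.perm_apply_apply (Or.inr hy), h₂.perm_apply_apply hy, (key y hy).1]
  rw [h₂.perm_apply_of_notMem hx2 hx2']
  by_cases hx1 : x ∈ C₁
  · rw [h.perm_apply_of_mem (Or.inl hx1), h₁.perm_apply_of_mem hx1]
  by_cases hx1' : x ∈ F '' C₁
  · obtain ⟨y, hy, rfl⟩ := hx1'
    rw [h.perm_apply_apply (Or.inl hy), h₁.perm_apply_apply hy]
  rw [h₁.perm_apply_of_notMem hx1 hx1', h.perm_apply_of_notMem (by simp [hx1, hx2])]
  rw [Set.image_union]
  exact fun hc => hc.elim hx1' hx2'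

theorem perm_conj {G : X → X} {D : Set X} (h : Swappable r F C) (k : permGroup r)
    (h' : Swappable r G D) (hD : D = k.1 '' C) (hG : ∀ x ∈ C, G (k.1 x) = k.1 (F x)) :
    h'.perm = k * h.perm * k⁻¹ := by
  subst hD
  rw [eq_mul_inv_iff_mul_eq]
  refine Subtype.ext (Equiv.ext fun x => ?_)
  change h'.perm.1 (k.1 x) = k.1 (h.perm.1 x)
  by_cases hx : x ∈ C
  · rw [h.perm_apply_of_mem hx, h'.perm_apply_of_mem ⟨x, hx, rfl⟩, hG x hx]
  by_cases hx' : x ∈ F '' C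
  · obtain ⟨y, hy, rfl⟩ := hx'
    rw [h.perm_apply_apply hy, ← hG y hy, h'.perm_apply_apply ⟨y, hy, rfl⟩]
  rw [h.perm_apply_of_notMem hx hx', h'.perm_apply_of_notMem]
  · rwa [k.1.injective.mem_set_image]
  · rintro ⟨_, ⟨y, hy, rfl⟩, hyx⟩
    rw [hG y hy] at hyx
    exact hx' ⟨y, hy, k.1.injective hyx⟩

theorem measureReal_perm_ne {μ : Measure X} [IsProbabilityMeasure μ] {R : PMPRelation X μ}
    (h : Swappable R.rel F C) : μ.real {x | h.perm.1 x ≠ x} = 2 * μ.real C := by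
  rw [h.setOf_perm_ne, measureReal_union, two_mul, measureReal_def, measureReal_def,
    R.measure_image_of_injOn h.measurable h.measurableSet h.injOn h.rel]
  · rw [Set.disjoint_right]
    rintro _ ⟨x, hx, rfl⟩
    exact h.notMem x hx
  · exact h.measurableSet_image

end Swappable

end Swaps

/-! ### Approximate representations by permutations -/

section Rep

variable {X : Type*} [MeasurableSpace X] {μ : Measure X} {R : PMPRelation X μ} {Ω : Type*}

/-- `ρ` is multiplicative almost everywhere, isometric, and preserves the probability `P`. -/
structure IsIsometricRep (P : FinAddProb Ω) (R : PMPRelation X μ)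
    (ρ : permGroup R.rel → Equiv.Perm Ω) : Prop where
  mul : ∀ g h, ∀ᶠ ω in P.ae, ρ (g * h) ω = ρ g (ρ h ω)
  dist : ∀ g h, P.m {ω | ρ g ω ≠ ρ h ω} = μ.real {x | g.1 x ≠ h.1 x}
  preimage : ∀ g s, P.m (ρ g ⁻¹' s) = P.m s

namespace IsIsometricRep

variable {P : FinAddProb Ω} {ρ : permGroup R.rel → Equiv.Perm Ω}

theorem comp {p : Ω → Prop} (h : IsIsometricRep P R ρ) (g : permGroup R.rel)
    (hp : ∀ᶠ ω in P.ae, p ω) : ∀ᶠ ω in P.ae, p (ρ g ω) := by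
  rw [P.eventually_iff] at hp ⊢
  rw [← hp]
  exact h.preimage g {ω | ¬ p ω}

theorem one (h : IsIsometricRep P R ρ) : ∀ᶠ ω in P.ae, ρ 1 ω = ω := by
  filter_upwards [h.mul 1 1] with ω hω
  rw [mul_one] at hω
  exact ((ρ 1).injective hω).symm

theorem moved (h : IsIsometricRep P R ρ) (g : permGroup R.rel) :
    P.m {ω | ρ g ω ≠ ω} = μ.real {x | g.1 x ≠ x} := by
  rw [← show _ = μ.real {x | g.1 x ≠ x} from h.dist g 1]
  refine P.congr_ae ?_
  filter_upwards [h.one] with ω hω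
  simp [hω]

theorem inv (h : IsIsometricRep P R ρ) (g : permGroup R.rel) :
    ∀ᶠ ω in P.ae, ρ g⁻¹ (ρ g ω) = ω := by
  filter_upwards [h.mul g⁻¹ g, h.one] with ω hω h1
  rw [← hω, inv_mul_cancel, h1]

theorem measurableSet_ne [StandardBorelSpace X] (g : permGroup R.rel) :
    MeasurableSet {x | g.1 x ≠ x} :=
  (measurableSet_eq_of_measurable (permGroup_measurable g) measurable_id).compl

/-- The support of `g k` has the sum of the measures of the two supports, while that of `ρ (g k)`
lies, up to a null set, in the union of the supports of `ρ g` and `ρ k`. Since `ρ` preserves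
measures of supports, the intersection of the latter is null. -/
theorem disjoint [StandardBorelSpace X] [IsProbabilityMeasure μ]
    (h : IsIsometricRep P R ρ) {g k : permGroup R.rel}
    (hgk : ∀ᵐ x ∂μ, g.1 x = x ∨ k.1 x = x) : ∀ᶠ ω in P.ae, ρ g ω = ω ∨ ρ k ω = ω := by
  have h1 : P.m {ω | ρ (g * k) ω ≠ ω} ≤ P.m ({ω | ρ g ω ≠ ω} ∪ {ω | ρ k ω ≠ ω}) := by
    refine P.mono_ae ?_
    filter_upwards [h.mul g k] with ω hω hne
    by_contra hc
    simp only [Set.mem_union, Set.mem_ofPred_eq, not_or, not_not] at hc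
    exact hne (by rw [hω, hc.2, hc.1])
  have h2 := P.union_add_inter {ω | ρ g ω ≠ ω} {ω | ρ k ω ≠ ω}
  rw [h.moved, h.moved] at h2
  rw [h.moved] at h1
  have h3 : μ.real {x | g.1 x ≠ x} + μ.real {x | k.1 x ≠ x} ≤ μ.real {x | (g * k).1 x ≠ x} := by
    have hd : AEDisjoint μ {x | g.1 x ≠ x} {x | k.1 x ≠ x} := by
      refine measure_eq_zero_iff_ae_notMem.2 ?_
      filter_upwards [hgk] with x hx hc
      exact hx.elim hc.1 hc.2
    rw [← measureReal_union₀ (measurableSet_ne k).nullMeasurableSet hd]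
    refine ENNReal.toReal_mono (measure_ne_top _ _) (measure_mono_ae ?_)
    filter_upwards [hgk] with x hx hxu
    change g.1 (k.1 x) ≠ x
    rcases hx with hx | hx
    · have hk : k.1 x ≠ x := hxu.elim (fun hc => absurd hx hc) id
      intro hc
      exact hk (g.1.injective (hc.trans hx.symm))
    · have hg : g.1 x ≠ x := hxu.elim id (fun hc => absurd hx hc)
      rwa [hx]
  have h4 : P.m ({ω | ρ g ω ≠ ω} ∩ {ω | ρ k ω ≠ ω}) ≤ 0 := by linarith
  filter_upwards [P.eventually_of_le_zero h4] with ω hω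
  by_contra! hc
  exact hω hc

end IsIsometricRep

end Rep

/-! ### Sets with two disjoint translates -/

/-- `B` is Borel and `B`, `α B`, `β B` are pairwise disjoint. -/
structure IsTriple {X : Type*} [MeasurableSpace X] {r : Setoid X} (α β : permGroup r)
    (B : Set X) : Prop where
  measurableSet : MeasurableSet B
  left : ∀ x ∈ B, α.1 x ∉ B
  right : ∀ x ∈ B, β.1 x ∉ B
  ne : ∀ x ∈ B, ∀ y ∈ B, α.1 x ≠ β.1 y

namespace IsTriple

section

variable {X : Type*} [MeasurableSpace X] {r : Setoid X} {α β : permGroup r} {B : Set X}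

theorem swapLeft (T : IsTriple α β B) : Swappable r α.1 B := .of_perm α T.measurableSet T.left

theorem swapRight (T : IsTriple α β B) : Swappable r β.1 B := .of_perm β T.measurableSet T.right

theorem mono (T : IsTriple α β B) {C : Set X} (hC : MeasurableSet C) (hCB : C ⊆ B) :
    IsTriple α β C :=
  ⟨hC, fun x hx hc => T.left x (hCB hx) (hCB hc), fun x hx hc => T.right x (hCB hx) (hCB hc),
    fun x hx y hy => T.ne x (hCB hx) y (hCB hy)⟩

theorem conj (T : IsTriple α β B) (k : permGroup r) :
    IsTriple (k * α * k⁻¹) (k * β * k⁻¹) (k.1 '' B) := by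
  have hk : ∀ (g : permGroup r) x, (k * g * k⁻¹).1 (k.1 x) = k.1 (g.1 x) := fun g x =>
    congrArg (fun y => k.1 (g.1 y)) (k.1.symm_apply_apply x)
  refine ⟨permGroup_measurableSet_image k T.measurableSet, ?_, ?_, ?_⟩
  · rintro _ ⟨x, hx, rfl⟩
    rw [hk, k.1.injective.mem_set_image]
    exact T.left x hx
  · rintro _ ⟨x, hx, rfl⟩
    rw [hk, k.1.injective.mem_set_image]
    exact T.right x hx
  · rintro _ ⟨x, hx, rfl⟩ _ ⟨y, hy, rfl⟩
    rw [hk, hk]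
    exact fun hc => T.ne x hx y hy (k.1.injective hc)

variable [StandardBorelSpace X]

/-- The involution exchanging `B` and `α B`. -/
noncomputable def a (T : IsTriple α β B) : permGroup r := T.swapLeft.perm

/-- The involution exchanging `B` and `β B`. -/
noncomputable def b (T : IsTriple α β B) : permGroup r := T.swapRight.perm

theorem a_apply (T : IsTriple α β B) {x : X} (hx : x ∈ B) : T.a.1 x = α.1 x :=
  T.swapLeft.perm_apply_of_mem hx

theorem a_apply_left (T : IsTriple α β B) {x : X} (hx : x ∈ B) : T.a.1 (α.1 x) = x :=
  T.swapLeft.perm_apply_apply hx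

theorem a_apply_right (T : IsTriple α β B) {x : X} (hx : x ∈ B) : T.a.1 (β.1 x) = β.1 x :=
  T.swapLeft.perm_apply_of_notMem (T.right x hx) fun ⟨y, hy, h⟩ => T.ne y hy x hx h

theorem b_apply (T : IsTriple α β B) {x : X} (hx : x ∈ B) : T.b.1 x = β.1 x :=
  T.swapRight.perm_apply_of_mem hx

theorem b_apply_right (T : IsTriple α β B) {x : X} (hx : x ∈ B) : T.b.1 (β.1 x) = x :=
  T.swapRight.perm_apply_apply hx

theorem b_apply_left (T : IsTriple α β B) {x : X} (hx : x ∈ B) : T.b.1 (α.1 x) = α.1 x :=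
  T.swapRight.perm_apply_of_notMem (T.left x hx) fun ⟨y, hy, h⟩ => T.ne x hx y hy h.symm

theorem a_ne (T : IsTriple α β B) {x : X} (hx : T.a.1 x ≠ x) : x ∈ B ∨ ∃ y ∈ B, α.1 y = x :=
  T.swapLeft.mem_or_mem_of_perm_ne hx

theorem b_ne (T : IsTriple α β B) {x : X} (hx : T.b.1 x ≠ x) : x ∈ B ∨ ∃ y ∈ B, β.1 y = x :=
  T.swapRight.mem_or_mem_of_perm_ne hx

/-- On `B ⊔ αB ⊔ βB` the involutions act as two transpositions of `S₃`; both sides are the third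
one, exchanging `αB` and `βB`. -/
theorem aba_eq_bab (T : IsTriple α β B) : T.a * T.b * T.a = T.b * T.a * T.b := by
  refine Subtype.ext (Equiv.ext fun x => ?_)
  change T.a.1 (T.b.1 (T.a.1 x)) = T.b.1 (T.a.1 (T.b.1 x))
  by_cases h1 : x ∈ B
  · rw [T.a_apply h1, T.b_apply_left h1, T.a_apply_left h1, T.b_apply h1, T.a_apply_right h1,
      T.b_apply_right h1]
  by_cases h2 : ∃ y ∈ B, α.1 y = x
  · obtain ⟨y, hy, rfl⟩ := h2
    rw [T.a_apply_left hy, T.b_apply hy, T.a_apply_right hy, T.b_apply_left hy, T.a_apply_left hy,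
      T.b_apply hy]
  by_cases h3 : ∃ y ∈ B, β.1 y = x
  · obtain ⟨y, hy, rfl⟩ := h3
    rw [T.a_apply_right hy, T.b_apply_right hy, T.a_apply hy, T.b_apply_left hy]
  have ha : T.a.1 x = x := by
    by_contra hc
    exact (T.a_ne hc).elim h1 h2
  have hb : T.b.1 x = x := by
    by_contra hc
    exact (T.b_ne hc).elim h1 h3
  rw [ha, hb, ha, hb]

theorem aa (T : IsTriple α β B) : T.a * T.a = 1 := T.swapLeft.perm_mul_perm

theorem bb (T : IsTriple α β B) : T.b * T.b = 1 := T.swapRight.perm_mul_perm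

end

/-! ### The set represented by a triple -/

variable {X : Type*} [MeasurableSpace X] [StandardBorelSpace X] {μ : Measure X}
  {R : PMPRelation X μ} {Ω : Type*} {P : FinAddProb Ω}
  {ρ : permGroup R.rel → Equiv.Perm Ω} {α β α' β' : permGroup R.rel} {B B' : Set X}

/-- The common part of the supports of the two involutions of a triple. -/
def Core (ρ : permGroup R.rel → Equiv.Perm Ω) (T : IsTriple α β B) : Set Ω :=
  {ω | ρ T.a ω ≠ ω ∧ ρ T.b ω ≠ ω}

theorem core_conj (h : IsIsometricRep P R ρ) (T : IsTriple α β B) (k : permGroup R.rel) :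
    ∀ᶠ ω in P.ae, ω ∈ Core ρ T → ρ k ω ∈ Core ρ (T.conj k) := by
  have hk : ∀ (g : permGroup R.rel) x, (k * g * k⁻¹).1 (k.1 x) = k.1 (g.1 x) := fun g x =>
    congrArg (fun y => k.1 (g.1 y)) (k.1.symm_apply_apply x)
  have ha : (T.conj k).a = k * T.a * k⁻¹ :=
    T.swapLeft.perm_conj k (T.conj k).swapLeft rfl fun x _ => hk α x
  have hb : (T.conj k).b = k * T.b * k⁻¹ :=
    T.swapRight.perm_conj k (T.conj k).swapRight rfl fun x _ => hk β x
  filter_upwards [h.inv k, h.comp k (h.mul (k * T.a) k⁻¹), h.mul k T.a,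
    h.comp k (h.mul (k * T.b) k⁻¹), h.mul k T.b] with ω h1 h2 h3 h4 h5 hω
  rw [h1, h3] at h2
  rw [h1, h5] at h4
  refine ⟨?_, ?_⟩
  · rw [ha, h2]
    exact fun hc => hω.1 ((ρ k).injective hc)
  · rw [hb, h4]
    exact fun hc => hω.2 ((ρ k).injective hc)

variable [IsProbabilityMeasure μ]

/-- With `c = aba`, the supports of `ρ a`, `ρ b`, `ρ c` have measure `2μ(B)` each, and the support
`V` of `ρ (ab)` has at least `3μ(B)`. Since `V` lies in each union of two supports, each
intersection of two has measure at most `μ(B)`. Since `V` also lies in the union of these three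
intersections, equality holds throughout and the triple intersection is null. -/
theorem core_aux (h : IsIsometricRep P R ρ) (T : IsTriple α β B) :
    P.m (Core ρ T) = μ.real B ∧ ∀ᶠ ω in P.ae, ω ∈ Core ρ T → ρ (T.a * T.b * T.a) ω = ω := by
  set a := T.a
  set b := T.b
  set c := T.a * T.b * T.a with hc
  -- The 3-cycle `ab` is also `ca` and `bc`, so a point fixed by two of `ρ a`, `ρ b`, `ρ c` is,
  -- almost everywhere, fixed by `ρ (ab)`.
  have hca : a * b = c * a := by
    rw [hc, mul_assoc _ T.a, T.aa, mul_one]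
  have hbc : a * b = b * c := by
    rw [hc, T.aba_eq_bab, ← mul_assoc, ← mul_assoc, T.bb, one_mul]
  have hma : P.m {ω | ρ a ω ≠ ω} = 2 * μ.real B := by
    rw [h.moved]; exact T.swapLeft.measureReal_perm_ne
  have hmb : P.m {ω | ρ b ω ≠ ω} = 2 * μ.real B := by
    rw [h.moved]; exact T.swapRight.measureReal_perm_ne
  have hmc : P.m {ω | ρ c ω ≠ ω} = 2 * μ.real B := by
    rw [h.moved, ← T.swapRight.measureReal_perm_ne]
    have : {x | c.1 x ≠ x} = a.1 ⁻¹' {x | b.1 x ≠ x} := by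
      ext x
      have haa : ∀ y, a.1 (a.1 y) = y := T.swapLeft.perm_perm
      change a.1 (b.1 (a.1 x)) ≠ x ↔ b.1 (a.1 x) ≠ a.1 x
      rw [not_iff_not]
      constructor
      · intro hx
        conv_rhs => rw [← hx]
        rw [haa]
      · intro hx
        rw [hx, haa]
    rw [this, measureReal_def, (R.measurePreserving a).measure_preimage
      (IsIsometricRep.measurableSet_ne b).nullMeasurableSet, ← measureReal_def]
    rfl
  set V : Set Ω := {ω | ρ (a * b) ω ≠ ω}
  have hV : 3 * μ.real B ≤ P.m V := by
    rw [h.moved]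
    have hsub : B ∪ (α.1 '' B ∪ β.1 '' B) ⊆ {x | (a * b).1 x ≠ x} := by
      rintro x (hx | ⟨y, hy, rfl⟩ | ⟨y, hy, rfl⟩)
      · change a.1 (b.1 x) ≠ x
        rw [T.b_apply hx, T.a_apply_right hx]
        exact fun hc => T.right x hx (hc.symm ▸ hx)
      · change a.1 (b.1 (α.1 y)) ≠ α.1 y
        rw [T.b_apply_left hy, T.a_apply_left hy]
        exact fun hc => T.left y hy (hc ▸ hy)
      · change a.1 (b.1 (β.1 y)) ≠ β.1 y
        rw [T.b_apply_right hy, T.a_apply hy]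
        exact T.ne y hy y hy
    refine le_trans (le_of_eq ?_) (measureReal_mono hsub)
    have hmB := T.measurableSet
    have hα : MeasurableSet (α.1 '' B) := permGroup_measurableSet_image α hmB
    have hβ : MeasurableSet (β.1 '' B) := permGroup_measurableSet_image β hmB
    rw [measureReal_union _ (hα.union hβ), measureReal_union _ hβ, measureReal_def,
      measureReal_def, measureReal_def, R.measure_image α hmB, R.measure_image β hmB]
    · ring
    · rw [Set.disjoint_left]
      rintro _ ⟨x, hx, rfl⟩ ⟨y, hy, hyx⟩
      exact T.ne x hx y hy hyx.symm
    · rw [Set.disjoint_left]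
      rintro x hx (⟨y, hy, rfl⟩ | ⟨y, hy, rfl⟩)
      · exact T.left y hy hx
      · exact T.right y hy hx
  have hVab : P.m V ≤ P.m ({ω | ρ a ω ≠ ω} ∪ {ω | ρ b ω ≠ ω}) := by
    refine P.mono_ae ?_
    filter_upwards [h.mul a b] with ω h1 hV
    by_contra hn
    simp only [Set.mem_union, Set.mem_ofPred_eq, not_or, not_not] at hn
    exact hV (by rw [h1, hn.2, hn.1])
  have hVac : P.m V ≤ P.m ({ω | ρ a ω ≠ ω} ∪ {ω | ρ c ω ≠ ω}) := by
    refine P.mono_ae ?_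
    filter_upwards [h.mul c a] with ω h1 hV
    by_contra hn
    simp only [Set.mem_union, Set.mem_ofPred_eq, not_or, not_not] at hn
    exact hV (by rw [hca, h1, hn.1, hn.2])
  have hVbc : P.m V ≤ P.m ({ω | ρ b ω ≠ ω} ∪ {ω | ρ c ω ≠ ω}) := by
    refine P.mono_ae ?_
    filter_upwards [h.mul b c] with ω h1 hV
    by_contra hn
    simp only [Set.mem_union, Set.mem_ofPred_eq, not_or, not_not] at hn
    exact hV (by rw [hbc, h1, hn.2, hn.1])
  have hV3 : P.m V ≤ P.m ({ω | ρ a ω ≠ ω} ∩ {ω | ρ b ω ≠ ω} ∪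
      ({ω | ρ a ω ≠ ω} ∩ {ω | ρ c ω ≠ ω} ∪ {ω | ρ b ω ≠ ω} ∩ {ω | ρ c ω ≠ ω})) := by
    refine P.mono_ae ?_
    filter_upwards [h.mul a b, h.mul c a, h.mul b c] with ω h1 h2 h3 hV
    have hV' : ρ (a * b) ω ≠ ω := hV
    have e1 : ¬ (ρ a ω = ω ∧ ρ b ω = ω) := fun hn => hV' (by rw [h1, hn.2, hn.1])
    have e2 : ¬ (ρ a ω = ω ∧ ρ c ω = ω) := fun hn => hV' (by rw [hca, h2, hn.1, hn.2])
    have e3 : ¬ (ρ b ω = ω ∧ ρ c ω = ω) := fun hn => hV' (by rw [hbc, h3, hn.2, hn.1])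
    simp only [Set.mem_union, Set.mem_inter_iff, Set.mem_ofPred_eq]
    tauto
  have u1 := P.union_add_inter {ω | ρ a ω ≠ ω} {ω | ρ b ω ≠ ω}
  have u2 := P.union_add_inter {ω | ρ a ω ≠ ω} {ω | ρ c ω ≠ ω}
  have u3 := P.union_add_inter {ω | ρ b ω ≠ ω} {ω | ρ c ω ≠ ω}
  have u4 := P.union_add_inter ({ω | ρ a ω ≠ ω} ∩ {ω | ρ b ω ≠ ω})
    ({ω | ρ a ω ≠ ω} ∩ {ω | ρ c ω ≠ ω} ∪ {ω | ρ b ω ≠ ω} ∩ {ω | ρ c ω ≠ ω})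
  have u5 := P.union_le ({ω | ρ a ω ≠ ω} ∩ {ω | ρ c ω ≠ ω}) ({ω | ρ b ω ≠ ω} ∩ {ω | ρ c ω ≠ ω})
  have hn := P.nonneg (({ω | ρ a ω ≠ ω} ∩ {ω | ρ b ω ≠ ω}) ∩
    ({ω | ρ a ω ≠ ω} ∩ {ω | ρ c ω ≠ ω} ∪ {ω | ρ b ω ≠ ω} ∩ {ω | ρ c ω ≠ ω}))
  constructor
  · change P.m ({ω | ρ a ω ≠ ω} ∩ {ω | ρ b ω ≠ ω}) = _
    linarith
  · have h0 : P.m (({ω | ρ a ω ≠ ω} ∩ {ω | ρ b ω ≠ ω}) ∩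
      ({ω | ρ a ω ≠ ω} ∩ {ω | ρ c ω ≠ ω} ∪ {ω | ρ b ω ≠ ω} ∩ {ω | ρ c ω ≠ ω})) ≤ 0 := by linarith
    filter_upwards [P.eventually_of_le_zero h0] with ω hω hcore
    by_contra hcc
    exact hω ⟨hcore, Or.inl ⟨hcore.1, hcc⟩⟩

theorem measure_core (h : IsIsometricRep P R ρ) (T : IsTriple α β B) :
    P.m (Core ρ T) = μ.real B := (core_aux h T).1

/-- Both involutions of `T` are products of those for `C` and `D`, and the mixed pairs have disjoint
supports; so both motions of a core point come from the same piece. -/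
theorem core_union (h : IsIsometricRep P R ρ) (T : IsTriple α β B) {C D : Set X}
    (hB : B = C ∪ D) (hd : Disjoint C D)
    (TC : IsTriple α β C) (TD : IsTriple α β D) :
    ∀ᶠ ω in P.ae, ω ∈ Core ρ T → ω ∈ Core ρ TC ∨ ω ∈ Core ρ TD := by
  have ha : T.a = TC.a * TD.a := T.swapLeft.perm_eq_mul TC.swapLeft TD.swapLeft hB hd
  have hb : T.b = TC.b * TD.b := T.swapRight.perm_eq_mul TC.swapRight TD.swapRight hB hd
  have hCB : C ⊆ B := hB ▸ Set.subset_union_left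
  have hDB : D ⊆ B := hB ▸ Set.subset_union_right
  have h1 : ∀ x, TC.a.1 x = x ∨ TD.b.1 x = x := by
    intro x
    by_contra! hc
    rcases TC.a_ne hc.1 with hx | ⟨y, hy, rfl⟩ <;> rcases TD.b_ne hc.2 with hx' | ⟨z, hz, hzx⟩
    · exact Set.disjoint_left.1 hd hx hx'
    · exact T.right z (hDB hz) (hzx ▸ hCB hx)
    · exact T.left y (hCB hy) (hDB hx')
    · exact T.ne y (hCB hy) z (hDB hz) hzx.symm
  have h2 : ∀ x, TD.a.1 x = x ∨ TC.b.1 x = x := by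
    intro x
    by_contra! hc
    rcases TD.a_ne hc.1 with hx | ⟨y, hy, rfl⟩ <;> rcases TC.b_ne hc.2 with hx' | ⟨z, hz, hzx⟩
    · exact Set.disjoint_left.1 hd hx' hx
    · exact T.right z (hCB hz) (hzx ▸ hDB hx)
    · exact T.left y (hDB hy) (hCB hx')
    · exact T.ne y (hDB hy) z (hCB hz) hzx.symm
  filter_upwards [h.disjoint (Eventually.of_forall h1), h.disjoint (Eventually.of_forall h2),
    h.mul TC.a TD.a, h.mul TC.b TD.b] with ω e1 e2 e3 e4 hω
  have hω1 : ρ T.a ω ≠ ω := hω.1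
  have hω2 : ρ T.b ω ≠ ω := hω.2
  rw [ha, e3] at hω1
  rw [hb, e4] at hω2
  by_contra! hcon
  simp only [Core, Set.mem_ofPred_eq] at hcon
  by_cases p1 : ρ TD.a ω = ω
  · rw [p1] at hω1
    have p2 := e1.resolve_left hω1
    rw [p2] at hω2
    exact hcon.1 ⟨hω1, hω2⟩
  · have p2 := e2.resolve_left p1
    by_cases p3 : ρ TD.b ω = ω
    · rw [p3] at hω2
      exact hω2 p2
    · exact hcon.2 ⟨p1, p3⟩

/-- A property of almost every point of the core can be checked on countably many pieces. -/
theorem core_of_cover (h : IsIsometricRep P R ρ) (T : IsTriple α β B) {ι : Type*} [Countable ι]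
    {C : ι → Set X} (hC : ∀ i, MeasurableSet (C i)) (hcov : ∀ᵐ x ∂μ, x ∈ B → ∃ i, x ∈ C i)
    {p : Ω → Prop} (hp : ∀ i, ∀ D ⊆ B ∩ C i, ∀ TD : IsTriple α β D,
      ∀ᶠ ω in P.ae, ω ∈ Core ρ TD → p ω) :
    ∀ᶠ ω in P.ae, ω ∈ Core ρ T → p ω := by
  have hBm := T.measurableSet
  rcases isEmpty_or_nonempty ι with hι | hι
  · have h0 : μ.real B = 0 := by
      rw [measureReal_def, measure_eq_zero_iff_ae_notMem.2 ?_, ENNReal.toReal_zero]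
      filter_upwards [hcov] with x hx hxB
      exact hι.elim (hx hxB).choose
    have := P.eventually_notMem_iff.2 ((measure_core h T).trans h0)
    exact this.mono fun ω hω hc => absurd hc hω
  obtain ⟨e, he⟩ := exists_surjective_nat ι
  let E : ℕ → Set X := fun J => B \ ⋃ j < J, C (e j)
  have hE : ∀ J, MeasurableSet (E J) := fun J => hBm.diff
    (MeasurableSet.iUnion fun j => MeasurableSet.iUnion fun _ => hC _)
  have hEsub : ∀ J, E J ⊆ B := fun J => Set.sdiff_subset
  have hEsucc : ∀ J, E (J + 1) = E J \ C (e J) := by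
    intro J
    ext x
    simp only [E, Set.mem_sdiff, Set.mem_iUnion, Nat.lt_succ_iff_lt_or_eq]
    grind
  have TE := fun J => T.mono (hE J) (hEsub J)
  have hle : ∀ J, P.m {ω | ω ∈ Core ρ T ∧ ¬ p ω} ≤ P.m {ω | ω ∈ Core ρ (TE J) ∧ ¬ p ω} := by
    intro J
    induction J with
    | zero =>
      have : E 0 = B := by simp [E]
      refine P.mono (fun ω hω => ?_)
      convert hω
    | succ J ih =>
      refine ih.trans (P.mono_ae ?_)
      have TI := T.mono ((hE J).inter (hC (e J))) (Set.inter_subset_left.trans (hEsub J))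
      filter_upwards [core_union h (TE J)
        (by rw [hEsucc, Set.inter_union_sdiff])
        (by rw [hEsucc]; exact Set.disjoint_sdiff_right.mono_left Set.inter_subset_right)
        TI (TE (J + 1)), hp (e J) _ (Set.inter_subset_inter_left _ (hEsub J)) TI] with ω h1 h2 hω
      exact ⟨(h1 hω.1).resolve_left fun hc => hω.2 (h2 hc), hω.2⟩
  -- `P` is only finitely additive, so countably many null sets cannot be collected; instead the
  -- core of what remains after `J` pieces has measure `μ(E J)`, which tends to zero.
  have hlim : Tendsto (fun J => μ.real (E J)) atTop (𝓝 0) := by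
    have hmono : Antitone E := antitone_nat_of_succ_le fun J => by
      rw [hEsucc]; exact Set.sdiff_subset
    have hlim := tendsto_measure_iInter_atTop (μ := μ) (s := E)
      (fun J => (hE J).nullMeasurableSet) hmono ⟨0, measure_ne_top _ _⟩
    have h0 : μ (⋂ J, E J) = 0 := by
      rw [measure_eq_zero_iff_ae_notMem]
      filter_upwards [hcov] with x hx hc
      rw [Set.mem_iInter] at hc
      obtain ⟨i, hi⟩ := hx (hc 0).1
      obtain ⟨j, rfl⟩ := he i
      exact (hc (j + 1)).2 (Set.mem_biUnion (show j < j + 1 from j.lt_succ_self) hi)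
    rw [h0] at hlim
    exact (ENNReal.tendsto_toReal ENNReal.zero_ne_top).comp hlim
  have h0 : P.m {ω | ω ∈ Core ρ T ∧ ¬ p ω} ≤ 0 := ge_of_tendsto' hlim fun J =>
    (hle J).trans ((P.mono fun ω hω => hω.1).trans (measure_core h (TE J)).le)
  filter_upwards [P.eventually_of_le_zero h0] with ω hω hcore
  by_contra hc
  exact hω ⟨hcore, hc⟩

/-! ### Elements fixing a set pointwise fix its core; disjoint sets have disjoint cores -/

theorem fixes_core_of_left_eq (h : IsIsometricRep P R ρ) (T : IsTriple α β B) {k : permGroup R.rel}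
    (hk : ∀ x ∈ B, k.1 x = x) (hl : ∀ x ∈ B, k.1 (α.1 x) = α.1 x) :
    ∀ᶠ ω in P.ae, ρ T.a ω ≠ ω → ρ k ω = ω := by
  have hd : ∀ x, k.1 x = x ∨ T.a.1 x = x := by
    intro x
    by_contra! hc
    rcases T.a_ne hc.2 with hx | ⟨y, hy, rfl⟩
    · exact hc.1 (hk x hx)
    · exact hc.1 (hl y hy)
  filter_upwards [h.disjoint (Eventually.of_forall hd)] with ω hω hne
  exact hω.resolve_right hne

/-- With `c` the third transposition, `c k` fixes `B` and `αB`, so the previous case applies to `c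
k`; and `ρ c` fixes almost every core point. -/
theorem fixes_core_of_left_eq_right (h : IsIsometricRep P R ρ) (T : IsTriple α β B)
    {k : permGroup R.rel} (hk : ∀ x ∈ B, k.1 x = x) (hl : ∀ x ∈ B, k.1 (α.1 x) = β.1 x) :
    ∀ᶠ ω in P.ae, ω ∈ Core ρ T → ρ k ω = ω := by
  set c := T.a * T.b * T.a with hc
  have hcB : ∀ x ∈ B, c.1 x = x := by
    intro x hx
    change T.a.1 (T.b.1 (T.a.1 x)) = x
    rw [T.a_apply hx, T.b_apply_left hx, T.a_apply_left hx]
  have hcβ : ∀ x ∈ B, c.1 (β.1 x) = α.1 x := by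
    intro x hx
    change T.a.1 (T.b.1 (T.a.1 (β.1 x))) = α.1 x
    rw [T.a_apply_right hx, T.b_apply_right hx, T.a_apply hx]
  filter_upwards [fixes_core_of_left_eq h T (k := c * k)
    (fun x hx => (congrArg c.1 (hk x hx)).trans (hcB x hx))
    (fun x hx => (congrArg c.1 (hl x hx)).trans (hcβ x hx)), h.mul c k, (core_aux h T).2]
    with ω h1 h2 h3 hω
  have h4 := h1 hω.1
  rw [h2] at h4
  exact (ρ c).injective (h4.trans (h3 hω).symm)

/-- Composing `k` with the swap of `αB` and `kαB` gives an element that fixes `B` and `αB`; the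
image of the swap fixes the core because its support is disjoint from that of `T.b`. -/
theorem fixes_core_of_disjoint (h : IsIsometricRep P R ρ) (T : IsTriple α β B)
    {k : permGroup R.rel} (hk : ∀ x ∈ B, k.1 x = x)
    (hα : ∀ x ∈ B, ∀ y ∈ B, k.1 (α.1 x) ≠ α.1 y) (hβ : ∀ x ∈ B, ∀ y ∈ B, k.1 (α.1 x) ≠ β.1 y) :
    ∀ᶠ ω in P.ae, ω ∈ Core ρ T → ρ k ω = ω := by
  have hS : Swappable R.rel k.1 (α.1 '' B) :=
    .of_perm k (permGroup_measurableSet_image α T.measurableSet) (by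
      rintro _ ⟨x, hx, rfl⟩ ⟨y, hy, hyx⟩
      exact hα x hx y hy hyx.symm)
  have hkB : ∀ x ∈ B, k.1 (α.1 x) ∉ B := by
    intro x hx hc
    have := k.1.injective (hk _ hc)
    exact T.left x hx (this ▸ hc)
  have hδB : ∀ x ∈ B, hS.perm.1 x = x := by
    intro x hx
    refine hS.perm_apply_of_notMem ?_ ?_
    · rintro ⟨y, hy, rfl⟩
      exact T.left y hy hx
    · rintro ⟨_, ⟨y, hy, rfl⟩, rfl⟩
      exact hkB y hy hx
  have hd : ∀ x, hS.perm.1 x = x ∨ T.b.1 x = x := by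
    intro x
    by_contra! hc
    rcases T.b_ne hc.2 with hx | ⟨y, hy, rfl⟩
    · exact hc.1 (hδB x hx)
    · rcases hS.mem_or_mem_of_perm_ne hc.1 with ⟨z, hz, hzy⟩ | ⟨_, ⟨z, hz, rfl⟩, hzy⟩
      · exact T.ne z hz y hy hzy
      · exact hβ z hz y hy hzy
  filter_upwards [fixes_core_of_left_eq h T (k := hS.perm * k)
    (fun x hx => (congrArg hS.perm.1 (hk x hx)).trans (hδB x hx))
    (fun x hx => hS.perm_apply_apply ⟨x, hx, rfl⟩), h.mul hS.perm k,
    h.disjoint (Eventually.of_forall hd)] with ω h1 h2 h3 hω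
  have h4 := h1 hω.1
  rw [h2] at h4
  exact (ρ hS.perm).injective (h4.trans (h3.resolve_right hω.2).symm)

/-- `B` is cut according to whether `k α x` equals `α x`, equals `β x`, or differs from both;
separating sets turn the last case into disjointness of whole images. -/
theorem fixes_core (h : IsIsometricRep P R ρ) (T : IsTriple α β B) {k : permGroup R.rel}
    (hk : ∀ x ∈ B, k.1 x = x) : ∀ᶠ ω in P.ae, ω ∈ Core ρ T → ρ k ω = ω := by
  obtain ⟨S, hS, hsep⟩ := exists_separating_seq X
  have hkα : Measurable fun x => k.1 (α.1 x) :=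
    (permGroup_measurable k).comp (permGroup_measurable α)
  let C : Option (Option (ℕ × ℕ)) → Set X := fun i =>
    match i with
    | none => {x | k.1 (α.1 x) = α.1 x}
    | some none => {x | k.1 (α.1 x) = β.1 x}
    | some (some (n, m)) => {x | (k.1 (α.1 x) ∈ S n ∧ α.1 x ∉ S n) ∧
        (k.1 (α.1 x) ∈ S m ∧ β.1 x ∉ S m)}
  have hC : ∀ i, MeasurableSet (C i) := by
    rintro (_ | _ | ⟨n, m⟩)
    · exact measurableSet_eq_of_measurable hkα (permGroup_measurable α)
    · exact measurableSet_eq_of_measurable hkα (permGroup_measurable β)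
    · exact ((hkα (hS n)).inter (permGroup_measurable α (hS n)).compl).inter
        ((hkα (hS m)).inter (permGroup_measurable β (hS m)).compl)
  refine core_of_cover h T hC (Eventually.of_forall fun x hx => ?_) ?_
  · by_cases h1 : k.1 (α.1 x) = α.1 x
    · exact ⟨none, h1⟩
    by_cases h2 : k.1 (α.1 x) = β.1 x
    · exact ⟨some none, h2⟩
    obtain ⟨n, hn⟩ := hsep _ _ h1
    obtain ⟨m, hm⟩ := hsep _ _ h2
    exact ⟨some (some (n, m)), hn, hm⟩
  · rintro (_ | _ | ⟨n, m⟩) D hD TD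
    · exact (fixes_core_of_left_eq h TD (fun x hx => hk x (hD hx).1) fun x hx => (hD hx).2).mono
        fun ω hω hc => hω hc.1
    · exact fixes_core_of_left_eq_right h TD (fun x hx => hk x (hD hx).1) fun x hx => (hD hx).2
    · refine fixes_core_of_disjoint h TD (fun x hx => hk x (hD hx).1) (fun x hx y hy hc => ?_)
        fun x hx y hy hc => ?_
      · exact (hD hy).2.1.2 (hc ▸ (hD hx).2.1.1)
      · exact (hD hy).2.2.2 (hc ▸ (hD hx).2.2.1)

theorem fixes_core_of_ae (h : IsIsometricRep P R ρ) (T : IsTriple α β B) {k : permGroup R.rel}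
    (hk : ∀ᵐ x ∂μ, x ∈ B → k.1 x = x) : ∀ᶠ ω in P.ae, ω ∈ Core ρ T → ρ k ω = ω :=
  core_of_cover h T (ι := Unit) (C := fun _ => {x | k.1 x = x})
    (fun _ => measurableSet_eq_of_measurable (permGroup_measurable k) measurable_id)
    (hk.mono fun _ hx hxB => ⟨(), hx hxB⟩)
    fun _ _ hD TD => fixes_core h TD fun _ hx => (hD hx).2

/-- If `α'` or `β'` sends a part of `B'` outside `B`, the corresponding swap fixes `B`, hence also
the core of `T`, so the core of that part does not meet it. What remains is a set `E ⊆ B'` whose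
disjoint images `α'E` and `β'E` both lie in `B`, so `μ(E) ≤ μ(B) / 2`. The argument is then repeated
with `E` and `B` in the roles of `B` and `B'`. -/
theorem core_inter_le (h : IsIsometricRep P R ρ) (n : ℕ) :
    ∀ {α β α' β' : permGroup R.rel} {B B' : Set X} (T : IsTriple α β B) (T' : IsTriple α' β' B'),
      Disjoint B B' → P.m (Core ρ T ∩ Core ρ T') ≤ (1 / 2) ^ n * μ.real B := by
  induction n with
  | zero =>
    intro α β α' β' B B' T T' _
    rw [pow_zero, one_mul, ← measure_core h T]
    exact P.mono Set.inter_subset_left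
  | succ n ih =>
    intro α β α' β' B B' T T' hd
    have hB := T.measurableSet
    have hα' : MeasurableSet (α'.1 ⁻¹' B) := permGroup_measurable α' hB
    have hβ' : MeasurableSet (β'.1 ⁻¹' B) := permGroup_measurable β' hB
    have T1 := T'.mono (T'.measurableSet.diff hα') Set.sdiff_subset
    have T2 := T'.mono (T'.measurableSet.inter hα') Set.inter_subset_left
    have T21 := T2.mono (T2.measurableSet.diff hβ') Set.sdiff_subset
    have T22 := T2.mono (T2.measurableSet.inter hβ') Set.inter_subset_left
    have hle : P.m (Core ρ T ∩ Core ρ T') ≤ P.m (Core ρ T22 ∩ Core ρ T) := by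
      refine P.mono_ae ?_
      have f1 := fixes_core h T (k := T1.a) fun x hx => T1.swapLeft.perm_apply_of_notMem
        (fun hc => Set.disjoint_left.1 hd hx hc.1) (by
          rintro ⟨y, hy, rfl⟩
          exact hy.2 hx)
      have f2 := fixes_core h T (k := T21.b) fun x hx => T21.swapRight.perm_apply_of_notMem
        (fun hc => Set.disjoint_left.1 hd hx hc.1.1) (by
          rintro ⟨y, hy, rfl⟩
          exact hy.2 hx)
      filter_upwards [f1, f2, core_union h T'
        (Set.sdiff_union_inter _ _).symm
        (Set.disjoint_sdiff_left.mono_right Set.inter_subset_right) T1 T2,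
        core_union h T2 (Set.sdiff_union_inter _ _).symm
        (Set.disjoint_sdiff_left.mono_right Set.inter_subset_right) T21 T22] with ω h1 h2 h3 h4 hω
      rcases h3 hω.2 with h5 | h5
      · exact absurd (h1 hω.1) h5.1
      rcases h4 h5 with h6 | h6
      · exact absurd (h2 hω.1) h6.2
      exact ⟨h6, hω.1⟩
    have hd' : Disjoint (B' ∩ α'.1 ⁻¹' B ∩ β'.1 ⁻¹' B) B :=
      (hd.mono_right (Set.inter_subset_left.trans Set.inter_subset_left)).symm
    refine (hle.trans (ih T22 T hd')).trans ?_
    have h2 : 2 * μ.real (B' ∩ α'.1 ⁻¹' B ∩ β'.1 ⁻¹' B) ≤ μ.real B := by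
      set E := B' ∩ α'.1 ⁻¹' B ∩ β'.1 ⁻¹' B
      have hEm : MeasurableSet E := T22.measurableSet
      have hsub : α'.1 '' E ∪ β'.1 '' E ⊆ B := by
        rintro _ (⟨x, hx, rfl⟩ | ⟨x, hx, rfl⟩)
        · exact hx.1.2
        · exact hx.2
      refine le_trans (le_of_eq ?_) (measureReal_mono hsub)
      rw [measureReal_union _ (permGroup_measurableSet_image β' hEm), measureReal_def,
        measureReal_def, measureReal_def, R.measure_image α' hEm, R.measure_image β' hEm]
      · ring
      · rw [Set.disjoint_left]
        rintro _ ⟨x, hx, rfl⟩ ⟨y, hy, hyx⟩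
        exact T22.ne x hx y hy hyx.symm
    rw [pow_succ]
    have : (0 : ℝ) < (1 / 2) ^ n := by positivity
    nlinarith

theorem core_disjoint (h : IsIsometricRep P R ρ) (T : IsTriple α β B) (T' : IsTriple α' β' B')
    (hd : ∀ᵐ x ∂μ, x ∈ B → x ∉ B') : ∀ᶠ ω in P.ae, ω ∈ Core ρ T → ω ∉ Core ρ T' := by
  refine core_of_cover h T (ι := Unit) (C := fun _ => B'ᶜ) (fun _ => T'.measurableSet.compl)
    (hd.mono fun x hx hxB => ⟨(), hx hxB⟩) fun _ D hD TD => ?_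
  have hdD : Disjoint D B' := Set.disjoint_left.2 fun x hx => (hD hx).2
  have hlim : Tendsto (fun n : ℕ => (1 / 2 : ℝ) ^ n * μ.real D) atTop (𝓝 0) := by
    simpa using (tendsto_pow_atTop_nhds_zero_of_lt_one (by norm_num : (0 : ℝ) ≤ 1 / 2)
      (by norm_num)).mul_const (μ.real D)
  have h0 := ge_of_tendsto' hlim fun n => core_inter_le h n TD T' hdD
  filter_upwards [P.eventually_of_le_zero h0] with ω hω h1 h2
  exact hω ⟨h1, h2⟩

end IsTriple

/-! ### Sides of an involution -/

/-- The points that an involution moves up (`s = true`) or down (`s = false`), with respect to an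
order on the target of `e`. -/
def Side {Y Z : Type*} [LinearOrder Z] (e : Y → Z) (f : Y → Y) (s : Bool) : Set Y :=
  {y | cond s (e y < e (f y)) (e (f y) < e y)}

theorem Side.ne {Y Z : Type*} [LinearOrder Z] {e : Y → Z} {f : Y → Y} {s : Bool} {y : Y}
    (h : y ∈ Side e f s) : f y ≠ y := by
  intro hc
  cases s <;> simp [Side, hc] at h

theorem Side.not {Y Z : Type*} [LinearOrder Z] {e : Y → Z} {f : Y → Y} {s : Bool} {y : Y}
    (h : y ∈ Side e f s) : y ∉ Side e f !s := by
  cases s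
  · exact fun hc => lt_asymm (show e (f y) < e y from h) hc
  · exact fun hc => lt_asymm (show e y < e (f y) from h) hc

theorem Side.apply {Y Z : Type*} [LinearOrder Z] {e : Y → Z} {f : Y → Y} {s : Bool} {y : Y}
    (hf : f (f y) = y) (h : y ∈ Side e f s) : f y ∈ Side e f !s := by
  cases s
  · change e (f y) < e (f (f y))
    rw [hf]; exact h
  · change e (f (f y)) < e (f y)
    rw [hf]; exact h

theorem Side.exists_of_ne {Y Z : Type*} [LinearOrder Z] {e : Y → Z} (he : Function.Injective e)
    {f : Y → Y} {y : Y} (h : f y ≠ y) : y ∈ Side e f true ∨ y ∈ Side e f false :=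
  (lt_or_gt_of_ne (he.ne h)).symm

theorem Side.eq_of_mem {Y Z : Type*} [LinearOrder Z] {e : Y → Z} {f : Y → Y} {s s' : Bool} {y : Y}
    (h : y ∈ Side e f s) (h' : y ∈ Side e f s') : s = s' := by
  by_contra hc
  have : s' = !s := by cases s <;> cases s' <;> simp at hc ⊢
  exact Side.not h (this ▸ h')

/-! ### The part of the relation with classes of two elements -/

section PairPart

variable {X : Type*} [MeasurableSpace X] {μ : Measure X}

/-- `τ` is an involution whose support is a union of classes with exactly two elements, and `e` is
a measurable real coordinate separating points. -/
structure IsPairFlip (R : PMPRelation X μ) (τ : permGroup R.rel) (e : X → ℝ) : Prop where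
  involutive : ∀ x, τ.1 (τ.1 x) = x
  eq_or_eq : ∀ x, τ.1 x ≠ x → ∀ y, R.rel x y → y = x ∨ y = τ.1 x
  measurable : Measurable e
  injective : Function.Injective e

namespace IsPairFlip

variable {R : PMPRelation X μ} {τ : permGroup R.rel} {e : X → ℝ} {Ω : Type*} {P : FinAddProb Ω}
  {ρ : permGroup R.rel → Equiv.Perm Ω} {ι : Ω → ℕ} {B C : Set X} {s s' : Bool}

theorem measurableSet_side (H : IsPairFlip R τ e) (s : Bool) : MeasurableSet (Side e τ.1 s) := by
  have h1 := H.measurable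
  have h2 := H.measurable.comp (permGroup_measurable τ)
  cases s
  · exact measurableSet_lt h2 h1
  · exact measurableSet_lt h1 h2

theorem swappable (H : IsPairFlip R τ e) (hB : MeasurableSet B) (hs : B ⊆ Side e τ.1 s) :
    Swappable R.rel τ.1 B :=
  .of_perm τ hB fun x hx hc => Side.not (Side.apply (H.involutive x) (hs hx)) (by
    rw [Bool.not_not]; exact hs hc) |>.elim

theorem image_eq (H : IsPairFlip R τ e) (B : Set X) : τ.1 '' B = τ.1 ⁻¹' B := by
  ext x
  constructor
  · rintro ⟨y, hy, rfl⟩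
    rwa [Set.mem_preimage, H.involutive]
  · exact fun hx => ⟨_, hx, H.involutive x⟩

theorem apply_eq (H : IsPairFlip R τ e) (hs : B ⊆ Side e τ.1 s) (k : permGroup R.rel) {x : X}
    (hx : x ∈ B) : k.1 x = x ∨ k.1 x = τ.1 x :=
  H.eq_or_eq x (Side.ne (hs hx)) _ (permGroup_rel k x)

theorem apply_flip_eq (H : IsPairFlip R τ e) (hs : B ⊆ Side e τ.1 s) (k : permGroup R.rel) {x : X}
    (hx : x ∈ B) (hk : k.1 x = x) : k.1 (τ.1 x) = τ.1 x := by
  refine (H.eq_or_eq x (Side.ne (hs hx)) _ (R.rel.trans (permGroup_rel τ x)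
    (permGroup_rel k _))).resolve_left fun hc => ?_
  exact (Side.ne (hs hx)) (k.1.injective (hc.trans hk.symm))

theorem flip_flip (H : IsPairFlip R τ e) (h : IsIsometricRep P R ρ) :
    ∀ᶠ ω in P.ae, ρ τ (ρ τ ω) = ω := by
  have hτ : τ * τ = 1 := Subtype.ext (Equiv.ext H.involutive)
  filter_upwards [h.mul τ τ, h.one] with ω h1 h2
  rw [← h1, hτ, h2]

variable [StandardBorelSpace X]

/-- The half of the support of the swap of `B` and `τ B` lying on side `s` of `ρ τ`. -/
def Half (ρ : permGroup R.rel → Equiv.Perm Ω) (ι : Ω → ℕ) (h : Swappable R.rel τ.1 B)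
    (s : Bool) : Set Ω :=
  {ω | ρ h.perm ω ≠ ω} ∩ Side ι (ρ τ) s

theorem commute (H : IsPairFlip R τ e) (hB : Swappable R.rel τ.1 B) :
    hB.perm * τ = τ * hB.perm := by
  refine Subtype.ext (Equiv.ext fun x => ?_)
  change hB.perm.1 (τ.1 x) = τ.1 (hB.perm.1 x)
  by_cases hx : x ∈ B
  · rw [hB.perm_apply_apply hx, hB.perm_apply_of_mem hx, H.involutive]
  by_cases hx' : x ∈ τ.1 '' B
  · obtain ⟨y, hy, rfl⟩ := hx'
    rw [H.involutive, hB.perm_apply_apply hy, hB.perm_apply_of_mem hy]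
  rw [hB.perm_apply_of_notMem hx hx', hB.perm_apply_of_notMem]
  · rw [H.image_eq] at hx'
    exact hx'
  · rintro ⟨y, hy, hyx⟩
    exact hx (τ.1.injective hyx ▸ hy)

theorem half_flip (H : IsPairFlip R τ e) (h : IsIsometricRep P R ρ)
    (hB : Swappable R.rel τ.1 B) (s : Bool) :
    ∀ᶠ ω in P.ae, ω ∈ Half ρ ι hB s → ρ τ ω ∈ Half ρ ι hB !s := by
  filter_upwards [h.mul hB.perm τ, h.mul τ hB.perm, H.flip_flip h] with ω h1 h2 h3 hω
  refine ⟨fun hc => hω.1 ?_, Side.apply h3 hω.2⟩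
  rw [← h1, H.commute hB, h2] at hc
  exact (ρ τ).injective hc

theorem half_union (h : IsIsometricRep P R ρ) (hB : Swappable R.rel τ.1 B) {B₁ B₂ : Set X}
    (h₁ : Swappable R.rel τ.1 B₁) (h₂ : Swappable R.rel τ.1 B₂) (hu : B = B₁ ∪ B₂)
    (hd : Disjoint B₁ B₂) (s : Bool) :
    ∀ᶠ ω in P.ae, ω ∈ Half ρ ι hB s → ω ∈ Half ρ ι h₁ s ∨ ω ∈ Half ρ ι h₂ s := by
  filter_upwards [h.mul h₁.perm h₂.perm] with ω h1 hω
  have h2 : ρ hB.perm ω ≠ ω := hω.1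
  rw [hB.perm_eq_mul h₁ h₂ hu hd, h1] at h2
  by_cases h3 : ρ h₂.perm ω = ω
  · rw [h3] at h2
    exact Or.inl ⟨h2, hω.2⟩
  · exact Or.inr ⟨h3, hω.2⟩

variable [IsProbabilityMeasure μ]

/-- The swap `s` of `B` and `τB`, and `sτ`, which is `τ` off `B ∪ τB`, have disjoint supports. So a
point moved by `ρ s` is fixed by `ρ (sτ)`, which is impossible if `ρ τ` fixes it. -/
theorem moved_subset (H : IsPairFlip R τ e) (h : IsIsometricRep P R ρ)
    (hB : Swappable R.rel τ.1 B) : ∀ᶠ ω in P.ae, ρ hB.perm ω ≠ ω → ρ τ ω ≠ ω := by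
  have hd : ∀ x, (hB.perm * τ).1 x = x ∨ hB.perm.1 x = x := by
    intro x
    by_cases hx : x ∈ B
    · exact Or.inl (hB.perm_apply_apply hx)
    by_cases hx' : x ∈ τ.1 '' B
    · obtain ⟨y, hy, rfl⟩ := hx'
      left
      change hB.perm.1 (τ.1 (τ.1 y)) = τ.1 y
      rw [H.involutive, hB.perm_apply_of_mem hy]
    · exact Or.inr (hB.perm_apply_of_notMem hx hx')
  filter_upwards [h.disjoint (Eventually.of_forall hd), h.mul hB.perm τ] with ω h1 h2 hω hc
  have h3 := h1.resolve_right hω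
  rw [h2, hc] at h3
  exact hω h3

/-- `ρ τ` interchanges the two halves, which together make up a support of measure `2μ(B)`. -/
theorem measure_half (H : IsPairFlip R τ e) (h : IsIsometricRep P R ρ)
    (hι : Function.Injective ι) (hB : Swappable R.rel τ.1 B) (s : Bool) :
    P.m (Half ρ ι hB s) = μ.real B := by
  have hle : ∀ s, P.m (Half ρ ι hB s) ≤ P.m (Half ρ ι hB !s) := fun s => by
    rw [← h.preimage τ (Half ρ ι hB !s)]
    exact P.mono_ae (H.half_flip h hB s)
  have heq : P.m (Half ρ ι hB true) = P.m (Half ρ ι hB false) := le_antisymm (hle true) (hle false)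
  have hsum : P.m (Half ρ ι hB true ∪ Half ρ ι hB false) = 2 * μ.real B := by
    rw [← hB.measureReal_perm_ne, ← h.moved]
    refine P.congr_ae ?_
    filter_upwards [H.moved_subset h hB] with ω hω
    constructor
    · exact fun hc => hc.elim And.left And.left
    · exact fun hc => (Side.exists_of_ne hι (hω hc)).imp (And.intro hc) (And.intro hc)
  rw [P.union _ _ (Set.disjoint_left.2 fun ω h1 h2 => Side.not h1.2 h2.2)] at hsum
  cases s <;> linarith

/-- On a class of two points, `k` fixes one exactly if it fixes the other, so its support misses
`τB` as well as `B`. -/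
theorem fixes_half (H : IsPairFlip R τ e) (h : IsIsometricRep P R ρ) (hs : B ⊆ Side e τ.1 s)
    (hB : Swappable R.rel τ.1 B) {k : permGroup R.rel} (hk : ∀ᵐ x ∂μ, x ∈ B → k.1 x = x)
    (s' : Bool) : ∀ᶠ ω in P.ae, ω ∈ Half ρ ι hB s' → ρ k ω = ω := by
  have hd : ∀ᵐ x ∂μ, k.1 x = x ∨ hB.perm.1 x = x := by
    filter_upwards [hk, (R.measurePreserving τ).quasiMeasurePreserving.ae hk] with x h1 h2
    by_contra! hc
    rcases hB.mem_or_mem_of_perm_ne hc.2 with hx | ⟨y, hy, rfl⟩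
    · exact hc.1 (h1 hx)
    · rw [H.involutive] at h2
      exact hc.1 (H.apply_flip_eq hs k hy (h2 hy))
  filter_upwards [h.disjoint hd] with ω h1 h2
  exact h1.resolve_right h2.1

theorem half_disjoint (H : IsPairFlip R τ e) (h : IsIsometricRep P R ρ)
    (hB : Swappable R.rel τ.1 B) (hC : Swappable R.rel τ.1 C)
    (hd : ∀ᵐ x ∂μ, x ∈ B → x ∉ C) (hd' : ∀ᵐ x ∂μ, τ.1 x ∈ B → x ∉ C) :
    ∀ᶠ ω in P.ae, ρ hB.perm ω = ω ∨ ρ hC.perm ω = ω := by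
  refine h.disjoint ?_
  filter_upwards [hd, (R.measurePreserving τ).quasiMeasurePreserving.ae hd, hd',
    (R.measurePreserving τ).quasiMeasurePreserving.ae hd'] with x h1 h2 h3 h4
  rw [H.involutive] at h4
  by_contra! hc
  have e1 := hB.mem_or_mem_of_perm_ne hc.1
  have e2 := hC.mem_or_mem_of_perm_ne hc.2
  rw [H.image_eq] at e1 e2
  rcases e1 with e1 | e1 <;> rcases e2 with e2 | e2
  · exact h1 e1 e2
  · exact h4 e1 e2
  · exact h3 e1 e2
  · exact h2 e1 e2

/-- On `B` the element `k` is either the identity or `τ`, and `B` is cut accordingly. -/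
theorem half_half (H : IsPairFlip R τ e) (h : IsIsometricRep P R ρ) (hBs : B ⊆ Side e τ.1 s)
    (hCs : C ⊆ Side e τ.1 s') (hB : Swappable R.rel τ.1 B) (hC : Swappable R.rel τ.1 C)
    {k : permGroup R.rel} (hd : ∀ᵐ x ∂μ, x ∈ B → k.1 x ∉ C) :
    ∀ᶠ ω in P.ae, ω ∈ Half ρ ι hB s → ρ k ω ∉ Half ρ ι hC s' := by
  have hE : MeasurableSet {x | k.1 x = x} :=
    measurableSet_eq_of_measurable (permGroup_measurable k) measurable_id
  have h1s : B ∩ {x | k.1 x = x} ⊆ Side e τ.1 s := Set.inter_subset_left.trans hBs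
  have h2s : B \ {x | k.1 x = x} ⊆ Side e τ.1 s := Set.sdiff_subset.trans hBs
  have h1 := H.swappable (hB.measurableSet.inter hE) h1s
  have h2 := H.swappable (hB.measurableSet.diff hE) h2s
  -- For equal sides the part of `B` is disjoint from both `C` and `τC`, so the swaps have disjoint
  -- supports; for different sides the halves are disjoint by definition.
  have c1 : ∀ᶠ ω in P.ae, ω ∈ Half ρ ι h1 s → ρ k ω ∉ Half ρ ι hC s' := by
    by_cases hss : s = s'
    · have d1 : ∀ᵐ x ∂μ, x ∈ B ∩ {x | k.1 x = x} → x ∉ C := by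
        filter_upwards [hd] with x hx hxB
        have := hx hxB.1
        rwa [show k.1 x = x from hxB.2] at this
      have d2 : ∀ᵐ x ∂μ, τ.1 x ∈ B ∩ {x | k.1 x = x} → x ∉ C := Eventually.of_forall fun x hx hc =>
        Side.not (Side.apply (H.involutive x) (hCs hc)) (by
          rw [Bool.not_not, ← hss]; exact h1s hx)
      filter_upwards [H.fixes_half h h1s h1 (Eventually.of_forall fun x hx => hx.2) s,
        H.half_disjoint h h1 hC d1 d2] with ω e1 e2 hω hc
      rw [e1 hω] at hc
      exact e2.elim hω.1 hc.1
    · filter_upwards [H.fixes_half h h1s h1 (Eventually.of_forall fun x hx => hx.2) s]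
        with ω e1 hω hc
      rw [e1 hω] at hc
      exact hss (Side.eq_of_mem hω.2 hc.2)
  -- Here `τ k` is the identity, and composing with `τ` exchanges the halves of `C`, so the roles of
  -- the two cases of sides are reversed.
  have c2 : ∀ᶠ ω in P.ae, ω ∈ Half ρ ι h2 s → ρ k ω ∉ Half ρ ι hC s' := by
    have hkτ : ∀ x ∈ B \ {x | k.1 x = x}, k.1 x = τ.1 x := fun x hx =>
      (H.apply_eq hBs k hx.1).resolve_left hx.2
    have hfix := H.fixes_half (P := P) (ρ := ρ) (ι := ι) h h2s h2 (k := τ * k)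
      (Eventually.of_forall fun x hx => (congrArg τ.1 (hkτ x hx)).trans (H.involutive x)) s
    have hflip := h.comp k (H.half_flip (ι := ι) h hC s')
    by_cases hss : s = !s'
    · have d1 : ∀ᵐ x ∂μ, x ∈ B \ {x | k.1 x = x} → x ∉ C := Eventually.of_forall fun x hx hc =>
        Side.not (hCs hc) (hss ▸ h2s hx)
      have d2 : ∀ᵐ x ∂μ, τ.1 x ∈ B \ {x | k.1 x = x} → x ∉ C := by
        filter_upwards [(R.measurePreserving τ).quasiMeasurePreserving.ae hd] with x hx hxB
        have := hx hxB.1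
        rwa [hkτ _ hxB, H.involutive] at this
      filter_upwards [hfix, h.mul τ k, H.half_disjoint h h2 hC d1 d2, hflip]
        with ω e1 e2 e3 e4 hω hc
      have e5 := e4 hc
      have e6 := e1 hω
      rw [e2] at e6
      rw [e6] at e5
      exact e3.elim hω.1 e5.1
    · filter_upwards [hfix, h.mul τ k, hflip] with ω e1 e2 e4 hω hc
      have e5 := e4 hc
      have e6 := e1 hω
      rw [e2] at e6
      rw [e6] at e5
      exact hss (Side.eq_of_mem hω.2 e5.2)
  filter_upwards [c1, c2, half_union (ι := ι) h hB h1 h2 (Set.inter_union_sdiff _ _).symm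
    (Set.disjoint_sdiff_right.mono_left Set.inter_subset_right) s] with ω e1 e2 e3 hω
  exact (e3 hω).elim e1 e2

/-- A triple lives on classes with at least three points, where `τ` is trivial. Since halves consist
of points moved by `ρ τ`, this separates cores from halves. -/
theorem core_fixed (H : IsPairFlip R τ e) (h : IsIsometricRep P R ρ) {α β : permGroup R.rel}
    (T : IsTriple α β B) : ∀ᶠ ω in P.ae, ω ∈ T.Core ρ → ρ τ ω = ω := by
  refine T.fixes_core h fun x hx => ?_
  by_contra hc
  have h1 := H.eq_or_eq x hc _ (permGroup_rel α x)
  have h2 := H.eq_or_eq x hc _ (permGroup_rel β x)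
  have n1 : α.1 x ≠ x := fun hh => T.left x hx (hh.symm ▸ hx)
  have n2 : β.1 x ≠ x := fun hh => T.right x hx (hh.symm ▸ hx)
  exact T.ne x hx x hx ((h1.resolve_left n1).trans (h2.resolve_left n2).symm)

theorem core_half (H : IsPairFlip R τ e) (h : IsIsometricRep P R ρ) {α β : permGroup R.rel}
    (T : IsTriple α β B) (hC : Swappable R.rel τ.1 C) (k : permGroup R.rel) (s : Bool) :
    ∀ᶠ ω in P.ae, ω ∈ T.Core ρ → ρ k ω ∉ Half ρ ι hC s := by
  filter_upwards [T.core_conj h k, h.comp k (H.core_fixed h (T.conj k)),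
    h.comp k (H.moved_subset h hC)] with ω h1 h2 h3 hω hc
  exact h3 hc.1 (h2 (h1 hω))

theorem half_core (H : IsPairFlip R τ e) (h : IsIsometricRep P R ρ) {α β : permGroup R.rel}
    (T : IsTriple α β B) (hC : Swappable R.rel τ.1 C) (k : permGroup R.rel) (s : Bool) :
    ∀ᶠ ω in P.ae, ω ∈ Half ρ ι hC s → ρ k ω ∉ T.Core ρ := by
  filter_upwards [h.comp k (H.core_half (ι := ι) h T hC k⁻¹ s), h.inv k] with ω h1 h2 hω hc
  rw [h2] at h1
  exact h1 hc hω

end IsPairFlip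

end PairPart

/-! ### Represented sets -/

section Represents

variable {X : Type*} [MeasurableSpace X] [StandardBorelSpace X] {μ : Measure X}
  {R : PMPRelation X μ} {Ω : Type*}

/-- The Borel set `B` is represented by `S`: finite disjoint unions of the two basic cases. -/
inductive Represents (τ : permGroup R.rel) (e : X → ℝ) (ρ : permGroup R.rel → Equiv.Perm Ω)
    (ι : Ω → ℕ) : Set X → Set Ω → Prop
  | core {α β : permGroup R.rel} {B : Set X} (T : IsTriple α β B) :
      Represents τ e ρ ι B (T.Core ρ)
  -- The half is taken on the side `s` that contains `B`; using the same label in `X` and in `Ω`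
  -- keeps the choices for different sets consistent.
  | half {B : Set X} {s : Bool} (hs : B ⊆ Side e τ.1 s) (hB : Swappable R.rel τ.1 B) :
      Represents τ e ρ ι B (IsPairFlip.Half ρ ι hB s)
  | union {B C : Set X} {S T : Set Ω} (hB : Represents τ e ρ ι B S)
      (hC : Represents τ e ρ ι C T) (hd : Disjoint B C) : Represents τ e ρ ι (B ∪ C) (S ∪ T)

namespace Represents

variable {τ : permGroup R.rel} {e : X → ℝ} {ρ : permGroup R.rel → Equiv.Perm Ω} {ι : Ω → ℕ}
  {P : FinAddProb Ω} {B C : Set X} {S T : Set Ω}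

theorem measurableSet (hB : Represents τ e ρ ι B S) : MeasurableSet B := by
  induction hB with
  | core T => exact T.measurableSet
  | half _ hB => exact hB.measurableSet
  | union _ _ _ h1 h2 => exact h1.union h2

variable [IsProbabilityMeasure μ]

theorem disjoint (hB : Represents τ e ρ ι B S) (hC : Represents τ e ρ ι C T)
    (H : IsPairFlip R τ e) (h : IsIsometricRep P R ρ) (k : permGroup R.rel)
    (hd : ∀ᵐ x ∂μ, x ∈ B → k.1 x ∉ C) : ∀ᶠ ω in P.ae, ω ∈ S → ρ k ω ∉ T := by
  induction hB with
  | @core _ _ B TB =>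
    induction hC with
    | @core _ _ C TC =>
      have hd' : ∀ᵐ x ∂μ, x ∈ k.1 '' B → x ∉ C := by
        filter_upwards [(R.measurePreserving k⁻¹).quasiMeasurePreserving.ae hd] with x hx hxB
        obtain ⟨y, hy, rfl⟩ := hxB
        have e1 : (k⁻¹).1 (k.1 y) = y := k.1.symm_apply_apply y
        rw [e1] at hx
        exact hx hy
      filter_upwards [TB.core_conj h k, h.comp k ((TB.conj k).core_disjoint h TC hd')]
        with ω h1 h2 hω
      exact h2 (h1 hω)
    | half hs hC => exact H.core_half h TB hC k _
    | union _ _ _ ih1 ih2 =>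
      filter_upwards [ih1 (hd.mono fun x hx hxB hc => hx hxB (Or.inl hc)),
        ih2 (hd.mono fun x hx hxB hc => hx hxB (Or.inr hc))] with ω h1 h2 hω hc
      exact hc.elim (h1 hω) (h2 hω)
  | half hs hB =>
    induction hC with
    | core TC => exact H.half_core h TC hB k _
    | half hs' hC => exact H.half_half h hs hs' hB hC hd
    | union _ _ _ ih1 ih2 =>
      filter_upwards [ih1 (hd.mono fun x hx hxB hc => hx hxB (Or.inl hc)),
        ih2 (hd.mono fun x hx hxB hc => hx hxB (Or.inr hc))] with ω h1 h2 hω hc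
      exact hc.elim (h1 hω) (h2 hω)
  | union _ _ _ ih1 ih2 =>
    filter_upwards [ih1 (hd.mono fun x hx hxB => hx (Or.inl hxB)),
      ih2 (hd.mono fun x hx hxB => hx (Or.inr hxB))] with ω h1 h2 hω
    exact hω.elim h1 h2

theorem disjoint_one (hB : Represents τ e ρ ι B S) (hC : Represents τ e ρ ι C T)
    (H : IsPairFlip R τ e) (h : IsIsometricRep P R ρ) (hd : ∀ᵐ x ∂μ, x ∈ B → x ∉ C) :
    ∀ᶠ ω in P.ae, ω ∈ S → ω ∉ T := by
  filter_upwards [hB.disjoint hC H h 1 hd, h.one] with ω h1 h2 hω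
  rw [h2] at h1
  exact h1 hω

theorem measure_eq (hB : Represents τ e ρ ι B S) (H : IsPairFlip R τ e)
    (h : IsIsometricRep P R ρ) (hι : Function.Injective ι) : P.m S = μ.real B := by
  induction hB with
  | core T => exact T.measure_core h
  | half _ hB => exact H.measure_half h hι hB _
  | union hB hC hd ih1 ih2 =>
    rw [P.union_of_ae (hB.disjoint_one hC H h (Eventually.of_forall fun x hx =>
      Set.disjoint_left.1 hd hx)), ih1, ih2, measureReal_union hd hC.measurableSet]

theorem fixes (hB : Represents τ e ρ ι B S) (H : IsPairFlip R τ e) (h : IsIsometricRep P R ρ)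
    {k : permGroup R.rel} (hk : ∀ᵐ x ∂μ, x ∈ B → k.1 x = x) :
    ∀ᶠ ω in P.ae, ω ∈ S → ρ k ω = ω := by
  induction hB with
  | core T => exact T.fixes_core_of_ae h hk
  | half hs hB => exact H.fixes_half h hs hB hk _
  | union _ _ _ ih1 ih2 =>
    filter_upwards [ih1 (hk.mono fun x hx hxB => hx (Or.inl hxB)),
      ih2 (hk.mono fun x hx hxB => hx (Or.inr hxB))] with ω h1 h2 hω
    exact hω.elim h1 h2

end Represents

/-- Every Borel subset of `B` is represented. -/
theorem exists_represents {γ : ℕ → permGroup R.rel} {τ : permGroup R.rel} {e : X → ℝ}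
    (H : IsPairFlip R τ e)
    (hτ : ∀ᵐ x ∂μ, τ.1 x = x → ∃ n m, (γ n).1 x ≠ x ∧ (γ m).1 x ≠ x ∧ (γ n).1 x ≠ (γ m).1 x)
    (ρ : permGroup R.rel → Equiv.Perm Ω) (ι : Ω → ℕ) [IsProbabilityMeasure μ] {A : Set X}
    (hA : MeasurableSet A) {ε : ℝ} (hε : 0 < ε) :
    ∃ B ⊆ A, ∃ S, Represents τ e ρ ι B S ∧ μ.real (A \ B) < ε := by
  obtain ⟨S, hS, hsep⟩ := exists_separating_seq X
  -- The pieces are the two sides of `τ`, and the sets where `γ n` and `γ m` form a triple,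
  -- witnessed by one separating set for each of its three disjointness conditions.
  let C : Bool ⊕ (ℕ × ℕ × ℕ × ℕ × ℕ) → Set X := fun i =>
    match i with
    | .inl s => Side e τ.1 s
    | .inr (n, m, i, j, k) => ((γ n).1 ⁻¹' S i \ S i) ∩ ((γ m).1 ⁻¹' S j \ S j) ∩
        ((γ n).1 ⁻¹' S k \ (γ m).1 ⁻¹' S k)
  have hCm : ∀ i, MeasurableSet (C i) := by
    rintro (s | ⟨n, m, i, j, k⟩)
    · exact H.measurableSet_side s
    · exact (((permGroup_measurable _ (hS _)).diff (hS _)).inter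
        ((permGroup_measurable _ (hS _)).diff (hS _))).inter
        ((permGroup_measurable _ (hS _)).diff (permGroup_measurable _ (hS _)))
  have hCr : ∀ i, ∀ B ⊆ C i, MeasurableSet B → ∃ T, Represents τ e ρ ι B T := by
    rintro (s | ⟨n, m, i, j, k⟩) B hB hBm
    · exact ⟨_, .half hB (H.swappable hBm hB)⟩
    · exact ⟨_, .core (α := γ n) (β := γ m) ⟨hBm, fun x hx hc => (hB hc).1.1.2 (hB hx).1.1.1,
        fun x hx hc => (hB hc).1.2.2 (hB hx).1.2.1, fun x hx y hy hxy =>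
          (hB hy).2.2 (by rw [Set.mem_preimage, ← hxy]; exact (hB hx).2.1)⟩⟩
  have hcov : ∀ᵐ x ∂μ, ∃ i, x ∈ C i := by
    filter_upwards [hτ] with x hx
    by_cases hxτ : τ.1 x = x
    · obtain ⟨n, m, h1, h2, h3⟩ := hx hxτ
      obtain ⟨i, hi⟩ := hsep _ _ h1
      obtain ⟨j, hj⟩ := hsep _ _ h2
      obtain ⟨k, hk⟩ := hsep _ _ h3
      exact ⟨.inr (n, m, i, j, k), ⟨hi, hj⟩, hk⟩
    · exact (Side.exists_of_ne H.injective hxτ).elim (fun h => ⟨.inl true, h⟩)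
        fun h => ⟨.inl false, h⟩
  obtain ⟨u, hu⟩ := exists_surjective_nat (Bool ⊕ (ℕ × ℕ × ℕ × ℕ × ℕ))
  let E : ℕ → Set X := fun J => A ∩ ⋃ j < J, C (u j)
  have hEm : ∀ J, MeasurableSet (E J) := fun J => hA.inter
    (MeasurableSet.iUnion fun j => MeasurableSet.iUnion fun _ => hCm _)
  have hEs : ∀ J, E (J + 1) = E J ∪ (A ∩ C (u J)) \ E J := by
    intro J
    ext x
    simp only [E, Set.mem_union, Set.mem_sdiff, Set.mem_inter_iff, Set.mem_iUnion,
      Nat.lt_succ_iff_lt_or_eq]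
    grind
  have hEr : ∀ J, ∃ T, Represents τ e ρ ι (E J) T := by
    intro J
    induction J with
    | zero =>
      have : E 0 = ∅ := by simp [E]
      rw [this]
      exact hCr (.inl true) ∅ (Set.empty_subset _) MeasurableSet.empty
    | succ J ih =>
      obtain ⟨T, hT⟩ := ih
      obtain ⟨T', hT'⟩ := hCr (u J) ((A ∩ C (u J)) \ E J)
        (Set.sdiff_subset.trans Set.inter_subset_right) ((hA.inter (hCm _)).diff (hEm J))
      rw [hEs]
      exact ⟨_, hT.union hT' Set.disjoint_sdiff_right⟩
  have hmono : Antitone fun J => A \ E J := antitone_nat_of_succ_le fun J =>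
    Set.sdiff_subset_sdiff_right (by rw [hEs]; exact Set.subset_union_left)
  have hlim := tendsto_measure_iInter_atTop (μ := μ) (s := fun J => A \ E J)
    (fun J => (hA.diff (hEm J)).nullMeasurableSet) hmono ⟨0, measure_ne_top _ _⟩
  have h0 : μ (⋂ J, A \ E J) = 0 := by
    rw [measure_eq_zero_iff_ae_notMem]
    filter_upwards [hcov] with x hx hc
    rw [Set.mem_iInter] at hc
    obtain ⟨i, hi⟩ := hx
    obtain ⟨j, rfl⟩ := hu i
    exact (hc (j + 1)).2 ⟨(hc 0).1, Set.mem_biUnion (show j < j + 1 from j.lt_succ_self) hi⟩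
  rw [h0] at hlim
  have hlim' : Tendsto (fun J => μ.real (A \ E J)) atTop (𝓝 0) :=
    (ENNReal.tendsto_toReal ENNReal.zero_ne_top).comp hlim
  obtain ⟨J, hJ⟩ := (hlim'.eventually_lt_const hε).exists
  obtain ⟨T, hT⟩ := hEr J
  exact ⟨E J, Set.inter_subset_left, T, hT, hJ⟩

end Represents

/-! ### Approximating Borel sets by subsets of the sample space -/

section Approximation

variable {X : Type*} [MeasurableSpace X] {μ : Measure X} {R : PMPRelation X μ} {Ω : Type*}

/-- `Q B S` assigns to a dense family of Borel sets `B` subsets `S` of `Ω`, compatibly with `ρ`. -/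
structure IsSetRep (P : FinAddProb Ω) (R : PMPRelation X μ) (ρ : permGroup R.rel → Equiv.Perm Ω)
    (Q : Set X → Set Ω → Prop) : Prop where
  measurableSet : ∀ {B S}, Q B S → MeasurableSet B
  measure_eq : ∀ {B S}, Q B S → P.m S = μ.real B
  disjoint : ∀ {B S C T}, Q B S → Q C T → ∀ k : permGroup R.rel,
    (∀ᵐ x ∂μ, x ∈ B → k.1 x ∉ C) → ∀ᶠ ω in P.ae, ω ∈ S → ρ k ω ∉ T
  fixes : ∀ {B S}, Q B S → ∀ k : permGroup R.rel, (∀ᵐ x ∂μ, x ∈ B → k.1 x = x) →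
    ∀ᶠ ω in P.ae, ω ∈ S → ρ k ω = ω
  exists_approx : ∀ {A : Set X}, MeasurableSet A → ∀ {ε : ℝ}, 0 < ε →
    ∃ B ⊆ A, ∃ S, Q B S ∧ μ.real (A \ B) < ε

/-- `S` behaves like the Borel set `A`, up to `δ`, with respect to all sets of the family `Q`. -/
def IsModel (P : FinAddProb Ω) (ρ : permGroup R.rel → Equiv.Perm Ω) (Q : Set X → Set Ω → Prop)
    (δ : ℝ) (A : Set X) (S : Set Ω) : Prop :=
  ∀ B T, Q B T → ∀ k : permGroup R.rel,
    ((∀ᵐ x ∂μ, x ∈ B → k.1 x ∈ A) → P.m {ω | ω ∈ T ∧ ρ k ω ∉ S} ≤ δ) ∧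
    ((∀ᵐ x ∂μ, x ∈ B → k.1 x ∉ A) → P.m {ω | ω ∈ T ∧ ρ k ω ∈ S} ≤ δ)

variable {P : FinAddProb Ω} {ρ : permGroup R.rel → Equiv.Perm Ω} {Q : Set X → Set Ω → Prop}
  {δ : ℝ}

theorem IsModel.notMem_le {A B : Set X} {S T : Set Ω} (hS : IsModel P ρ Q δ A S)
    (h : IsIsometricRep P R ρ) (hT : Q B T)
    (hB : ∀ᵐ x ∂μ, x ∈ B → x ∈ A) : P.m {ω | ω ∈ T ∧ ω ∉ S} ≤ δ := by
  refine le_trans (P.mono_ae ?_) ((hS B T hT 1).1 hB)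
  filter_upwards [h.one] with ω h1 hω
  exact ⟨hω.1, by rw [h1]; exact hω.2⟩

theorem IsModel.mem_le {A B : Set X} {S T : Set Ω} (hS : IsModel P ρ Q δ A S)
    (h : IsIsometricRep P R ρ) (hT : Q B T)
    (hB : ∀ᵐ x ∂μ, x ∈ B → x ∉ A) : P.m {ω | ω ∈ T ∧ ω ∈ S} ≤ δ := by
  refine le_trans (P.mono_ae ?_) ((hS B T hT 1).2 hB)
  filter_upwards [h.one] with ω h1 hω
  exact ⟨hω.1, by rw [h1]; exact hω.2⟩

namespace IsSetRep

theorem disjoint_one (H : IsSetRep P R ρ Q) (h : IsIsometricRep P R ρ) {B C : Set X} {S T : Set Ω}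
    (hB : Q B S) (hC : Q C T) (hd : Disjoint B C) : ∀ᶠ ω in P.ae, ω ∈ S → ω ∉ T := by
  filter_upwards [H.disjoint hB hC 1 (Eventually.of_forall fun _ hx => Set.disjoint_left.1 hd hx),
    h.one] with ω h1 h2 hω
  rw [h2] at h1
  exact h1 hω

theorem isModel_univ (H : IsSetRep P R ρ Q) (hδ : 0 ≤ δ) : IsModel P ρ Q δ Set.univ Set.univ := by
  refine fun B T hT k => ⟨fun _ => ?_, fun hk => ?_⟩
  · simpa [P.empty] using hδ
  · refine (P.mono fun ω hω => hω.1).trans ?_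
    rw [H.measure_eq hT, measureReal_def, measure_eq_zero_iff_ae_notMem.2
      (hk.mono fun x hx hxB => hx hxB trivial)]
    exact hδ

theorem isModel_empty (H : IsSetRep P R ρ Q) (hδ : 0 ≤ δ) : IsModel P ρ Q δ ∅ ∅ := by
  refine fun B T hT k => ⟨fun hk => ?_, fun _ => ?_⟩
  · refine (P.mono fun ω hω => hω.1).trans ?_
    rw [H.measure_eq hT, measureReal_def, measure_eq_zero_iff_ae_notMem.2 hk]
    exact hδ
  · simpa [P.empty] using hδ

variable [IsProbabilityMeasure μ]

theorem exists_cover (H : IsSetRep P R ρ Q) (h : IsIsometricRep P R ρ) (hδ : 0 < δ)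
    {A₁ A₂ A₃ : Set X} (h₁ : MeasurableSet A₁) (h₂ : MeasurableSet A₂) (h₃ : MeasurableSet A₃)
    (h₁₂ : Disjoint A₁ A₂) (h₁₃ : Disjoint A₁ A₃) (h₂₃ : Disjoint A₂ A₃)
    (hu : A₁ ∪ A₂ ∪ A₃ = Set.univ) :
    ∃ B₁ ⊆ A₁, ∃ B₂ ⊆ A₂, ∃ B₃ ⊆ A₃, ∃ S₁ S₂ S₃, Q B₁ S₁ ∧ Q B₂ S₂ ∧ Q B₃ S₃ ∧
      P.m (S₁ ∪ S₂ ∪ S₃)ᶜ ≤ 3 * δ := by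
  obtain ⟨B₁, hB₁, S₁, hS₁, hm₁⟩ := H.exists_approx h₁ hδ
  obtain ⟨B₂, hB₂, S₂, hS₂, hm₂⟩ := H.exists_approx h₂ hδ
  obtain ⟨B₃, hB₃, S₃, hS₃, hm₃⟩ := H.exists_approx h₃ hδ
  refine ⟨B₁, hB₁, B₂, hB₂, B₃, hB₃, S₁, S₂, S₃, hS₁, hS₂, hS₃, ?_⟩
  have d₁₂ := H.disjoint_one h hS₁ hS₂ (h₁₂.mono hB₁ hB₂)
  have d₁₃ := H.disjoint_one h hS₁ hS₃ (h₁₃.mono hB₁ hB₃)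
  have d₂₃ := H.disjoint_one h hS₂ hS₃ (h₂₃.mono hB₂ hB₃)
  have d : ∀ᶠ ω in P.ae, ω ∈ S₁ ∪ S₂ → ω ∉ S₃ := by
    filter_upwards [d₁₃, d₂₃] with ω e1 e2 hω
    exact hω.elim e1 e2
  rw [P.compl, P.union_of_ae d, P.union_of_ae d₁₂, H.measure_eq hS₁, H.measure_eq hS₂,
    H.measure_eq hS₃]
  rw [measureReal_sdiff hB₁ (H.measurableSet hS₁)] at hm₁
  rw [measureReal_sdiff hB₂ (H.measurableSet hS₂)] at hm₂
  rw [measureReal_sdiff hB₃ (H.measurableSet hS₃)] at hm₃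
  have hs : μ.real A₁ + μ.real A₂ + μ.real A₃ = 1 := by
    rw [← measureReal_union h₁₂ h₂, ← measureReal_union (Set.disjoint_union_left.2 ⟨h₁₃, h₂₃⟩) h₃,
      hu, probReal_univ]
  linarith

/-- `S` represents a large subset of `A`, and another set represents a large subset of the
complement. If `k` sends `B` into `A`, then `ρ k` sends its representative off the second set, hence
into `S` up to the part left uncovered. -/
theorem exists_isModel (H : IsSetRep P R ρ Q) (h : IsIsometricRep P R ρ) {A : Set X}
    (hA : MeasurableSet A) (hδ : 0 < δ) : ∃ S, IsModel P ρ Q δ A S := by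
  -- The third part of the partition is empty; the tolerance `δ / 3` makes the uncovered part at
  -- most `δ`.
  obtain ⟨B₁, hB₁, B₂, hB₂, B₃, hB₃, S₁, S₂, S₃, hS₁, hS₂, hS₃, hm⟩ := H.exists_cover h
    (show 0 < δ / 3 by positivity) hA hA.compl MeasurableSet.empty disjoint_compl_right
    (Set.disjoint_empty _) (Set.disjoint_empty _) (by simp)
  refine ⟨S₁, fun B T hT k => ⟨fun hk => ?_, fun hk => ?_⟩⟩
  · have d₂ := H.disjoint hT hS₂ k (hk.mono fun x hx hxB hc => hB₂ hc (hx hxB))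
    have d₃ := H.disjoint hT hS₃ k (Eventually.of_forall fun x _ hc => hB₃ hc)
    refine (P.mono_ae (t := ρ k ⁻¹' (S₁ ∪ S₂ ∪ S₃)ᶜ) ?_).trans ?_
    · filter_upwards [d₂, d₃] with ω e2 e3 hω hc
      exact hc.elim (fun hc => hc.elim hω.2 (e2 hω.1)) (e3 hω.1)
    · rw [h.preimage]
      linarith
  · have d := H.disjoint hT hS₁ k (hk.mono fun x hx hxB hc => hx hxB (hB₁ hc))
    refine (P.eventually_notMem_iff.1 ?_).trans_le hδ.le
    filter_upwards [d] with ω e hω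
    exact e hω.1 hω.2

/-- `D` plays the domain of a product. On representatives of subsets of `D ∩ A`, of `A \ D` and of
the complement of `A`, the models decide every condition. The errors are `3 * δ` for the uncovered
part and seven times `δ` for the models. -/
theorem mul_le (H : IsSetRep P R ρ Q) (h : IsIsometricRep P R ρ) (hδ : 0 < δ) {A C D : Set X}
    (hA : MeasurableSet A) (hD : MeasurableSet D) {SA SC SD : Set Ω}
    (mA : IsModel P ρ Q δ A SA) (mC : IsModel P ρ Q δ C SC) (mD : IsModel P ρ Q δ D SD)
    {g g' G : permGroup R.rel} (hDAC : ∀ᵐ x ∂μ, x ∈ D ↔ x ∈ A ∧ g'.1 x ∈ C)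
    (hG : ∀ᵐ x ∂μ, x ∈ D → G.1 x = g.1 (g'.1 x)) :
    P.m {ω | ¬ ((ω ∈ SD ↔ ω ∈ SA ∧ ρ g' ω ∈ SC) ∧ (ω ∈ SD → ρ G ω = ρ g (ρ g' ω)))} ≤
      10 * δ := by
  obtain ⟨B₁, hB₁, B₂, hB₂, B₃, hB₃, S₁, S₂, S₃, hS₁, hS₂, hS₃, hm⟩ := H.exists_cover h hδ
    (hD.inter hA) (hA.diff hD) hA.compl (Set.disjoint_left.2 fun x hx hc => hc.2 hx.1)
    (Set.disjoint_left.2 fun x hx hc => hc hx.2) (Set.disjoint_left.2 fun x hx hc => hc hx.1)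
    (by ext x; by_cases hxA : x ∈ A <;> by_cases hxD : x ∈ D <;> simp [hxA, hxD])
  have e₁ := mD.notMem_le h hS₁ (Eventually.of_forall fun x hx => (hB₁ hx).1)
  have e₂ := mA.notMem_le h hS₁ (Eventually.of_forall fun x hx => (hB₁ hx).2)
  have e₃ := (mC B₁ S₁ hS₁ g').1 (hDAC.mono fun x hx hxB => (hx.1 (hB₁ hxB).1).2)
  have e₄ := mD.mem_le h hS₂ (Eventually.of_forall fun x hx => (hB₂ hx).2)
  have e₅ := (mC B₂ S₂ hS₂ g').2 (hDAC.mono fun x hx hxB hc =>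
    (hB₂ hxB).2 (hx.2 ⟨(hB₂ hxB).1, hc⟩))
  have e₆ := mD.mem_le h hS₃ (hDAC.mono fun x hx hxB hc => hB₃ hxB (hx.1 hc).1)
  have e₇ := mA.mem_le h hS₃ (Eventually.of_forall fun x hx => hB₃ hx)
  -- That `G` and `g * g'` agree on `D` is expressed by an element fixing `D`, to which `fixes`
  -- applies.
  have hfix := H.fixes hS₁ ((g * g')⁻¹ * G) (hG.mono fun x hx hxB => by
    change (g * g').1.symm (G.1 x) = x
    rw [hx (hB₁ hxB).1]
    exact (g * g').1.symm_apply_apply x)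
  refine (P.mono_ae (t := (S₁ ∪ S₂ ∪ S₃)ᶜ ∪ ({ω | ω ∈ S₁ ∧ ω ∉ SD} ∪ ({ω | ω ∈ S₁ ∧ ω ∉ SA} ∪
    ({ω | ω ∈ S₁ ∧ ρ g' ω ∉ SC} ∪ ({ω | ω ∈ S₂ ∧ ω ∈ SD} ∪ ({ω | ω ∈ S₂ ∧ ρ g' ω ∈ SC} ∪
    ({ω | ω ∈ S₃ ∧ ω ∈ SD} ∪ {ω | ω ∈ S₃ ∧ ω ∈ SA}))))))) ?_).trans ?_
  · filter_upwards [hfix, h.mul g g', h.mul (g * g') ((g * g')⁻¹ * G)] with ω f1 f2 f3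
    intro hω
    by_contra hc
    simp only [Set.mem_union, Set.mem_compl_iff, Set.mem_ofPred_eq, not_or, not_and, not_not]
      at hc
    obtain ⟨c0, c1, c2, c3, c4, c5, c6, c7⟩ := hc
    refine hω.elim ?_
    have c : ω ∈ S₁ ∨ ω ∈ S₂ ∨ ω ∈ S₃ := by
      by_contra! hc
      exact hc.2.2 (c0 ⟨hc.1, hc.2.1⟩)
    rcases c with c | c | c
    · refine ⟨⟨fun _ => ⟨c2 c, c3 c⟩, fun _ => c1 c⟩, fun _ => ?_⟩
      rw [f1 c, f2, mul_inv_cancel_left] at f3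
      exact f3
    · exact ⟨⟨fun hd => absurd hd (c4 c), fun hd => absurd hd.2 (c5 c)⟩,
        fun hd => absurd hd (c4 c)⟩
    · exact ⟨⟨fun hd => absurd hd (c6 c), fun hd => absurd hd.1 (c7 c)⟩,
        fun hd => absurd hd (c6 c)⟩
  · have hle : ∀ {s t : Set Ω} {a b : ℝ}, P.m s ≤ a → P.m t ≤ b → P.m (s ∪ t) ≤ a + b :=
      fun hs ht => (P.union_le _ _).trans (add_le_add hs ht)
    refine (hle hm (hle e₁ (hle e₂ (hle e₃ (hle e₄ (hle e₅ (hle e₆ e₇))))))).trans ?_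
    linarith

/-- Represented subsets of `A ∩ Fix g` and `Fix g \ A` have representatives inside the fixed set of
`ρ g`. They nearly exhaust it because its measure is `μ(Fix g)`. -/
theorem abs_trace_sub_le [StandardBorelSpace X] (H : IsSetRep P R ρ Q)
    (h : IsIsometricRep P R ρ) (hδ : 0 < δ) {A : Set X} (hA : MeasurableSet A) {S : Set Ω}
    (mA : IsModel P ρ Q δ A S)
    (g : permGroup R.rel) :
    |μ.real {x | x ∈ A ∧ g.1 x = x} - P.m {ω | ω ∈ S ∧ ρ g ω = ω}| ≤ 3 * δ := by
  have hV : MeasurableSet {x | g.1 x = x} := (IsIsometricRep.measurableSet_ne g).of_compl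
  obtain ⟨B₁, hB₁, S₁, hS₁, hm₁⟩ := H.exists_approx (hA.inter hV) hδ
  obtain ⟨B₂, hB₂, S₂, hS₂, hm₂⟩ := H.exists_approx (hV.diff hA) hδ
  rw [measureReal_sdiff hB₁ (H.measurableSet hS₁), ← H.measure_eq hS₁] at hm₁
  rw [measureReal_sdiff hB₂ (H.measurableSet hS₂), ← H.measure_eq hS₂] at hm₂
  have e₁ := mA.notMem_le h hS₁ (Eventually.of_forall fun x hx => (hB₁ hx).1)
  have e₂ := mA.mem_le h hS₂ (Eventually.of_forall fun x hx => (hB₂ hx).2)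
  have f₁ := H.fixes hS₁ g (Eventually.of_forall fun x hx => (hB₁ hx).2)
  have f₂ := H.fixes hS₂ g (Eventually.of_forall fun x hx => (hB₂ hx).1)
  have d := H.disjoint_one h hS₁ hS₂
    (Set.disjoint_left.2 fun x hx hc => (hB₂ hc).2 (hB₁ hx).1)
  have hF : P.m {ω | ρ g ω = ω} = μ.real (A ∩ {x | g.1 x = x}) + μ.real ({x | g.1 x = x} \ A) := by
    have h1 := P.compl {ω | ρ g ω ≠ ω}
    rw [h.moved, ← probReal_compl_eq_one_sub (IsIsometricRep.measurableSet_ne g)] at h1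
    rw [← measureReal_union (Set.disjoint_left.2 fun x hx hc => hc.2 hx.1) (hV.diff hA),
      Set.inter_comm, Set.inter_union_sdiff]
    simpa [Set.compl_ofPred] using h1
  have hlow : P.m S₁ ≤ P.m {ω | ω ∈ S ∧ ρ g ω = ω} + δ := by
    refine (P.mono_ae ?_).trans ((P.union_le _ _).trans (add_le_add le_rfl e₁))
    filter_upwards [f₁] with ω hω hS
    by_cases hc : ω ∈ S
    · exact Or.inl ⟨hc, hω hS⟩
    · exact Or.inr ⟨hS, hc⟩
  have hrest : P.m ({ω | ρ g ω = ω} \ (S₁ ∪ S₂)) = P.m {ω | ρ g ω = ω} - (P.m S₁ + P.m S₂) := by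
    rw [eq_sub_iff_add_eq, ← P.union_of_ae d,
      ← P.union _ _ Set.disjoint_sdiff_left]
    refine P.congr_ae ?_
    filter_upwards [f₁, f₂] with ω h1 h2
    rw [Set.sdiff_union_self]
    exact ⟨fun hc => hc.elim id fun hc => hc.elim h1 h2, Or.inl⟩
  have hup : P.m {ω | ω ∈ S ∧ ρ g ω = ω} ≤
      P.m S₁ + (P.m ({ω | ρ g ω = ω} \ (S₁ ∪ S₂)) + P.m {ω | ω ∈ S₂ ∧ ω ∈ S}) := by
    refine (P.mono fun ω hω => ?_).trans
      ((P.union_le _ _).trans (add_le_add le_rfl (P.union_le _ _)))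
    by_cases h1 : ω ∈ S₁
    · exact Or.inl h1
    by_cases h2 : ω ∈ S₂
    · exact Or.inr (Or.inr ⟨h2, hω.1⟩)
    · exact Or.inr (Or.inl ⟨hω.2, fun hc => hc.elim h1 h2⟩)
  have hs : P.m S₁ ≤ μ.real (A ∩ {x | g.1 x = x}) := by
    rw [H.measure_eq hS₁]; exact measureReal_mono hB₁
  change |μ.real (A ∩ {x | g.1 x = x}) - _| ≤ _
  rw [abs_le]
  constructor <;> linarith

end IsSetRep

end Approximation

/-! ### The sample space of an ultraproduct of symmetric groups -/

section Ultraproduct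

variable {U : Ultrafilter ℕ} {n : ℕ → ℕ}

/-- The fibre over `k` of a set in the disjoint union of the finite sets `Fin (n k)`. -/
def fiber (S : Set (Σ k, Fin (n k))) (k : ℕ) : Set (Fin (n k)) := {i | ⟨k, i⟩ ∈ S}

theorem tendsto_density (S : Set (Σ k, Fin (n k))) :
    Tendsto (fun k => density (fiber S k)) U
      (𝓝 (limUnder (U : Filter ℕ) fun k => density (fiber S k))) := by
  refine tendsto_nhds_limUnder ?_
  obtain ⟨l, -, hl⟩ := isCompact_iff_ultrafilter_le_nhds.1 (isCompact_Icc (a := (0 : ℝ)) (b := 1))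
    (U.map fun k => density (fiber S k)) (by
      rw [Filter.le_principal_iff]
      exact Filter.mem_map.2 (Filter.univ_mem' fun k => ⟨density_nonneg _, density_le_one _⟩))
  exact ⟨l, hl⟩

/-- The limit along `U` of the normalized counting measures. -/
noncomputable def ultraProb (U : Ultrafilter ℕ) (hn : ∀ k, 0 < n k) :
    FinAddProb (Σ k, Fin (n k)) where
  m S := limUnder (U : Filter ℕ) fun k => density (fiber S k)
  nonneg S := ge_of_tendsto' (tendsto_density S) fun _ => density_nonneg _
  union S T hST := by
    refine tendsto_nhds_unique (tendsto_density (S ∪ T)) ?_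
    have hk : ∀ k, density (fiber (S ∪ T) k) = density (fiber S k) + density (fiber T k) :=
      fun k => density_union_of_disjoint (Set.disjoint_left.2 fun i hi hc =>
        Set.disjoint_left.1 hST hi hc)
    simp only [hk]
    exact (tendsto_density S).add (tendsto_density T)
  univ := by
    refine tendsto_nhds_unique (tendsto_density Set.univ) ?_
    exact tendsto_const_nhds.congr fun k => (density_univ (hn k)).symm

theorem tendsto_ultraProb (hn : ∀ k, 0 < n k) (S : Set (Σ k, Fin (n k))) :
    Tendsto (fun k => density (fiber S k)) U (𝓝 ((ultraProb U hn).m S)) :=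
  tendsto_density S

theorem ultraProb_setOf_ne (hn : ∀ k, 0 < n k) (σ τ : PermSeq U n) :
    (ultraProb U hn).m {ω | Equiv.sigmaCongrRight σ ω ≠ Equiv.sigmaCongrRight τ ω} =
      dist σ τ := by
  refine congrArg (limUnder (U : Filter ℕ)) (funext fun k => ?_)
  rw [permDist_eq_density]
  refine congrArg density (Set.ext fun i => not_congr ?_)
  change (⟨k, σ k i⟩ : Σ k, Fin (n k)) = ⟨k, τ k i⟩ ↔ _
  simp

theorem isIsometricRep_of_isometry {X : Type*} [MeasurableSpace X] {μ : Measure X}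
    [IsProbabilityMeasure μ] {R : PMPRelation X μ} (hn : ∀ k, 0 < n k)
    {θ : fullGroup R →* PermUltraproduct U n} (hθ : Isometry θ)
    {σ : permGroup R.rel → PermSeq U n}
    (hσ : ∀ g, (SeparationQuotient.mk (σ g) : PermUltraproduct U n) = θ (toFullGroup R g)) :
    IsIsometricRep (ultraProb U hn) R fun g => Equiv.sigmaCongrRight (σ g) where
  mul g h := by
    have h1 := ultraProb_setOf_ne hn (σ (g * h)) (σ g * σ h)
    rw [← SeparationQuotient.dist_mk, SeparationQuotient.mk_mul, hσ, hσ, hσ, map_mul, map_mul,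
      dist_self] at h1
    exact h1
  dist g h := by
    rw [ultraProb_setOf_ne, ← SeparationQuotient.dist_mk, hσ, hσ, hθ.dist_eq, dist_toFullGroup]
  preimage g S := congrArg (limUnder (U : Filter ℕ)) (funext fun k =>
    density_preimage (σ g k) (fiber S k))

end Ultraproduct

/-! ### Soficity from an isometric embedding of the full group -/

section Sofic

variable {X : Type*} [MeasurableSpace X] [StandardBorelSpace X] {μ : Measure X}
  [IsProbabilityMeasure μ] {R : PMPRelation X μ}

/-- `π φ` restricts `σ (g φ) k` to the fibre over `k` of a model of the domain of `φ`. Finitely many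
strict inequalities about limits along `U` hold simultaneously for some `k`. -/
theorem IsSetRep.isSofic {U : Ultrafilter ℕ} {n : ℕ → ℕ} (hn : ∀ k, 0 < n k)
    {γ : ℕ → permGroup R.rel} (hγ : Generates R γ)
    {σ : permGroup R.rel → PermSeq U n} (hσ : σ 1 = 1)
    (h : IsIsometricRep (ultraProb U hn) R fun g => Equiv.sigmaCongrRight (σ g))
    {Q : Set X → Set (Σ k, Fin (n k)) → Prop}
    (H : IsSetRep (ultraProb U hn) R (fun g => Equiv.sigmaCongrRight (σ g)) Q) : IsSofic R := by
  intro K hK ε hε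
  have hδ : 0 < ε / 11 := by positivity
  -- Arbitrary choices are right only approximately, whereas `π 1` and `π 0` are prescribed exactly;
  -- for these two the data are chosen by hand, consistently because `0 ≠ 1`.
  have hch : ∀ φ : FullSemigroup R, ∃ (f : BorelFullSemigroup R) (g : permGroup R.rel)
      (S : Set (Σ k, Fin (n k))), SeparationQuotient.mk f = φ ∧
      (∀ᵐ x ∂μ, x ∈ dom f.1 → f.1 x = some (g.1 x)) ∧
      IsModel (ultraProb U hn) (fun g => Equiv.sigmaCongrRight (σ g)) Q (ε / 11) (dom f.1) S ∧
      (φ = 1 → g = 1 ∧ S = Set.univ) ∧ (φ = 0 → S = ∅) := by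
    intro φ
    have h01 : (0 : FullSemigroup R) ≠ 1 := by
      intro hc
      have h1 : dist (0 : FullSemigroup R) 1 = 1 := by
        change dist (SeparationQuotient.mk (0 : BorelFullSemigroup R))
          (SeparationQuotient.mk 1) = 1
        rw [SeparationQuotient.dist_mk, BorelFullSemigroup.dist_def]
        have : {x | (0 : BorelFullSemigroup R).1 x ≠ (1 : BorelFullSemigroup R).1 x} =
            Set.univ := Set.eq_univ_of_forall fun x hx => Option.some_ne_none x hx.symm
        rw [this, probReal_univ]
      rw [hc, dist_self] at h1
      exact zero_ne_one h1
    by_cases h1 : φ = 1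
    · have hd : dom (1 : BorelFullSemigroup R).1 = Set.univ :=
        Set.eq_univ_of_forall fun x => ⟨x, rfl⟩
      refine ⟨1, 1, Set.univ, h1.symm, Eventually.of_forall fun x _ => rfl, ?_,
        fun _ => ⟨rfl, rfl⟩, fun h0 => absurd (h0.symm.trans h1) h01⟩
      rw [hd]
      exact H.isModel_univ hδ.le
    by_cases h0 : φ = 0
    · have hd : dom (0 : BorelFullSemigroup R).1 = ∅ :=
        Set.eq_empty_of_forall_notMem fun x ⟨y, hy⟩ => Option.some_ne_none y hy.symm
      refine ⟨0, 1, ∅, h0.symm, ?_, ?_, fun h => absurd h h1, fun _ => rfl⟩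
      · rw [hd]
        exact Eventually.of_forall fun x hx => hx.elim
      · rw [hd]
        exact H.isModel_empty hδ.le
    obtain ⟨f, rfl⟩ := SeparationQuotient.surjective_mk φ
    obtain ⟨g, hg⟩ := hγ.exists_perm_of_memBorelFullSemigroup f.2
    obtain ⟨S, hS⟩ := H.exists_isModel h (measurableSet_dom f.2.1) hδ
    exact ⟨f, g, S, rfl, hg, hS, fun h => absurd h h1, fun h => absurd h h0⟩
  choose f g S hf hg hS hS1 hS0 using hch
  have hmul : ∀ φ ψ : FullSemigroup R, (ultraProb U hn).m {ω | ¬ ((ω ∈ S (φ * ψ) ↔ ω ∈ S ψ ∧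
      Equiv.sigmaCongrRight (σ (g ψ)) ω ∈ S φ) ∧ (ω ∈ S (φ * ψ) →
      Equiv.sigmaCongrRight (σ (g (φ * ψ))) ω = Equiv.sigmaCongrRight (σ (g φ))
        (Equiv.sigmaCongrRight (σ (g ψ)) ω)))} < ε := by
    intro φ ψ
    have hfm : ∀ᵐ x ∂μ, (f (φ * ψ)).1 x = ((f ψ).1 x).bind (f φ).1 := by
      have h1 : dist (f (φ * ψ)) (f φ * f ψ) = 0 := by
        rw [← SeparationQuotient.dist_mk, SeparationQuotient.mk_mul, hf, hf, hf, dist_self]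
      rw [BorelFullSemigroup.dist_def, measureReal_eq_zero_iff] at h1
      exact h1
    have hgφ := (R.measurePreserving (g ψ)).quasiMeasurePreserving.ae (hg φ)
    refine (H.mul_le h hδ (measurableSet_dom (f ψ).2.1) (measurableSet_dom (f (φ * ψ)).2.1)
      (hS ψ) (hS φ) (hS (φ * ψ)) ?_ ?_).trans_lt (by linarith)
    · filter_upwards [hfm, hg ψ] with x h1 h2
      constructor
      · rintro ⟨y, hy⟩
        rw [h1, Option.bind_eq_some_iff] at hy
        obtain ⟨z, hz, hzy⟩ := hy
        have h3 := h2 ⟨z, hz⟩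
        rw [hz, Option.some.injEq] at h3
        exact ⟨⟨z, hz⟩, y, h3 ▸ hzy⟩
      · rintro ⟨hx, y, hy⟩
        exact ⟨y, by rw [h1, h2 hx]; exact hy⟩
    · filter_upwards [hfm, hg ψ, hgφ, hg (φ * ψ)] with x h1 h2 h3 h4 hx
      have h5 := h4 hx
      obtain ⟨y, hy⟩ := hx
      have hy' := hy
      rw [h1, Option.bind_eq_some_iff] at hy
      obtain ⟨z, hz, hzy⟩ := hy
      have h6 := h2 ⟨z, hz⟩
      rw [hz, Option.some.injEq] at h6
      subst h6
      have h7 := h3 ⟨y, hzy⟩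
      rw [hzy, Option.some.injEq] at h7
      rw [hy', Option.some.injEq] at h5
      exact h5.symm.trans h7
  have htr : ∀ φ : FullSemigroup R, |φ.tr - (ultraProb U hn).m
      {ω | ω ∈ S φ ∧ Equiv.sigmaCongrRight (σ (g φ)) ω = ω}| < ε := by
    intro φ
    have h1 : φ.tr = μ.real {x | x ∈ dom (f φ).1 ∧ (g φ).1 x = x} := by
      conv_lhs => rw [← hf φ]
      change μ.real {x | (f φ).1 x = some x} = _
      refine measureReal_congr ?_
      filter_upwards [hg φ] with x hx
      refine propext ⟨fun hc => ?_, fun hc => ?_⟩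
      · have h2 := hx ⟨x, hc⟩
        have h3 : (f φ).1 x = some x := hc
        rw [h3, Option.some.injEq] at h2
        exact ⟨⟨x, hc⟩, h2.symm⟩
      · exact (hx hc.1).trans (congrArg some hc.2)
    rw [h1]
    exact (H.abs_trace_sub_le h hδ (measurableSet_dom (f φ).2.1) (hS φ) (g φ)).trans_lt
      (by linarith)
  have hev : ∀ᶠ k in (U : Filter ℕ), (∀ φ ∈ K, ∀ ψ ∈ K, density (fiber {ω |
      ¬ ((ω ∈ S (φ * ψ) ↔ ω ∈ S ψ ∧ Equiv.sigmaCongrRight (σ (g ψ)) ω ∈ S φ) ∧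
      (ω ∈ S (φ * ψ) → Equiv.sigmaCongrRight (σ (g (φ * ψ))) ω =
      Equiv.sigmaCongrRight (σ (g φ)) (Equiv.sigmaCongrRight (σ (g ψ)) ω)))} k) < ε) ∧
      ∀ φ ∈ K, |φ.tr - density (fiber
        {ω | ω ∈ S φ ∧ Equiv.sigmaCongrRight (σ (g φ)) ω = ω} k)| < ε := by
    refine Eventually.and ?_ ?_
    · exact (eventually_all_finite hK).2 fun φ _ => (eventually_all_finite hK).2 fun ψ _ =>
        (tendsto_ultraProb hn _).eventually_lt_const (hmul φ ψ)
    · exact (eventually_all_finite hK).2 fun φ _ =>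
        ((tendsto_ultraProb hn _).const_sub φ.tr).abs.eventually_lt_const (htr φ)
  obtain ⟨k, hkm, hkt⟩ := hev.exists
  let π : FullSemigroup R → (Fin (n k) ≃. Fin (n k)) := fun φ =>
    pequivOn (F := σ (g φ) k) (A := fiber (S φ) k) (σ (g φ) k).injective.injOn
  have hπ : ∀ φ i j, π φ i = some j ↔ (⟨k, i⟩ : Σ k, Fin (n k)) ∈ S φ ∧ σ (g φ) k i = j :=
    fun φ i j => pequivOn_eq_some _
  refine ⟨n k, hn k, π, ⟨?_, ?_⟩, fun φ hφ ψ hψ => ?_, fun φ hφ => ?_⟩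
  · refine PEquiv.ext fun i => (hπ 1 i i).2 ⟨?_, ?_⟩
    · rw [(hS1 1 rfl).2]; trivial
    · rw [(hS1 1 rfl).1, hσ]; rfl
  · refine PEquiv.ext fun i => Option.eq_none_iff_forall_ne_some.2 fun j hj => ?_
    have := ((hπ 0 i j).1 hj).1
    rwa [hS0 0 rfl] at this
  · refine (density_mono fun i hi => ?_).trans_lt (hkm φ hφ ψ hψ)
    rintro ⟨hc, hc'⟩
    refine hi (Option.ext fun j => ?_)
    rw [PEquiv.trans_eq_some, hπ]
    constructor
    · rintro ⟨h1, h2⟩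
      obtain ⟨h3, h4⟩ := hc.1 h1
      have h5 := eq_of_heq (Sigma.mk.inj (hc' h1)).2
      exact ⟨_, (hπ ψ i _).2 ⟨h3, rfl⟩, (hπ φ _ j).2 ⟨h4, h5.symm.trans h2⟩⟩
    · rintro ⟨l, h1, h2⟩
      obtain ⟨h3, rfl⟩ := (hπ ψ i l).1 h1
      obtain ⟨h4, h5⟩ := (hπ φ _ j).1 h2
      have h6 := hc.2 ⟨h3, h4⟩
      exact ⟨h6, (eq_of_heq (Sigma.mk.inj (hc' h6)).2).trans h5⟩
  · have h1 : finTrace (π φ) = density (fiber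
        {ω | ω ∈ S φ ∧ Equiv.sigmaCongrRight (σ (g φ)) ω = ω} k) := by
      rw [finTrace_eq_density]
      refine congrArg density (Set.ext fun i => (hπ φ i i).trans (and_congr Iff.rfl ?_))
      change σ (g φ) k i = i ↔ (⟨k, σ (g φ) k i⟩ : Σ k, Fin (n k)) = ⟨k, i⟩
      simp
    rw [h1]
    exact hkt φ hφ

theorem IsMetricallySofic.isSofic {U : Ultrafilter ℕ} (h : IsMetricallySofic U (fullGroup R))
    (hR : ∀ᵐ x ∂μ, ∃ y, R.rel x y ∧ y ≠ x) : IsSofic R := by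
  obtain ⟨n, hn, θ, hθ⟩ := h
  obtain ⟨γ, hγ⟩ := R.exists_generates
  obtain ⟨τ, hτ, hτ', hτγ⟩ := hγ.exists_involution hR
  obtain ⟨e, he⟩ := exists_measurableEmbedding_real X
  have H : IsPairFlip R τ e := ⟨hτ, hτ', he.measurable, he.injective⟩
  -- The lift of the identity is taken to be the identity itself, not merely equivalent to it, so
  -- that `π 1` is exactly the identity.
  have hex : ∀ g : permGroup R.rel, ∃ σ : PermSeq U n,
      (SeparationQuotient.mk σ : PermUltraproduct U n) = θ (toFullGroup R g) ∧
      (g = 1 → σ = 1) := by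
    intro g
    by_cases hg : g = 1
    · refine ⟨1, ?_, fun _ => rfl⟩
      rw [hg, map_one, map_one, SeparationQuotient.mk_one]
    · obtain ⟨σ, hσ⟩ := SeparationQuotient.surjective_mk (θ (toFullGroup R g))
      exact ⟨σ, hσ, fun hc => absurd hc hg⟩
  choose σ hσ hσ1 using hex
  have hrep := isIsometricRep_of_isometry hn hθ hσ
  -- Any enumeration of `Ω` may serve as the order that defines its sides.
  have hι : Function.Injective (Encodable.encode : (Σ k, Fin (n k)) → ℕ) :=
    Encodable.encode_injective
  exact IsSetRep.isSofic hn hγ (hσ1 1 rfl) hrep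
    { measurableSet := fun hB => Represents.measurableSet hB
      measure_eq := fun hB => hB.measure_eq H hrep hι
      disjoint := fun hB hC k hd => hB.disjoint hC H hrep k hd
      fixes := fun hB k hk => hB.fixes H hrep hk
      exists_approx := fun hA _ hε => exists_represents H hτγ _ Encodable.encode hA hε }

end Sofic

end SoficRel

theorem mainTheorem2 {X : Type*} [MeasurableSpace X] [StandardBorelSpace X]
    (μ : MeasureTheory.Measure X) [MeasureTheory.IsProbabilityMeasure μ] (R : SoficRel.PMPRelation X μ)
    (hR : ∀ᵐ x ∂μ, ∃ y, R.rel x y ∧ y ≠ x)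
    (U : Ultrafilter ℕ) (hU : (U : Filter ℕ) ≤ Filter.cofinite) :
    SoficRel.IsSofic R ↔ SoficRel.IsMetricallySofic U (SoficRel.fullGroup R) :=
  ⟨fun h => h.isMetricallySofic hU, fun h => h.isSofic hR⟩
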